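/- Let $I=(a,b)$ be a bounded interval, let $k\ge 1$ be an integer and $0\le s\le k$ a real number. For real $\sigma\ge 0$ let $H^\sigma(I)$ be the Sobolev space with norm $\|\cdot\|_\sigma$ (the Sobolev–Slobodeckij space if $\sigma$ is not an integer), let $\|\cdot\|$ be the norm of $L^2(I)$, and let $H^1_E(I)=\{v\in H^1(I): v(a)=0\}$. Let $a_2\in H^{1+s}(I)$ with $a_2\ge a_{\min}>0$ and $a_0\in H^1(I)$ with $a_0\ge 0$. Let $f \in L^2(I)$, and let $u\in H^1_E(I)\cap H^{2+s}(I)$ be the solution of $$-(a_2u')'+a_0u=f\ \text{ in } (a,b),\qquad u(a)=0,\quad u'(b)=0 .$$ Let $a=x_1<\dots<x_N=b$ ($N \ge 2$) be a partition with elements $I_i=(x_i,x_{i+1})$ and mesh size $h=\max_i(x_{i+1}-x_i)$, and let $P_l(I_i)$ be the polynomials of degree at most $l$ on $I_i$. Let $S_h$ be the space of all $v=(v^0,v^1,\dots,v^N)$ where $v^0|_{I_i}\in P_k(I_i)$ for every $i$, the nodal values $v^1,\dots,v^N$ are real numbers (not necessarily traces of $v^0$), and $v^1=0$. With $r=k+1$,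 the discrete weak derivative $d_{w,r}v$ of $v\in S_h$ is the piecewise polynomial with $d_{w,r}v|_{I_i}\in P_r(I_i)$ and $$\int_{I_i} d_{w,r}v\,q\,dx=-\int_{I_i}v^0q'\,dx+v^{i+1}q(x_{i+1})-v^iq(x_i)\qquad\text{for all } q\in P_r(I_i),\ i=1,\dots,N-1 .$$ Let $u_h\in S_h$ be the weak finite element solution, that is, $$\sum_{i=1}^{N-1}\int_{I_i}a_2\,d_{w,r}u_h\,d_{w,r}v\,dx+\int_I a_0u_h^0v^0\,dx=\int_I fv^0\,dx\qquad\text{for all } v\in S_h,$$ and let $Q_h^0u$ be the function whose restriction to each $I_i$ is the $L^2(I_i)$-projection of $u|_{I_i}$ onto $P_k(I_i)$. Then there is a constant $C>0$, which may depend on $a,b,k,s,a_{\min},a_2,a_0$ but not on the partition, $f$, $u$ or $u_h$, such that $$\|Q_h^0u-u_h^0\|\le C\,h^{s+2}\,\|u\|_{s+2}.$$ -/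

import Mathlib

open MeasureTheory Set Polynomial
open scoped ContDiff ENNReal

namespace WeakFEM

/-! ### Sobolev spaces on a bounded open interval `(a, b)` -/

/-- Lebesgue measure on the open interval `(a, b)`. -/
noncomputable abbrev vol (a b : ℝ) : Measure ℝ := volume.restrict (Ioo a b)

/-- `g` is a weak derivative of order `j` of `u` on `(a, b)`. -/
def HasWeakDeriv (a b : ℝ) (j : ℕ) (u g : ℝ → ℝ) : Prop :=
  LocallyIntegrableOn u (Ioo a b) ∧ LocallyIntegrableOn g (Ioo a b) ∧
    ∀ φ : ℝ → ℝ, ContDiff ℝ ∞ φ → HasCompactSupport φ → tsupport φ ⊆ Ioo a b →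
      ∫ x in Ioo a b, u x * iteratedDeriv j φ x = (-1) ^ j * ∫ x in Ioo a b, g x * φ x

/-- The weak derivative of order `j` of `u` on `(a, b)`, when there is one (it is then unique up to
equality almost everywhere on `(a, b)`). -/
noncomputable def weakDeriv (a b : ℝ) (j : ℕ) (u : ℝ → ℝ) : ℝ → ℝ :=
  Classical.epsilon fun g => HasWeakDeriv a b j u g

/-- The square of the Sobolev-Slobodeckij seminorm of order `θ ∈ (0, 1)` on `(a, b)`. -/
noncomputable def slobodeckijSq (a b θ : ℝ) (g : ℝ → ℝ) : ℝ≥0∞ :=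
  ∫⁻ x in Ioo a b, ∫⁻ y in Ioo a b, ENNReal.ofReal ((g x - g y) ^ 2 / |x - y| ^ (1 + 2 * θ))

/-- `u` belongs to the Sobolev space `H^σ(a, b)`, for real `σ ≥ 0`: the weak derivatives of order at
most `m = ⌊σ⌋` exist in `L²(a, b)` and, if `σ` is not an integer, the derivative of order `m` has a
finite Slobodeckij seminorm of order `σ - m`. -/
def MemH (a b σ : ℝ) (u : ℝ → ℝ) : Prop :=
  (∀ j ≤ ⌊σ⌋₊, ∃ g, HasWeakDeriv a b j u g ∧ MemLp g 2 (vol a b)) ∧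
    (0 < Int.fract σ → slobodeckijSq a b (Int.fract σ) (weakDeriv a b ⌊σ⌋₊ u) < ⊤)

open Classical in
/-- The norm `‖u‖_σ` of `H^σ(a, b)`. -/
noncomputable def normH (a b σ : ℝ) (u : ℝ → ℝ) : ℝ :=
  Real.sqrt ((∑ j ∈ Finset.range (⌊σ⌋₊ + 1), ∫ x in Ioo a b, weakDeriv a b j u x ^ 2) +
    if 0 < Int.fract σ then
      (slobodeckijSq a b (Int.fract σ) (weakDeriv a b ⌊σ⌋₊ u)).toReal
    else 0)

/-- `u` belongs to `H^1_E(a, b)`, that is, `u ∈ H^1(a, b)` and `u(a) = 0`. The function `u` itself is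
the representative that is continuous on `[a, b]`. -/
def MemHE (a b : ℝ) (u : ℝ → ℝ) : Prop :=
  MemH a b 1 u ∧ ContinuousOn u (Icc a b) ∧ u a = 0

/-! ### The boundary value problem -/

/-- `u ∈ H^1_E(a, b) ∩ H^2(a, b)` solves `-(a₂ u')' + a₀ u = f` on `(a, b)`, `u(a) = 0`, `u'(b) = 0`.
The equation says that the weak derivative of `a₂ u'` is `a₀ u - f`. -/
structure IsSolution (a b : ℝ) (a₂ a₀ f u : ℝ → ℝ) : Prop where
  memHE : MemHE a b u
  memH : MemH a b 2 u
  eqn : HasWeakDeriv a b 1 (fun x => a₂ x * weakDeriv a b 1 u x) (fun x => a₀ x * u x - f x)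
  neumann : HasDerivWithinAt u 0 (Icc a b) b

/-! ### Polynomials on an interval -/

/-- The space `P_r` of polynomials of degree at most `r`. -/
noncomputable abbrev P (r : ℕ) : Submodule ℝ ℝ[X] := Polynomial.degreeLT ℝ (r + 1)

/-- On `P_r`, a linear functional has exactly one representative for the `L²(y, z)` product. -/
theorem existsUnique_representative {y z : ℝ} (hyz : y < z) (r : ℕ) (L : ℝ[X] →ₗ[ℝ] ℝ) :
    ∃! p : ℝ[X], p ∈ P r ∧ ∀ q ∈ P r, ∫ x in y..z, p.eval x * q.eval x = L q := by
  have hint : ∀ p q : ℝ[X],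
      IntervalIntegrable (fun x => p.eval x * q.eval x) volume y z := fun p q =>
    (p.continuous.mul q.continuous).intervalIntegrable _ _
  have hdef : ∀ p : ℝ[X], ∫ x in y..z, p.eval x * p.eval x = 0 → p = 0 := by
    intro p hp
    by_contra hne
    have hpos : 0 < ∫ x in y..z, p.eval x * p.eval x := by
      obtain ⟨c, hc, hcp⟩ : ∃ c ∈ Icc y z, p.eval c ≠ 0 := by
        by_contra hcon
        push Not at hcon
        refine hne (Polynomial.eq_zero_of_infinite_isRoot p ?_)
        exact (Icc_infinite hyz).mono fun x hx => hcon x hx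
      exact intervalIntegral.integral_pos hyz (p.continuous.mul p.continuous).continuousOn
        (fun x _ => mul_self_nonneg _) ⟨c, hc, mul_self_pos.mpr hcp⟩
    exact hpos.ne' hp
  let B : P r →ₗ[ℝ] Module.Dual ℝ (P r) := LinearMap.mk₂ ℝ
    (fun p q => ∫ x in y..z, (p : ℝ[X]).eval x * (q : ℝ[X]).eval x)
    (by
      intro p p' q
      rw [← intervalIntegral.integral_add (hint _ _) (hint _ _)]
      simp [add_mul])
    (by
      intro c p q
      rw [smul_eq_mul, ← intervalIntegral.integral_const_mul]
      simp [mul_assoc])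
    (by
      intro p q q'
      rw [← intervalIntegral.integral_add (hint _ _) (hint _ _)]
      simp [mul_add])
    (by
      intro c p q
      rw [smul_eq_mul, ← intervalIntegral.integral_const_mul]
      simp [mul_left_comm])
  have hBinj : Function.Injective B := by
    rw [← LinearMap.ker_eq_bot, LinearMap.ker_eq_bot']
    intro p hp
    exact Subtype.ext (hdef p (by simpa [B] using LinearMap.congr_fun hp p))
  have : FiniteDimensional ℝ (P r) :=
    Module.Finite.equiv (Polynomial.degreeLTEquiv ℝ (r + 1)).symm
  have hBsurj : Function.Surjective B :=
    (LinearMap.injective_iff_surjective_of_finrank_eq_finrank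
      (Subspace.dual_finrank_eq (K := ℝ) (V := P r)).symm).mp hBinj
  obtain ⟨p, hp⟩ := hBsurj (L.comp (P r).subtype)
  refine ⟨p, ⟨p.2, fun q hq => ?_⟩, ?_⟩
  · simpa [B] using LinearMap.congr_fun hp ⟨q, hq⟩
  · rintro p' ⟨hp', hL⟩
    have : B ⟨p', hp'⟩ = B p := by
      rw [hp]
      ext q
      simpa [B] using hL q q.2
    exact congrArg Subtype.val (hBinj this)

/-- `p ∈ P_r` is the `L²(y, z)`-projection of `u` onto `P_r`. -/
def IsL2Proj (y z : ℝ) (r : ℕ) (u : ℝ → ℝ) (p : ℝ[X]) : Prop :=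
  p ∈ P r ∧ ∀ q ∈ P r, ∫ x in y..z, p.eval x * q.eval x = ∫ x in y..z, u x * q.eval x

theorem existsUnique_isL2Proj {y z : ℝ} (hyz : y < z) (r : ℕ) {u : ℝ → ℝ}
    (hu : IntervalIntegrable u volume y z) : ∃! p : ℝ[X], IsL2Proj y z r u p := by
  have hint : ∀ q : ℝ[X], IntervalIntegrable (fun x => u x * q.eval x) volume y z := fun q =>
    hu.mul_continuousOn q.continuous.continuousOn
  exact existsUnique_representative hyz r
    { toFun := fun q => ∫ x in y..z, u x * q.eval x
      map_add' := by
        intro q q'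
        rw [← intervalIntegral.integral_add (hint _) (hint _)]
        simp [mul_add]
      map_smul' := by
        intro c q
        rw [RingHom.id_apply, smul_eq_mul, ← intervalIntegral.integral_const_mul]
        simp [mul_left_comm] }

/-- The `L²(y, z)`-projection of `u` onto `P_r`. -/
noncomputable def l2Proj (y z : ℝ) (r : ℕ) (u : ℝ → ℝ) : ℝ[X] :=
  Classical.epsilon fun p => IsL2Proj y z r u p

/-- `p ∈ P_r` is the discrete weak derivative on `[y, z]` of the weak function with interior value
`v₀` and endpoint values `vy`, `vz`. -/
def IsDiscreteWeakDeriv (y z : ℝ) (r : ℕ) (v₀ : ℝ[X]) (vy vz : ℝ) (p : ℝ[X]) : Prop :=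
  p ∈ P r ∧ ∀ q ∈ P r, ∫ x in y..z, p.eval x * q.eval x =
    -(∫ x in y..z, v₀.eval x * q.derivative.eval x) + vz * q.eval z - vy * q.eval y

theorem existsUnique_isDiscreteWeakDeriv {y z : ℝ} (hyz : y < z) (r : ℕ) (v₀ : ℝ[X]) (vy vz : ℝ) :
    ∃! p : ℝ[X], IsDiscreteWeakDeriv y z r v₀ vy vz p := by
  have hint : ∀ q : ℝ[X],
      IntervalIntegrable (fun x => v₀.eval x * q.derivative.eval x) volume y z := fun q =>
    (v₀.continuous.mul q.derivative.continuous).intervalIntegrable _ _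
  exact existsUnique_representative hyz r
    { toFun := fun q =>
        -(∫ x in y..z, v₀.eval x * q.derivative.eval x) + vz * q.eval z - vy * q.eval y
      map_add' := by
        intro q q'
        have := intervalIntegral.integral_add (hint q) (hint q')
        simp only [Polynomial.derivative_add, Polynomial.eval_add, mul_add] at this ⊢
        rw [this]
        ring
      map_smul' := by
        intro c q
        have := intervalIntegral.integral_const_mul (a := y) (b := z) (μ := volume) c
          (fun x => v₀.eval x * q.derivative.eval x)
        simp only [Polynomial.derivative_smul, Polynomial.eval_smul, smul_eq_mul,
          RingHom.id_apply, mul_left_comm _ c] at this ⊢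
        rw [this]
        ring }

/-- The discrete weak derivative `d_{w,r} v` of `v = {v₀, vy, vz}` on `[y, z]`. -/
noncomputable def discreteWeakDeriv (y z : ℝ) (r : ℕ) (v₀ : ℝ[X]) (vy vz : ℝ) : ℝ[X] :=
  Classical.epsilon fun p => IsDiscreteWeakDeriv y z r v₀ vy vz p

/-! ### Meshes and the weak finite element method -/

/-- A partition `a = x_0 < x_1 < ⋯ < x_n = b` of `[a, b]` into `n` elements. -/
structure Mesh (a b : ℝ) (n : ℕ) where
  node : Fin (n + 1) → ℝ
  strictMono : StrictMono node
  node_zero : node 0 = a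
  node_last : node (Fin.last n) = b

namespace Mesh

variable {a b : ℝ} {n : ℕ} (T : Mesh a b n)

/-- The left endpoint of the `i`-th element. -/
def lo (i : Fin n) : ℝ := T.node i.castSucc

/-- The right endpoint of the `i`-th element. -/
def hi (i : Fin n) : ℝ := T.node i.succ

/-- The mesh size, the largest length of an element. -/
noncomputable def size : ℝ := ⨆ i : Fin n, (T.hi i - T.lo i)

end Mesh

/-- A weak function on a mesh with `n` elements whose interior values are polynomials: on each
element it has an interior value and two endpoint values. -/
structure WeakFun (n : ℕ) where
  interior : Fin n → ℝ[X]
  left : Fin n → ℝ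
  right : Fin n → ℝ

/-- The weak finite element space `S_h`: interior values of degree at most `k`, the value `0` at the
first node, and no jump at an interior node. -/
structure MemS {n : ℕ} (k : ℕ) (v : WeakFun n) : Prop where
  interior_mem : ∀ i, v.interior i ∈ P k
  left_zero : ∀ i : Fin n, (i : ℕ) = 0 → v.left i = 0
  single_valued : ∀ i j : Fin n, (i : ℕ) + 1 = j → v.right i = v.left j

/-- The discrete weak derivative of `v` on the `i`-th element, in `P_r`. -/
noncomputable def WeakFun.dw {a b : ℝ} {n : ℕ} (T : Mesh a b n) (r : ℕ) (v : WeakFun n)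
    (i : Fin n) : ℝ[X] :=
  discreteWeakDeriv (T.lo i) (T.hi i) r (v.interior i) (v.left i) (v.right i)

/-- `uh ∈ S_h` solves the weak finite element equations
`(a₂ d_{w,r} uh, d_{w,r} v)_h + (a₀ uh⁰, v⁰) = (f, v⁰)` for all `v ∈ S_h`. -/
def IsWeakFESolution {a b : ℝ} {n : ℕ} (T : Mesh a b n) (k r : ℕ) (a₂ a₀ f : ℝ → ℝ)
    (uh : WeakFun n) : Prop :=
  MemS k uh ∧ ∀ v : WeakFun n, MemS k v →
    (∑ i, ∫ x in T.lo i..T.hi i, a₂ x * (uh.dw T r i).eval x * (v.dw T r i).eval x) +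
      (∑ i, ∫ x in T.lo i..T.hi i, a₀ x * (uh.interior i).eval x * (v.interior i).eval x) =
    ∑ i, ∫ x in T.lo i..T.hi i, f x * (v.interior i).eval x

/-- The `L²(a, b)` norm `‖Q_h⁰ u - uh⁰‖`, where `Q_h⁰ u` is on each element the `L²`-projection of `u`
onto `P_k`. -/
noncomputable def interiorError {a b : ℝ} {n : ℕ} (T : Mesh a b n) (k : ℕ) (u : ℝ → ℝ)
    (uh : WeakFun n) : ℝ :=
  Real.sqrt (∑ i, ∫ x in T.lo i..T.hi i,
    ((l2Proj (T.lo i) (T.hi i) k u).eval x - (uh.interior i).eval x) ^ 2)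

end WeakFEM

namespace WeakFEM

/-! ### Square integrable functions on an interval -/

/-! Let `A`, `E`, `U` be the continuous representatives of the coefficients and of the solution, `V
= U'`, `Ψ = (A V)' = E U - f`, let `Q` denote elementwise projections, and let `e = Q_h u - u_h` in
`S_h`. Since `r = k + 1`, the discrete weak derivative commutes with projection: that of `Q_h u` is
`Q V` in `P_{k+1}` (`isDiscreteWeakDeriv_l2Proj`). Let `Φ` be the continuous piecewise polynomial
that equals `A V` at the nodes and has derivative `Q Ψ` in `P_k` (`flux`). Summation by parts gives
`(d_w v, Φ) = -(Ψ, v⁰)`; the boundary terms vanish because `v(a) = 0` and `u'(b) = 0`. Hence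
(`error_identity`) `(A d_w e, d_w v) + (E e⁰, v⁰) = (A (Q V - V), d_w v) + (A V - Φ, d_w v) + (E (Q
U - U), v⁰)`.

The duality argument is entirely discrete. A weak function in `S_h` is determined by its discrete
weak derivative, which can be any piecewise polynomial of degree `k + 1` (`dw_ofDeriv`,
`MemS.interior_eq`). So the dual problem with right side `e⁰` is a square linear system for a
derivative `ζ`, and testing the error equation with the weak function of derivative `ζ` turns its
left side into `‖e⁰‖²`. Elliptic regularity is replaced by `exists_dual_bounds`: `ζ` and its weak
function are bounded pointwise by `C ‖e⁰‖`, and on the element of length `h_i` the function `ζ` is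
within `h_i R_i` of a constant, where the `ℓ²` norm of `R` is at most `C ‖e⁰‖`. This holds because
`A ζ + τ` is orthogonal to `P_{k+1}` on every element for a flux `τ` whose derivative is controlled
in `L²`.

The three terms are then of order `h^{s+2} ‖e⁰‖`. In the first and third, the projection errors are
`O(h^{s+1})` and orthogonal to polynomials, so the coefficient may be replaced by its variation over
the element, which gains one power of `h` from `A', E' ∈ L²`. In the second, `A V - Φ` vanishes at
the ends of each element and, as `k ≥ 1`, has mean zero; it is `O(h · h^s)` and pairs with `ζ` minus
a constant, which gains another `h`. Cauchy-Schwarz over the elements, and division by `‖e⁰‖`,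
finish the proof for arbitrary meshes.

The approximation orders come from `Approx`: local squared errors are bounded by `ℓ^{2α} ∫ ρ` with
one integrable density `ρ`, and each integration raises order and degree by one (`Approx.lift`). At
the bottom, the top derivative is compared with its means by the Slobodeckij seminorm. For `Ψ` this
requires products of functions of fractional smoothness: `Reg.mul` handles them, at the price of a
growth bound for the approximating constants, obtained by comparing means over doubled intervals
(`abs_mean_le_rpow`). -/

theorem integral_Ioo_eq_interval {c d : ℝ} (hcd : c ≤ d) (f : ℝ → ℝ) :
    ∫ x in Ioo c d, f x = ∫ x in c..d, f x := by
  rw [intervalIntegral.integral_of_le hcd, integral_Ioc_eq_integral_Ioo]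

theorem intervalIntegrable_of_integrable_vol {c d : ℝ} (hcd : c ≤ d) {f : ℝ → ℝ}
    (hf : Integrable f (vol c d)) : IntervalIntegrable f volume c d := by
  rw [intervalIntegrable_iff_integrableOn_Ioo_of_le hcd]
  exact hf

theorem memLp_sub {a b c d : ℝ} {f : ℝ → ℝ} (hf : MemLp f 2 (vol a b)) (hac : a ≤ c)
    (hdb : d ≤ b) : MemLp f 2 (vol c d) :=
  hf.mono_measure (Measure.restrict_mono (Ioo_subset_Ioo hac hdb) le_rfl)

theorem memLp_intervalIntegrable {c d : ℝ} {f : ℝ → ℝ} (hf : MemLp f 2 (vol c d)) (hcd : c ≤ d) :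
    IntervalIntegrable f volume c d :=
  intervalIntegrable_of_integrable_vol hcd (hf.integrable one_le_two)

theorem memLp_intervalIntegrable_mul {c d : ℝ} {f g : ℝ → ℝ} (hf : MemLp f 2 (vol c d))
    (hg : MemLp g 2 (vol c d)) (hcd : c ≤ d) :
    IntervalIntegrable (fun x => f x * g x) volume c d :=
  intervalIntegrable_of_integrable_vol hcd (hf.integrable_mul hg)

theorem memLp_intervalIntegrable_sq {c d : ℝ} {f : ℝ → ℝ} (hf : MemLp f 2 (vol c d))
    (hcd : c ≤ d) : IntervalIntegrable (fun x => f x ^ 2) volume c d :=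
  intervalIntegrable_of_integrable_vol hcd hf.integrable_sq

theorem memLp_mul_of_continuousOn {c d : ℝ} {f g : ℝ → ℝ} (hf : MemLp f 2 (vol c d))
    (hg : ContinuousOn g (Icc c d)) : MemLp (fun x => g x * f x) 2 (vol c d) := by
  obtain ⟨M, hM⟩ := isCompact_Icc.exists_bound_of_continuousOn hg
  have hgm : AEStronglyMeasurable g (vol c d) :=
    (hg.mono Ioo_subset_Icc_self).aestronglyMeasurable measurableSet_Ioo
  refine MemLp.of_le_mul (c := M) hf (hgm.mul hf.1) ?_
  filter_upwards [ae_restrict_mem measurableSet_Ioo] with x hx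
  rw [norm_mul]
  exact mul_le_mul_of_nonneg_right (hM x (Ioo_subset_Icc_self hx)) (norm_nonneg _)

theorem memLp_of_continuousOn {c d : ℝ} {g : ℝ → ℝ} (hg : ContinuousOn g (Icc c d)) :
    MemLp g 2 (vol c d) := by
  have : IsFiniteMeasure (vol c d) := ⟨by simp⟩
  simpa using memLp_mul_of_continuousOn (memLp_const (1 : ℝ) : MemLp _ 2 (vol c d)) hg

theorem memLp_eval (c d : ℝ) (q : ℝ[X]) : MemLp (fun x => q.eval x) 2 (vol c d) :=
  memLp_of_continuousOn q.continuous.continuousOn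

theorem memLp_const_vol (c d r : ℝ) : MemLp (fun _ => r) 2 (vol c d) :=
  memLp_of_continuousOn continuousOn_const

/-- The `L²(c, d)` norm. -/
noncomputable def nrm (c d : ℝ) (f : ℝ → ℝ) : ℝ := Real.sqrt (∫ x in c..d, f x ^ 2)

theorem nrm_nonneg (c d : ℝ) (f : ℝ → ℝ) : 0 ≤ nrm c d f := Real.sqrt_nonneg _

theorem integral_sq_nonneg {c d : ℝ} (hcd : c ≤ d) (f : ℝ → ℝ) : 0 ≤ ∫ x in c..d, f x ^ 2 :=
  intervalIntegral.integral_nonneg hcd fun _ _ => sq_nonneg _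

theorem nrm_sq {c d : ℝ} (hcd : c ≤ d) (f : ℝ → ℝ) : nrm c d f ^ 2 = ∫ x in c..d, f x ^ 2 :=
  Real.sq_sqrt (integral_sq_nonneg hcd f)

theorem sq_integral_mul_le {c d : ℝ} (hcd : c ≤ d) {f g : ℝ → ℝ} (hf : MemLp f 2 (vol c d))
    (hg : MemLp g 2 (vol c d)) :
    (∫ x in c..d, f x * g x) ^ 2 ≤ (∫ x in c..d, f x ^ 2) * ∫ x in c..d, g x ^ 2 := by
  have hfg := memLp_intervalIntegrable_mul hf hg hcd
  have hff := memLp_intervalIntegrable_sq hf hcd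
  have hgg := memLp_intervalIntegrable_sq hg hcd
  -- Cauchy-Schwarz from the discriminant of the nonnegative quadratic `t ↦ ∫ (f + t g)²`.
  have key : ∀ t : ℝ, 0 ≤ (∫ x in c..d, g x ^ 2) * (t * t) + (2 * ∫ x in c..d, f x * g x) * t +
      ∫ x in c..d, f x ^ 2 := by
    intro t
    have : (∫ x in c..d, g x ^ 2) * (t * t) + (2 * ∫ x in c..d, f x * g x) * t +
        ∫ x in c..d, f x ^ 2 = ∫ x in c..d, (f x + t * g x) ^ 2 := by
      have e : ∀ x, (f x + t * g x) ^ 2 = (t * t) * g x ^ 2 + (2 * t) * (f x * g x) + f x ^ 2 :=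
        fun x => by ring
      simp only [e]
      rw [intervalIntegral.integral_add ((hgg.const_mul _).add (hfg.const_mul _)) hff,
        intervalIntegral.integral_add (hgg.const_mul _) (hfg.const_mul _),
        intervalIntegral.integral_const_mul, intervalIntegral.integral_const_mul]
      ring
    rw [this]
    exact integral_sq_nonneg hcd _
  have := discrim_le_zero key
  simp only [discrim] at this
  nlinarith

theorem abs_integral_mul_le {c d : ℝ} (hcd : c ≤ d) {f g : ℝ → ℝ} (hf : MemLp f 2 (vol c d))
    (hg : MemLp g 2 (vol c d)) : |∫ x in c..d, f x * g x| ≤ nrm c d f * nrm c d g := by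
  refine abs_le_of_sq_le_sq ?_ (mul_nonneg (nrm_nonneg _ _ _) (nrm_nonneg _ _ _))
  rw [mul_pow, nrm_sq hcd, nrm_sq hcd]
  exact sq_integral_mul_le hcd hf hg

theorem nrm_congr {c d : ℝ} {f g : ℝ → ℝ} (h : ∀ᵐ x ∂vol c d, f x = g x) (hcd : c ≤ d) :
    nrm c d f = nrm c d g := by
  unfold nrm
  rw [← integral_Ioo_eq_interval hcd, ← integral_Ioo_eq_interval hcd]
  congr 1
  refine integral_congr_ae ?_
  filter_upwards [h] with x hx
  rw [hx]

theorem nrm_add_le {c d : ℝ} (hcd : c ≤ d) {f g : ℝ → ℝ} (hf : MemLp f 2 (vol c d))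
    (hg : MemLp g 2 (vol c d)) : nrm c d (fun x => f x + g x) ≤ nrm c d f + nrm c d g := by
  have hfg := memLp_intervalIntegrable_mul hf hg hcd
  have hff := memLp_intervalIntegrable_sq hf hcd
  have hgg := memLp_intervalIntegrable_sq hg hcd
  refine abs_le_of_sq_le_sq' ?_ (add_nonneg (nrm_nonneg _ _ _) (nrm_nonneg _ _ _)) |>.2
  have : nrm c d (fun x => f x + g x) ^ 2 =
      nrm c d f ^ 2 + 2 * (∫ x in c..d, f x * g x) + nrm c d g ^ 2 := by
    rw [nrm_sq hcd, nrm_sq hcd, nrm_sq hcd]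
    have e : ∀ x, (f x + g x) ^ 2 = f x ^ 2 + 2 * (f x * g x) + g x ^ 2 := fun x => by ring
    simp only [e]
    rw [intervalIntegral.integral_add (hff.add (hfg.const_mul _)) hgg,
        intervalIntegral.integral_add hff (hfg.const_mul _),
        intervalIntegral.integral_const_mul]
  rw [this]
  have := (le_abs_self _).trans (abs_integral_mul_le hcd hf hg)
  nlinarith

theorem nrm_const_mul {c d : ℝ} (r : ℝ) (f : ℝ → ℝ) :
    nrm c d (fun x => r * f x) = |r| * nrm c d f := by
  unfold nrm
  simp only [mul_pow]
  rw [intervalIntegral.integral_const_mul, Real.sqrt_mul (sq_nonneg _), Real.sqrt_sq_eq_abs]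

theorem integral_sq_mono {c d : ℝ} (hcd : c ≤ d) {f g : ℝ → ℝ} (hf : MemLp f 2 (vol c d))
    (hg : MemLp g 2 (vol c d)) (h : ∀ᵐ x ∂vol c d, |f x| ≤ |g x|) :
    ∫ x in c..d, f x ^ 2 ≤ ∫ x in c..d, g x ^ 2 := by
  rw [← integral_Ioo_eq_interval hcd, ← integral_Ioo_eq_interval hcd]
  refine integral_mono_ae hf.integrable_sq hg.integrable_sq ?_
  filter_upwards [h] with x hx
  exact sq_le_sq.mpr hx

theorem nrm_le_mul {c d M : ℝ} (hcd : c ≤ d) {f g : ℝ → ℝ} (hM : 0 ≤ M) (hf : MemLp f 2 (vol c d))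
    (hg : MemLp g 2 (vol c d)) (h : ∀ᵐ x ∂vol c d, |f x| ≤ M * |g x|) :
    nrm c d f ≤ M * nrm c d g := by
  rw [← abs_of_nonneg hM, ← nrm_const_mul]
  refine Real.sqrt_le_sqrt (integral_sq_mono hcd hf (hg.const_mul M) ?_)
  filter_upwards [h] with x hx
  rwa [abs_mul, abs_of_nonneg hM]

theorem nrm_const {c d : ℝ} (hcd : c ≤ d) (r : ℝ) :
    nrm c d (fun _ => r) = |r| * Real.sqrt (d - c) := by
  unfold nrm
  rw [intervalIntegral.integral_const, smul_eq_mul, Real.sqrt_mul (by linarith),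
    Real.sqrt_sq_eq_abs, mul_comm]

theorem nrm_mono {a b c d : ℝ} {f : ℝ → ℝ} (hf : MemLp f 2 (vol a b)) (hac : a ≤ c)
    (hcd : c ≤ d) (hdb : d ≤ b) : nrm c d f ≤ nrm a b f := by
  refine Real.sqrt_le_sqrt ?_
  exact intervalIntegral.integral_mono_interval hac hcd hdb
    (Filter.Eventually.of_forall fun _ => sq_nonneg _)
    (memLp_intervalIntegrable_sq hf (hac.trans (hcd.trans hdb)))

theorem nrm_le_of_sq_le {c d M : ℝ} {f : ℝ → ℝ} (hM : 0 ≤ M) (h : ∫ x in c..d, f x ^ 2 ≤ M ^ 2) :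
    nrm c d f ≤ M := by
  rw [← Real.sqrt_sq hM]
  exact Real.sqrt_le_sqrt h

theorem abs_integral_le_nrm {c d : ℝ} (hcd : c ≤ d) {f : ℝ → ℝ} (hf : MemLp f 2 (vol c d)) :
    |∫ x in c..d, f x| ≤ Real.sqrt (d - c) * nrm c d f := by
  have := abs_integral_mul_le hcd (memLp_const_vol c d 1) hf
  simpa [nrm_const hcd] using this

/-! ### Primitives of square integrable functions -/

/-- `F` is a primitive on `[a, b]` of the square integrable function `f`. -/
structure Prim (a b : ℝ) (F f : ℝ → ℝ) : Prop where
  memLp : MemLp f 2 (vol a b)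
  ftc : ∀ x ∈ Icc a b, F x = F a + ∫ t in a..x, f t

namespace Prim

variable {a b : ℝ} {F f G g : ℝ → ℝ}

theorem intervalIntegrable (h : Prim a b F f) {x y : ℝ} (hx : x ∈ Icc a b) (hy : y ∈ Icc a b) :
    IntervalIntegrable f volume x y := by
  refine (memLp_intervalIntegrable h.memLp (hx.1.trans hx.2)).mono_set ?_
  rw [uIcc_of_le (hx.1.trans hx.2)]
  exact uIcc_subset_Icc hx hy

theorem integral_eq (h : Prim a b F f) {x y : ℝ} (hx : x ∈ Icc a b) (hy : y ∈ Icc a b) :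
    ∫ t in x..y, f t = F y - F x := by
  have ha : a ∈ Icc a b := ⟨le_rfl, hx.1.trans hx.2⟩
  have := intervalIntegral.integral_add_adjacent_intervals (h.intervalIntegrable ha hx)
    (h.intervalIntegrable hx hy)
  rw [h.ftc x hx, h.ftc y hy]
  linarith

theorem mono (h : Prim a b F f) {c d : ℝ} (hac : a ≤ c) (hdb : d ≤ b) : Prim c d F f where
  memLp := memLp_sub h.memLp hac hdb
  ftc x hx := by
    have := h.integral_eq (x := c) (y := x) ⟨hac, hx.1.trans (hx.2.trans hdb)⟩
      ⟨hac.trans hx.1, hx.2.trans hdb⟩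
    linarith

theorem continuousOn (h : Prim a b F f) : ContinuousOn F (Icc a b) := by
  rcases lt_or_ge b a with hab | hab
  · simp [Icc_eq_empty_of_lt hab]
  have hi := memLp_intervalIntegrable h.memLp hab
  rw [intervalIntegrable_iff_integrableOn_Icc_of_le hab] at hi
  have := intervalIntegral.continuousOn_primitive_interval (f := f) (μ := volume)
    (a := a) (b := b) (by rwa [uIcc_of_le hab])
  rw [uIcc_of_le hab] at this
  exact (continuousOn_const.add this).congr h.ftc

theorem memLp_self (h : Prim a b F f) : MemLp F 2 (vol a b) := memLp_of_continuousOn h.continuousOn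

theorem congr_deriv (h : Prim a b F f) (hfg : ∀ᵐ x ∂vol a b, f x = g x) : Prim a b F g where
  memLp := (memLp_congr_ae hfg).mp h.memLp
  ftc x hx := by
    rw [h.ftc x hx, ← integral_Ioo_eq_interval hx.1, ← integral_Ioo_eq_interval hx.1]
    congr 1
    refine integral_congr_ae ?_
    exact (ae_mono (Measure.restrict_mono (Ioo_subset_Ioo le_rfl hx.2) le_rfl)) hfg

theorem abs_sub_le (h : Prim a b F f) {x : ℝ} (hx : x ∈ Icc a b) :
    |F x - F a| ≤ Real.sqrt (b - a) * nrm a b f := by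
  have ha : a ∈ Icc a b := ⟨le_rfl, hx.1.trans hx.2⟩
  rw [← h.integral_eq ha hx]
  refine (abs_integral_le_nrm hx.1 (memLp_sub h.memLp le_rfl hx.2)).trans ?_
  gcongr
  · exact nrm_nonneg _ _ _
  · exact hx.2
  · exact nrm_mono h.memLp le_rfl hx.1 hx.2

/-- Poincaré's inequality for functions shifted to vanish at the left endpoint. -/
theorem nrm_sub_le (h : Prim a b F f) (hab : a ≤ b) :
    nrm a b (fun x => F x - F a) ≤ (b - a) * nrm a b f := by
  have := nrm_le_mul (f := fun x => F x - F a) (g := fun _ => (1 : ℝ)) hab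
    (M := Real.sqrt (b - a) * nrm a b f)
    (mul_nonneg (Real.sqrt_nonneg _) (nrm_nonneg _ _ _))
    (h.memLp_self.sub (memLp_const_vol _ _ _)) (memLp_const_vol _ _ _) (by
      filter_upwards [ae_restrict_mem measurableSet_Ioo] with x hx
      simpa using h.abs_sub_le (Ioo_subset_Icc_self hx))
  rw [nrm_const hab, abs_one, one_mul] at this
  calc _ ≤ _ := this
    _ = (Real.sqrt (b - a) * Real.sqrt (b - a)) * nrm a b f := by ring
    _ = _ := by rw [Real.mul_self_sqrt (by linarith)]

/-- A pointwise bound by the norms of the function and its derivative. -/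
theorem abs_le (h : Prim a b F f) (hab : a < b) {x : ℝ} (hx : x ∈ Icc a b) :
    |F x| ≤ (Real.sqrt (b - a))⁻¹ * nrm a b F + 2 * Real.sqrt (b - a) * nrm a b f := by
  have hs : 0 < Real.sqrt (b - a) := Real.sqrt_pos.mpr (by linarith)
  have h1 := h.abs_sub_le hx
  -- The left side is the `L²` norm of the constant `F a = F + (F a - F)`.
  have h2 : |F a| * Real.sqrt (b - a) ≤ nrm a b F + (b - a) * nrm a b f := by
    rw [← nrm_const hab.le]
    have := nrm_add_le (g := fun x => F a - F x) hab.le h.memLp_self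
      ((memLp_const_vol a b (F a)).sub h.memLp_self)
    simp only [add_sub_cancel] at this
    refine this.trans (add_le_add le_rfl ?_)
    have : nrm a b (fun x => F a - F x) = nrm a b (fun x => F x - F a) := by
      unfold nrm
      simp only [sub_sq_comm]
    rw [this]
    exact h.nrm_sub_le hab.le
  have h4 : |F a| ≤ (Real.sqrt (b - a))⁻¹ * nrm a b F + Real.sqrt (b - a) * nrm a b f := by
    rw [← le_div_iff₀ hs] at h2
    refine h2.trans (le_of_eq ?_)
    have : (b - a) = Real.sqrt (b - a) * Real.sqrt (b - a) :=
      (Real.mul_self_sqrt (by linarith)).symm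
    field_simp
    rw [Real.sq_sqrt (by linarith)]
    ring
  have := abs_add_le (F x - F a) (F a)
  rw [sub_add_cancel] at this
  linarith

/-- `F` is arbitrary outside `[a, b]`, so its two-sided derivative at the ends is out of control.
The globally defined primitive replaces it when integrating by parts. -/
theorem exists_absolutelyContinuous (h : Prim a b F f) (hab : a ≤ b) :
    ∃ F' : ℝ → ℝ, AbsolutelyContinuousOnInterval F' a b ∧ (∀ x ∈ Icc a b, F' x = F x) ∧
      ∀ᵐ x, x ∈ Icc a b → deriv F' x = f x := by
  have hi := memLp_intervalIntegrable h.memLp hab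
  refine ⟨fun x => F a + ∫ t in a..x, f t, ?_, fun x hx => (h.ftc x hx).symm, ?_⟩
  · have h1 := hi.absolutelyContinuousOnInterval_intervalIntegral (c := a) left_mem_uIcc
    have h2 : AbsolutelyContinuousOnInterval (fun _ : ℝ => F a) a b :=
      contDiffOn_const.absolutelyContinuousOnInterval
    exact h2.fun_add h1
  · filter_upwards [hi.ae_hasDerivAt_integral] with x hx hxI
    rw [← uIcc_of_le hab] at hxI
    exact ((hx hxI a left_mem_uIcc).const_add (F a)).deriv

theorem mul (hF : Prim a b F f) (hG : Prim a b G g) :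
    Prim a b (fun x => F x * G x) (fun x => F x * g x + f x * G x) where
  memLp := by
    refine (memLp_mul_of_continuousOn hG.memLp hF.continuousOn).add ?_
    have := memLp_mul_of_continuousOn hF.memLp hG.continuousOn
    simpa only [mul_comm] using this
  ftc x hx := by
    obtain ⟨F', hFa, hFe, hFd⟩ := (hF.mono le_rfl hx.2).exists_absolutelyContinuous hx.1
    obtain ⟨G', hGa, hGe, hGd⟩ := (hG.mono le_rfl hx.2).exists_absolutelyContinuous hx.1
    have hxx : x ∈ Icc a x := ⟨hx.1, le_rfl⟩
    have haa : a ∈ Icc a x := ⟨le_rfl, hx.1⟩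
    have := hFa.integral_deriv_mul_eq_sub hGa
    rw [hFe x hxx, hGe x hxx, hFe a haa, hGe a haa] at this
    rw [← sub_eq_iff_eq_add', ← this]
    refine intervalIntegral.integral_congr_ae ?_
    filter_upwards [hFd, hGd] with t h1 h2 ht
    have ht' : t ∈ Icc a x := by
      rw [uIoc_of_le hx.1] at ht
      exact Ioc_subset_Icc_self ht
    rw [h1 ht', h2 ht', hFe t ht', hGe t ht']
    ring

theorem add (hF : Prim a b F f) (hG : Prim a b G g) :
    Prim a b (fun x => F x + G x) (fun x => f x + g x) where
  memLp := hF.memLp.add hG.memLp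
  ftc x hx := by
    have ha : a ∈ Icc a b := ⟨le_rfl, hx.1.trans hx.2⟩
    rw [intervalIntegral.integral_add (hF.intervalIntegrable ha hx) (hG.intervalIntegrable ha hx),
      hF.ftc x hx, hG.ftc x hx]
    ring

theorem const_mul (hF : Prim a b F f) (r : ℝ) :
    Prim a b (fun x => r * F x) (fun x => r * f x) where
  memLp := hF.memLp.const_mul r
  ftc x hx := by
    rw [intervalIntegral.integral_const_mul, hF.ftc x hx]
    ring

theorem sum {ι : Type*} (s : Finset ι) {F f : ι → ℝ → ℝ} (h : ∀ i ∈ s, Prim a b (F i) (f i)) :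
    Prim a b (fun x => ∑ i ∈ s, F i x) (fun x => ∑ i ∈ s, f i x) := by
  classical
  induction s using Finset.induction_on with
  | empty => exact ⟨by simp, by simp⟩
  | insert i s hi ih =>
    simp only [Finset.sum_insert hi]
    exact (h i (Finset.mem_insert_self _ _)).add
      (ih fun j hj => h j (Finset.mem_insert_of_mem hj))

theorem of_polynomial (a b : ℝ) (q : ℝ[X]) :
    Prim a b (fun x => q.eval x) (fun x => q.derivative.eval x) where
  memLp := memLp_eval _ _ _
  ftc x _ := by
    rw [intervalIntegral.integral_eq_sub_of_hasDerivAt (fun t _ => q.hasDerivAt t)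
      (q.derivative.continuous.intervalIntegrable _ _)]
    ring

end Prim

/-! ### Weak derivatives -/

theorem integrableOn_mul_test {a b : ℝ} {g φ : ℝ → ℝ} (hg : LocallyIntegrableOn g (Ioo a b))
    (hφ : Continuous φ) (hc : HasCompactSupport φ) (hs : tsupport φ ⊆ Ioo a b) :
    IntegrableOn (fun x => g x * φ x) (Ioo a b) := by
  have h1 : IntegrableOn g (tsupport φ) := hg.integrableOn_compact_subset hs hc
  have h2 : IntegrableOn (fun x => g x * φ x) (tsupport φ) :=
    h1.mul_continuousOn hφ.continuousOn hc
  rw [integrableOn_iff_integrable_of_support_subset] at h2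
  · exact h2.integrableOn
  · intro x hx
    exact subset_tsupport _ (right_ne_zero_of_mul hx)

theorem ae_eq_zero_of_integral_test_eq_zero {a b : ℝ} {v : ℝ → ℝ}
    (hv : LocallyIntegrableOn v (Ioo a b))
    (h : ∀ φ : ℝ → ℝ, ContDiff ℝ ∞ φ → HasCompactSupport φ → tsupport φ ⊆ Ioo a b →
      ∫ x in Ioo a b, v x * φ x = 0) : ∀ᵐ x ∂vol a b, v x = 0 := by
  rw [ae_restrict_iff' measurableSet_Ioo]
  refine isOpen_Ioo.ae_eq_zero_of_integral_contDiff_smul_eq_zero hv fun φ h1 h2 h3 => ?_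
  rw [← h φ h1 h2 h3, setIntegral_eq_integral_of_forall_compl_eq_zero]
  · simp only [smul_eq_mul, mul_comm]
  · intro x hx
    rw [image_eq_zero_of_notMem_tsupport (fun hx' => hx (h3 hx')), mul_zero]

theorem HasWeakDeriv.ae_unique {a b : ℝ} {j : ℕ} {u g g' : ℝ → ℝ} (h : HasWeakDeriv a b j u g)
    (h' : HasWeakDeriv a b j u g') : ∀ᵐ x ∂vol a b, g x = g' x := by
  have := ae_eq_zero_of_integral_test_eq_zero (v := fun x => g x - g' x) (h.2.1.sub h'.2.1)
    (fun φ h1 h2 h3 => by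
      have e := (h.2.2 φ h1 h2 h3).symm.trans (h'.2.2 φ h1 h2 h3)
      have e' := mul_left_cancel₀ (pow_ne_zero j (by norm_num : (-1 : ℝ) ≠ 0)) e
      simp only [sub_mul]
      rw [integral_sub (integrableOn_mul_test h.2.1 h1.continuous h2 h3)
        (integrableOn_mul_test h'.2.1 h1.continuous h2 h3), e', sub_self])
  filter_upwards [this] with x hx
  linarith

theorem weakDeriv_spec {a b : ℝ} {j : ℕ} {u g : ℝ → ℝ} (h : HasWeakDeriv a b j u g) :
    HasWeakDeriv a b j u (weakDeriv a b j u) :=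
  Classical.epsilon_spec (p := fun g => HasWeakDeriv a b j u g) ⟨g, h⟩

theorem HasWeakDeriv.ae_eq_weakDeriv {a b : ℝ} {j : ℕ} {u g : ℝ → ℝ} (h : HasWeakDeriv a b j u g) :
    ∀ᵐ x ∂vol a b, g x = weakDeriv a b j u x :=
  h.ae_unique (weakDeriv_spec h)

theorem HasWeakDeriv.congr_left {a b : ℝ} {j : ℕ} {u v g : ℝ → ℝ} (h : HasWeakDeriv a b j u g)
    (huv : ∀ᵐ x ∂vol a b, u x = v x) (hv : LocallyIntegrableOn v (Ioo a b)) :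
    HasWeakDeriv a b j v g := by
  refine ⟨hv, h.2.1, fun φ h1 h2 h3 => ?_⟩
  rw [← h.2.2 φ h1 h2 h3]
  refine integral_congr_ae ?_
  filter_upwards [huv] with x hx
  rw [hx]

theorem HasWeakDeriv.zero {a b : ℝ} {u g : ℝ → ℝ} (h : HasWeakDeriv a b 0 u g) :
    ∀ᵐ x ∂vol a b, u x = g x := by
  refine HasWeakDeriv.ae_unique (j := 0) (u := u) ⟨h.1, h.1, fun φ _ _ _ => ?_⟩ h
  simp

/-- The identity of order `j` is tested with `φ'`. Weak derivatives of all orders thereby form a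
chain of first order ones. -/
theorem HasWeakDeriv.succ {a b : ℝ} {j : ℕ} {u g g' : ℝ → ℝ} (h : HasWeakDeriv a b j u g)
    (h' : HasWeakDeriv a b (j + 1) u g') : HasWeakDeriv a b 1 g g' := by
  refine ⟨h.2.1, h'.2.1, fun φ h1 h2 h3 => ?_⟩
  have e := h'.2.2 φ h1 h2 h3
  have e' := h.2.2 (deriv φ) ((contDiff_infty_iff_deriv.mp h1).2) h2.deriv
    ((closure_minimal (support_deriv_subset) (isClosed_tsupport φ)).trans h3)
  rw [iteratedDeriv_succ', e'] at e
  rw [iteratedDeriv_one]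
  have hne : ((-1 : ℝ)) ^ j ≠ 0 := pow_ne_zero j (by norm_num)
  apply mul_left_cancel₀ hne
  rw [e]
  ring

theorem memLp_locallyIntegrableOn {a b : ℝ} {g : ℝ → ℝ} (hg : MemLp g 2 (vol a b)) :
    LocallyIntegrableOn g (Ioo a b) :=
  IntegrableOn.locallyIntegrableOn (hg.integrable one_le_two)

theorem prim_of_contDiff (a b : ℝ) {φ : ℝ → ℝ} (hφ : ContDiff ℝ ∞ φ) : Prim a b φ (deriv φ) where
  memLp := memLp_of_continuousOn (hφ.continuous_deriv (by simp)).continuousOn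
  ftc x _ := by
    rw [intervalIntegral.integral_deriv_eq_sub (fun t _ => hφ.differentiable (by simp) t)
      ((hφ.continuous_deriv (by simp)).intervalIntegrable _ _)]
    ring

theorem Prim.hasWeakDeriv {a b : ℝ} {F f : ℝ → ℝ} (hab : a ≤ b) (h : Prim a b F f) :
    HasWeakDeriv a b 1 F f := by
  refine ⟨memLp_locallyIntegrableOn h.memLp_self, memLp_locallyIntegrableOn h.memLp,
    fun φ h1 h2 h3 => ?_⟩
  have hp := prim_of_contDiff a b h1
  have hza : φ a = 0 := image_eq_zero_of_notMem_tsupport fun hx => lt_irrefl _ (h3 hx).1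
  have hzb : φ b = 0 := image_eq_zero_of_notMem_tsupport fun hx => lt_irrefl _ (h3 hx).2
  have := (h.mul hp).integral_eq (x := a) (y := b) ⟨le_rfl, hab⟩ ⟨hab, le_rfl⟩
  rw [intervalIntegral.integral_add (memLp_intervalIntegrable_mul h.memLp_self hp.memLp hab)
    (memLp_intervalIntegrable_mul h.memLp hp.memLp_self hab), hza, hzb] at this
  rw [iteratedDeriv_one, integral_Ioo_eq_interval hab, integral_Ioo_eq_interval hab]
  linarith

theorem exists_bump {a b : ℝ} (hab : a < b) : ∃ φ : ℝ → ℝ, ContDiff ℝ ∞ φ ∧ HasCompactSupport φ ∧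
    tsupport φ ⊆ Ioo a b ∧ ∫ x, φ x = 1 := by
  let B : ContDiffBump ((a + b) / 2) := ⟨(b - a) / 8, (b - a) / 4, by linarith, by linarith⟩
  refine ⟨B.normed volume, B.contDiff_normed, B.hasCompactSupport_normed, ?_, B.integral_normed⟩
  rw [B.tsupport_normed_eq]
  intro x hx
  rw [Metric.mem_closedBall, Real.dist_eq, abs_le] at hx
  have h1 : -((b - a) / 4) ≤ x - (a + b) / 2 := hx.1
  have h2 : x - (a + b) / 2 ≤ (b - a) / 4 := hx.2
  constructor <;> linarith

/-- A test function of mean zero is the derivative of a test function. -/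
theorem exists_test_primitive {a b : ℝ} {χ : ℝ → ℝ} (h1 : ContDiff ℝ ∞ χ)
    (h2 : HasCompactSupport χ) (h3 : tsupport χ ⊆ Ioo a b) (h4 : ∫ x, χ x = 0) :
    ∃ Φ : ℝ → ℝ, ContDiff ℝ ∞ Φ ∧ HasCompactSupport Φ ∧ tsupport Φ ⊆ Ioo a b ∧ deriv Φ = χ := by
  by_cases hK : (tsupport χ).Nonempty
  swap
  · rw [not_nonempty_iff_eq_empty, tsupport_eq_empty_iff] at hK
    subst hK
    refine ⟨0, contDiff_const, HasCompactSupport.zero, by simp, ?_⟩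
    ext x
    simp
  have hc := h2.sInf_mem hK
  have hd := h2.sSup_mem hK
  set c := sInf (tsupport χ)
  set d := sSup (tsupport χ)
  have hsub : tsupport χ ⊆ Icc c d := fun x hx =>
    ⟨csInf_le h2.bddBelow hx, le_csSup h2.bddAbove hx⟩
  have hcont := h1.continuous
  have hz : ∀ x, x ∉ Icc c d → χ x = 0 := fun x hx =>
    image_eq_zero_of_notMem_tsupport fun hx' => hx (hsub hx')
  have hint : Integrable χ := hcont.integrable_of_hasCompactSupport h2
  have hder : ∀ x, HasDerivAt (fun x => ∫ t in c..x, χ t) (χ x) x := fun x =>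
    intervalIntegral.integral_hasDerivAt_right (hcont.intervalIntegrable _ _)
      (hcont.stronglyMeasurableAtFilter _ _) hcont.continuousAt
  have hderiv : deriv (fun x => ∫ t in c..x, χ t) = χ := funext fun x => (hder x).deriv
  -- To the left of `c` the integrand vanishes; to the right of `d` the primitive equals the full
  -- integral of `χ`, which is zero.
  have hsupp : tsupport (fun x => ∫ t in c..x, χ t) ⊆ Icc c d := by
    refine closure_minimal (fun x hx => ?_) isClosed_Icc
    by_contra hxn
    apply hx
    rcases lt_or_ge x c with hxc | hxc
    · change ∫ t in c..x, χ t = 0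
      rw [intervalIntegral.integral_symm, intervalIntegral.integral_of_le hxc.le,
        integral_Ioc_eq_integral_Ioo, setIntegral_eq_zero_of_forall_eq_zero, neg_zero]
      exact fun t ht => hz t fun h => absurd h.1 (not_le.mpr ht.2)
    · have hxd : d < x := by
        by_contra hxd
        exact hxn ⟨hxc, not_lt.mp hxd⟩
      change ∫ t in c..x, χ t = 0
      rw [intervalIntegral.integral_of_le hxc, ← integral_Icc_eq_integral_Ioc, ← h4]
      refine setIntegral_eq_integral_of_forall_compl_eq_zero fun t ht => hz t fun h => ht ?_
      exact ⟨h.1, h.2.trans hxd.le⟩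
  refine ⟨fun x => ∫ t in c..x, χ t, ?_, ?_, ?_, hderiv⟩
  · rw [contDiff_infty_iff_deriv, hderiv]
    exact ⟨fun x => (hder x).differentiableAt, h1⟩
  · exact HasCompactSupport.of_support_subset_isCompact isCompact_Icc
      ((subset_tsupport _).trans hsupp)
  · exact hsupp.trans (Icc_subset_Ioo (h3 hc).1 (h3 hd).2)

/-- The lemma of du Bois-Reymond. -/
theorem exists_ae_eq_const_of_integral_deriv_eq_zero {a b : ℝ} (hab : a < b) {v : ℝ → ℝ}
    (hv : LocallyIntegrableOn v (Ioo a b))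
    (h : ∀ φ : ℝ → ℝ, ContDiff ℝ ∞ φ → HasCompactSupport φ → tsupport φ ⊆ Ioo a b →
      ∫ x in Ioo a b, v x * deriv φ x = 0) : ∃ c : ℝ, ∀ᵐ x ∂vol a b, v x = c := by
  obtain ⟨φ, p1, p2, p3, p4⟩ := exists_bump hab
  refine ⟨∫ x in Ioo a b, v x * φ x, ?_⟩
  set c := ∫ x in Ioo a b, v x * φ x
  have := ae_eq_zero_of_integral_test_eq_zero (v := fun x => v x - c)
    (hv.sub ((locallyIntegrable_const c).locallyIntegrableOn _)) (fun ψ q1 q2 q3 => by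
      have hψi : Integrable ψ := q1.continuous.integrable_of_hasCompactSupport q2
      have hφi : Integrable φ := p1.continuous.integrable_of_hasCompactSupport p2
      -- Subtracting `(∫ ψ) φ` from `ψ` makes the mean zero, so the difference is the derivative of
      -- a test function and is annihilated by `v`.
      obtain ⟨Φ, r1, r2, r3, r4⟩ := exists_test_primitive (a := a) (b := b)
        (χ := fun x => ψ x - (∫ x, ψ x) * φ x)
        (q1.sub (contDiff_const.mul p1)) (q2.sub (p2.mul_left))
        (by
          refine (tsupport_sub _ _).trans (union_subset q3 ?_)
          exact (tsupport_mul_subset_right).trans p3)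
        (by rw [integral_sub hψi (hφi.const_mul _), integral_const_mul, p4]; ring)
      have e := h Φ r1 r2 r3
      rw [r4] at e
      have i1 := integrableOn_mul_test hv q1.continuous q2 q3
      have i2 := integrableOn_mul_test hv p1.continuous p2 p3
      have e1 : ∫ x in Ioo a b, v x * (ψ x - (∫ x, ψ x) * φ x) =
          (∫ x in Ioo a b, v x * ψ x) - (∫ x, ψ x) * c := by
        have : ∀ x, v x * (ψ x - (∫ x, ψ x) * φ x) = v x * ψ x - (∫ x, ψ x) * (v x * φ x) :=
          fun x => by ring
        simp only [this]
        rw [integral_sub i1 (i2.const_mul _), integral_const_mul]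
      rw [e1] at e
      have e2 : ∫ x in Ioo a b, (v x - c) * ψ x =
          (∫ x in Ioo a b, v x * ψ x) - c * ∫ x in Ioo a b, ψ x := by
        simp only [sub_mul]
        rw [integral_sub i1 (hψi.integrableOn.const_mul _), integral_const_mul]
      rw [e2, setIntegral_eq_integral_of_forall_compl_eq_zero (f := ψ) (s := Ioo a b)
        (fun x hx => image_eq_zero_of_notMem_tsupport fun hx' => hx (q3 hx'))]
      linarith)
  filter_upwards [this] with x hx
  linarith

theorem prim_integral {a b : ℝ} {g : ℝ → ℝ} (hg : MemLp g 2 (vol a b)) (c : ℝ) :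
    Prim a b (fun x => c + ∫ t in a..x, g t) g where
  memLp := hg
  ftc x _ := by simp

/-- The difference of `u` and a primitive of `g` has weak derivative zero, hence is constant by du
Bois-Reymond. -/
theorem HasWeakDeriv.exists_prim {a b : ℝ} (hab : a < b) {u g : ℝ → ℝ}
    (h : HasWeakDeriv a b 1 u g) (hg : MemLp g 2 (vol a b)) :
    ∃ F : ℝ → ℝ, Prim a b F g ∧ ∀ᵐ x ∂vol a b, u x = F x := by
  have hF := prim_integral hg 0
  have hw := hF.hasWeakDeriv hab.le
  obtain ⟨c, hc⟩ := exists_ae_eq_const_of_integral_deriv_eq_zero hab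
    (v := fun x => u x - (0 + ∫ t in a..x, g t)) (h.1.sub hw.1) (fun φ h1 h2 h3 => by
      have e1 := h.2.2 φ h1 h2 h3
      have e2 := hw.2.2 φ h1 h2 h3
      rw [iteratedDeriv_one] at e1 e2
      have hs : tsupport (deriv φ) ⊆ Ioo a b :=
        (closure_minimal (support_deriv_subset) (isClosed_tsupport φ)).trans h3
      have hcd : Continuous (deriv φ) := h1.continuous_deriv (by simp)
      simp only [sub_mul]
      rw [integral_sub (integrableOn_mul_test h.1 hcd h2.deriv hs)
        (integrableOn_mul_test hw.1 hcd h2.deriv hs), e1, e2, sub_self])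
  refine ⟨fun x => c + ∫ t in a..x, g t, prim_integral hg c, ?_⟩
  filter_upwards [hc] with x hx
  linarith

theorem slobodeckijSq_congr {a b θ : ℝ} {f g : ℝ → ℝ} (h : ∀ᵐ x ∂vol a b, f x = g x) :
    slobodeckijSq a b θ f = slobodeckijSq a b θ g := by
  refine lintegral_congr_ae ?_
  filter_upwards [h] with x hx
  refine lintegral_congr_ae ?_
  filter_upwards [h] with y hy
  rw [hx, hy]

/-- The derivatives of a function in `H^σ`, with continuous representatives for all but the last. -/
theorem MemH.exists_derivatives {a b σ : ℝ} (hab : a < b) {u : ℝ → ℝ} (h : MemH a b σ u) :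
    ∃ U : ℕ → ℝ → ℝ, (∀ j < ⌊σ⌋₊, Prim a b (U j) (U (j + 1))) ∧
      (∀ j ≤ ⌊σ⌋₊, MemLp (U j) 2 (vol a b)) ∧
      (∀ j ≤ ⌊σ⌋₊, ∀ᵐ x ∂vol a b, U j x = weakDeriv a b j u x) ∧
      (∀ᵐ x ∂vol a b, u x = U 0 x) := by
  set n := ⌊σ⌋₊
  have h1 := h.1
  choose! g hg hgL using h1
  have hp : ∀ j < n, ∃ F : ℝ → ℝ, Prim a b F (g (j + 1)) ∧ ∀ᵐ x ∂vol a b, g j x = F x :=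
    fun j hj => ((hg j hj.le).succ (hg (j + 1) hj)).exists_prim hab (hgL _ hj)
  choose! F hF hFg using hp
  have hUg : ∀ j ≤ n, ∀ᵐ x ∂vol a b, g j x = (if j < n then F j else g j) x := by
    intro j hj
    by_cases hjn : j < n
    · simpa only [if_pos hjn] using hFg j hjn
    · simp [if_neg hjn]
  -- Below the top order the continuous primitive is chosen; the top derivative is only square
  -- integrable and is kept as it is.
  refine ⟨fun j => if j < n then F j else g j, fun j hj => ?_, fun j hj => ?_, fun j hj => ?_, ?_⟩
  · simp only [if_pos hj]
    exact (hF j hj).congr_deriv (hUg (j + 1) hj)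
  · exact (memLp_congr_ae (hUg j hj)).mp (hgL j hj)
  · filter_upwards [hUg j hj, (hg j hj).ae_eq_weakDeriv] with x h1 h2
    rw [← h1, h2]
  · filter_upwards [hUg 0 (Nat.zero_le _), (hg 0 (Nat.zero_le _)).zero] with x h1 h2
    rw [h2, h1]

theorem normH_nonneg (a b σ : ℝ) (u : ℝ → ℝ) : 0 ≤ normH a b σ u := Real.sqrt_nonneg _

theorem nrm_le_normH {a b σ : ℝ} (hab : a < b) {u v : ℝ → ℝ} {j : ℕ} (hj : j ≤ ⌊σ⌋₊)
    (h : ∀ᵐ x ∂vol a b, v x = weakDeriv a b j u x) : nrm a b v ≤ normH a b σ u := by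
  rw [nrm_congr h hab.le]
  refine Real.sqrt_le_sqrt ?_
  rw [← integral_Ioo_eq_interval hab.le]
  refine le_trans ?_ (le_add_of_nonneg_right ?_)
  · exact Finset.single_le_sum
      (f := fun j => ∫ x in Ioo a b, weakDeriv a b j u x ^ 2)
      (fun i _ => integral_nonneg fun _ => sq_nonneg _) (Finset.mem_range.mpr (by omega))
  · split_ifs
    · exact ENNReal.toReal_nonneg
    · exact le_rfl

/-- Membership in `H^σ` matters: an infinite seminorm would enter `normH` as `toReal ⊤ = 0`. -/
theorem slobodeckijSq_le_normH {a b σ : ℝ} {u v : ℝ → ℝ}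
    (hσ : 0 < Int.fract σ) (hu : MemH a b σ u)
    (h : ∀ᵐ x ∂vol a b, v x = weakDeriv a b ⌊σ⌋₊ u x) :
    slobodeckijSq a b (Int.fract σ) v ≤ ENNReal.ofReal (normH a b σ u ^ 2) := by
  rw [slobodeckijSq_congr h, ← ENNReal.ofReal_toReal (hu.2 hσ).ne]
  refine ENNReal.ofReal_le_ofReal ?_
  have hs : 0 ≤ ∑ j ∈ Finset.range (⌊σ⌋₊ + 1), ∫ x in Ioo a b, weakDeriv a b j u x ^ 2 :=
    Finset.sum_nonneg fun i _ => integral_nonneg fun _ => sq_nonneg _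
  unfold normH
  rw [if_pos hσ, Real.sq_sqrt (add_nonneg hs ENNReal.toReal_nonneg)]
  linarith

/-! ### Antiderivatives of polynomials -/

theorem mem_P_iff {r : ℕ} {q : ℝ[X]} : q ∈ P r ↔ ∀ m, r < m → q.coeff m = 0 := by
  rw [Polynomial.mem_degreeLT, Polynomial.degree_lt_iff_coeff_zero]
  rfl

theorem P_mono {r t : ℕ} (h : r ≤ t) {q : ℝ[X]} (hq : q ∈ P r) : q ∈ P t := by
  rw [mem_P_iff] at hq ⊢
  exact fun m hm => hq m (h.trans_lt hm)

theorem C_mem_P (r : ℕ) (t : ℝ) : C t ∈ P r := by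
  rw [mem_P_iff]
  intro m hm
  rw [coeff_C, if_neg (by omega)]

theorem derivative_mem_P {r : ℕ} {q : ℝ[X]} (hq : q ∈ P (r + 1)) : derivative q ∈ P r := by
  rw [mem_P_iff] at hq ⊢
  intro m hm
  rw [coeff_derivative, hq (m + 1) (by omega), zero_mul]

theorem mem_P_of_derivative {r : ℕ} {q : ℝ[X]} (hq : derivative q ∈ P r) : q ∈ P (r + 1) := by
  rw [mem_P_iff] at hq ⊢
  intro m hm
  obtain ⟨m, rfl⟩ : ∃ j, m = j + 1 := ⟨m - 1, by omega⟩
  have := hq m (by omega)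
  rw [coeff_derivative] at this
  exact (mul_eq_zero.mp this).resolve_right (by positivity)

/-- The antiderivative of a polynomial without constant term. -/
noncomputable def antideriv : ℝ[X] →ₗ[ℝ] ℝ[X] :=
  Polynomial.lsum fun n => ((n : ℝ) + 1)⁻¹ • Polynomial.monomial (n + 1)

theorem derivative_antideriv (q : ℝ[X]) : derivative (antideriv q) = q := by
  induction q using Polynomial.induction_on' with
  | add p q hp hq => rw [map_add, derivative_add, hp, hq]
  | monomial n r =>
    have : antideriv (monomial n r) = ((n : ℝ) + 1)⁻¹ • monomial (n + 1) r := by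
      unfold antideriv
      rw [Polynomial.lsum_apply, Polynomial.sum_monomial_index _ _ (by simp)]
      rfl
    rw [this, derivative_smul, derivative_monomial, smul_monomial]
    congr 1
    push_cast
    rw [smul_eq_mul]
    field_simp

/-- The antiderivative of the polynomial `q` that takes the value `v` at `y`. -/
noncomputable def antiderivFrom (y v : ℝ) (q : ℝ[X]) : ℝ[X] :=
  C v + (antideriv q - C ((antideriv q).eval y))

theorem derivative_antiderivFrom (y v : ℝ) (q : ℝ[X]) : derivative (antiderivFrom y v q) = q := by
  simp [antiderivFrom, derivative_antideriv]

theorem antiderivFrom_mem_P {r : ℕ} (y v : ℝ) {q : ℝ[X]} (hq : q ∈ P r) :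
    antiderivFrom y v q ∈ P (r + 1) :=
  mem_P_of_derivative (by rwa [derivative_antiderivFrom])

theorem eval_antiderivFrom_self (y v : ℝ) (q : ℝ[X]) : (antiderivFrom y v q).eval y = v := by
  simp [antiderivFrom]

theorem prim_antiderivFrom (a b y v : ℝ) (q : ℝ[X]) :
    Prim a b (fun x => (antiderivFrom y v q).eval x) (fun x => q.eval x) := by
  simpa only [derivative_antiderivFrom] using Prim.of_polynomial a b (antiderivFrom y v q)

theorem eval_antiderivFrom {y v : ℝ} (q : ℝ[X]) (x : ℝ) :
    (antiderivFrom y v q).eval x = v + ∫ t in y..x, q.eval t := by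
  have := intervalIntegral.integral_eq_sub_of_hasDerivAt (a := y) (b := x)
    (fun t _ => (antiderivFrom y v q).hasDerivAt t)
      ((antiderivFrom y v q).derivative.continuous.intervalIntegrable _ _)
  rw [derivative_antiderivFrom, eval_antiderivFrom_self] at this
  linarith

theorem Prim.sub {a b : ℝ} {F f G g : ℝ → ℝ} (hF : Prim a b F f) (hG : Prim a b G g) :
    Prim a b (fun x => F x - G x) (fun x => f x - g x) := by
  simpa [sub_eq_add_neg] using hF.add (hG.const_mul (-1))

/-! ### Local approximation by polynomials -/

theorem integral_add_sq_le {c d : ℝ} (hcd : c ≤ d) {f g : ℝ → ℝ} (hf : MemLp f 2 (vol c d))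
    (hg : MemLp g 2 (vol c d)) :
    ∫ x in c..d, (f x + g x) ^ 2 ≤ 2 * (∫ x in c..d, f x ^ 2) + 2 * ∫ x in c..d, g x ^ 2 := by
  have h := nrm_add_le hcd hf hg
  have h0 := nrm_nonneg c d (fun x => f x + g x)
  have h1 := nrm_nonneg c d f
  have h2 := nrm_nonneg c d g
  rw [← nrm_sq hcd, ← nrm_sq hcd, ← nrm_sq hcd]
  nlinarith [sq_nonneg (nrm c d f - nrm c d g)]

/-- A nonnegative density on `(a, b)` of total mass at most `M²`. -/
structure Density (a b M : ℝ) (ρ : ℝ → ℝ) : Prop where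
  integrable : IntervalIntegrable ρ volume a b
  nonneg : ∀ x, 0 ≤ ρ x
  mass_le : ∫ x in a..b, ρ x ≤ M ^ 2

theorem Density.sub_integrable {a b M c d : ℝ} {ρ : ℝ → ℝ} (h : Density a b M ρ) (hac : a ≤ c)
    (hcd : c ≤ d) (hdb : d ≤ b) : IntervalIntegrable ρ volume c d := by
  refine h.integrable.mono_set ?_
  rw [uIcc_of_le hcd, uIcc_of_le (hac.trans (hcd.trans hdb))]
  exact Icc_subset_Icc hac hdb

theorem Density.integral_nonneg {a b M c d : ℝ} {ρ : ℝ → ℝ} (h : Density a b M ρ) (hcd : c ≤ d) :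
    0 ≤ ∫ x in c..d, ρ x :=
  intervalIntegral.integral_nonneg hcd fun x _ => h.nonneg x

theorem Density.integral_le {a b M c d : ℝ} {ρ : ℝ → ℝ} (h : Density a b M ρ) (hac : a ≤ c)
    (hcd : c ≤ d) (hdb : d ≤ b) : ∫ x in c..d, ρ x ≤ M ^ 2 :=
  (intervalIntegral.integral_mono_interval hac hcd hdb
    (Filter.Eventually.of_forall h.nonneg) h.integrable).trans h.mass_le

theorem density_sq {a b M : ℝ} (hab : a ≤ b) {g : ℝ → ℝ} (hg : MemLp g 2 (vol a b))
    (hM : nrm a b g ≤ M) : Density a b M fun x => g x ^ 2 where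
  integrable := memLp_intervalIntegrable_sq hg hab
  nonneg _ := sq_nonneg _
  mass_le := by
    rw [← nrm_sq hab]
    exact pow_le_pow_left₀ (nrm_nonneg _ _ _) hM 2

/-- On every subinterval of length `ℓ`, `g` is approximated by polynomials of degree at most `l` with
an error of order `ℓ ^ α`, square summable over disjoint subintervals. -/
structure Approx (a b α M : ℝ) (l : ℕ) (g : ℝ → ℝ) : Prop where
  memLp : MemLp g 2 (vol a b)
  exists_density : ∃ ρ : ℝ → ℝ, Density a b M ρ ∧ ∀ c d, a ≤ c → c < d → d ≤ b →
    ∃ q ∈ P l, ∫ x in c..d, (g x - q.eval x) ^ 2 ≤ (d - c) ^ (2 * α) * ∫ x in c..d, ρ x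

/-- `g` is approximated by constants with order `θ`, and the constants grow at most like
`ℓ ^ (θ - 1)`. -/
structure Reg (a b θ M : ℝ) (g : ℝ → ℝ) : Prop where
  memLp : MemLp g 2 (vol a b)
  exists_density : ∃ ρ : ℝ → ℝ, Density a b M ρ ∧ ∀ c d, a ≤ c → c < d → d ≤ b →
    ∃ κ : ℝ, ∫ x in c..d, (g x - κ) ^ 2 ≤ (d - c) ^ (2 * θ) * (∫ x in c..d, ρ x) ∧
      |κ| ≤ M * (d - c) ^ (θ - 1)

/-! ### Calculus of the approximation properties: sums, multiples, primitives, products. -/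

theorem Reg.approx {a b θ M : ℝ} {g : ℝ → ℝ} (h : Reg a b θ M g) : Approx a b θ M 0 g := by
  obtain ⟨ρ, hρ, hh⟩ := h.exists_density
  refine ⟨h.memLp, ρ, hρ, fun c d hac hcd hdb => ?_⟩
  obtain ⟨κ, hκ, -⟩ := hh c d hac hcd hdb
  exact ⟨C κ, C_mem_P _ _, by simpa using hκ⟩

theorem integral_congr_sub {a b c d : ℝ} {f g : ℝ → ℝ} (hfg : ∀ᵐ x ∂vol a b, f x = g x)
    (hac : a ≤ c) (hcd : c ≤ d) (hdb : d ≤ b) (Φ : ℝ → ℝ → ℝ) :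
    ∫ x in c..d, Φ x (f x) = ∫ x in c..d, Φ x (g x) := by
  rw [← integral_Ioo_eq_interval hcd, ← integral_Ioo_eq_interval hcd]
  refine integral_congr_ae ?_
  filter_upwards [ae_mono (Measure.restrict_mono (Ioo_subset_Ioo hac hdb) le_rfl) hfg] with x hx
  rw [hx]

theorem Reg.congr {a b θ M : ℝ} {f g : ℝ → ℝ} (h : Reg a b θ M f)
    (hfg : ∀ᵐ x ∂vol a b, f x = g x) : Reg a b θ M g := by
  obtain ⟨ρ, hρ, hh⟩ := h.exists_density
  refine ⟨(memLp_congr_ae hfg).mp h.memLp, ρ, hρ, fun c d hac hcd hdb => ?_⟩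
  obtain ⟨κ, hκ, hκ'⟩ := hh c d hac hcd hdb
  refine ⟨κ, ?_, hκ'⟩
  rwa [← integral_congr_sub hfg hac hcd.le hdb fun _ t => (t - κ) ^ 2]

theorem Approx.mono_degree {a b α M : ℝ} {l l' : ℕ} {g : ℝ → ℝ} (h : Approx a b α M l g)
    (hl : l ≤ l') : Approx a b α M l' g := by
  obtain ⟨ρ, hρ, hh⟩ := h.exists_density
  refine ⟨h.memLp, ρ, hρ, fun c d hac hcd hdb => ?_⟩
  obtain ⟨q, hq, hq'⟩ := hh c d hac hcd hdb
  exact ⟨q, P_mono hl hq, hq'⟩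

theorem Approx.mono_const {a b α M M' : ℝ} {l : ℕ} {g : ℝ → ℝ} (h : Approx a b α M l g)
    (hM : 0 ≤ M) (hMM : M ≤ M') : Approx a b α M' l g := by
  obtain ⟨ρ, hρ, hh⟩ := h.exists_density
  exact ⟨h.memLp, ρ, ⟨hρ.1, hρ.2, hρ.3.trans (pow_le_pow_left₀ hM hMM 2)⟩, hh⟩

/-- The surplus power `ℓ^{β-α}` is at most `(b-a)^{β-α}` and is absorbed into the density. -/
theorem Approx.mono_order {a b α β M : ℝ} {l : ℕ} {g : ℝ → ℝ} (h : Approx a b β M l g)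
    (hαβ : α ≤ β) : Approx a b α ((b - a) ^ (β - α) * M) l g := by
  obtain ⟨ρ, hρ, hh⟩ := h.exists_density
  rcases lt_or_ge b a with hab | hab
  · refine ⟨h.memLp, fun _ => 0, ⟨by simp, fun _ => le_rfl, by simp; positivity⟩,
      fun c d hac hcd hdb => ?_⟩
    linarith
  have hba : (0 : ℝ) ≤ b - a := by linarith
  refine ⟨h.memLp, fun x => ((b - a) ^ (β - α)) ^ 2 * ρ x, ⟨hρ.1.const_mul _,
    fun x => mul_nonneg (sq_nonneg _) (hρ.2 x), ?_⟩, fun c d hac hcd hdb => ?_⟩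
  · rw [intervalIntegral.integral_const_mul, mul_pow]
    exact mul_le_mul_of_nonneg_left hρ.3 (sq_nonneg _)
  · obtain ⟨q, hq, hq'⟩ := hh c d hac hcd hdb
    refine ⟨q, hq, hq'.trans ?_⟩
    have hdc : 0 < d - c := by linarith
    rw [intervalIntegral.integral_const_mul, ← mul_assoc]
    refine mul_le_mul_of_nonneg_right ?_ (hρ.integral_nonneg hcd.le)
    have : (d - c) ^ (2 * β) = (d - c) ^ (2 * α) * ((d - c) ^ (β - α)) ^ 2 := by
      rw [← Real.rpow_natCast, ← Real.rpow_mul hdc.le, ← Real.rpow_add hdc]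
      congr 1
      push_cast
      ring
    rw [this]
    gcongr

theorem Approx.add {a b α M₁ M₂ : ℝ} {l : ℕ} {f g : ℝ → ℝ} (hM₁ : 0 ≤ M₁) (hM₂ : 0 ≤ M₂)
    (hf : Approx a b α M₁ l f) (hg : Approx a b α M₂ l g) :
    Approx a b α (2 * (M₁ + M₂)) l fun x => f x + g x := by
  obtain ⟨ρ, hρ, hh⟩ := hf.exists_density
  obtain ⟨τ, hτ, kk⟩ := hg.exists_density
  refine ⟨hf.memLp.add hg.memLp, fun x => 2 * ρ x + 2 * τ x, ⟨(hρ.1.const_mul 2).add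
    (hτ.1.const_mul 2), fun x => by linarith [hρ.2 x, hτ.2 x], ?_⟩, fun c d hac hcd hdb => ?_⟩
  · rw [intervalIntegral.integral_add (hρ.1.const_mul 2) (hτ.1.const_mul 2),
      intervalIntegral.integral_const_mul, intervalIntegral.integral_const_mul]
    nlinarith [hρ.3, hτ.3, mul_nonneg hM₁ hM₂]
  · obtain ⟨p, hp, hp'⟩ := hh c d hac hcd hdb
    obtain ⟨q, hq, hq'⟩ := kk c d hac hcd hdb
    refine ⟨p + q, add_mem hp hq, ?_⟩
    have h1 := integral_add_sq_le hcd.le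
      ((memLp_sub hf.memLp hac hdb).sub (memLp_eval c d p))
      ((memLp_sub hg.memLp hac hdb).sub (memLp_eval c d q))
    rw [intervalIntegral.integral_add ((hρ.sub_integrable hac hcd.le hdb).const_mul 2)
      ((hτ.sub_integrable hac hcd.le hdb).const_mul 2),
      intervalIntegral.integral_const_mul, intervalIntegral.integral_const_mul]
    have e : ∀ x, f x + g x - (p + q).eval x = (f x - p.eval x) + (g x - q.eval x) := fun x => by
      rw [eval_add]
      ring
    simp only [e]
    simp only [Pi.sub_apply] at h1
    linarith

theorem Approx.const_mul {a b α M : ℝ} {l : ℕ} {g : ℝ → ℝ} (h : Approx a b α M l g) (r : ℝ) :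
    Approx a b α (r * M) l fun x => r * g x := by
  obtain ⟨ρ, hρ, hh⟩ := h.exists_density
  refine ⟨h.memLp.const_mul r, fun x => r ^ 2 * ρ x, ⟨hρ.1.const_mul _,
    fun x => mul_nonneg (sq_nonneg _) (hρ.2 x), ?_⟩, fun c d hac hcd hdb => ?_⟩
  · rw [intervalIntegral.integral_const_mul, mul_pow]
    exact mul_le_mul_of_nonneg_left hρ.3 (sq_nonneg _)
  · obtain ⟨q, hq, hq'⟩ := hh c d hac hcd hdb
    refine ⟨r • q, Submodule.smul_mem _ r hq, ?_⟩
    have e : ∀ x, (r * g x - (r • q).eval x) ^ 2 = r ^ 2 * (g x - q.eval x) ^ 2 := fun x => by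
      rw [eval_smul, smul_eq_mul]
      ring
    simp only [e]
    rw [intervalIntegral.integral_const_mul, intervalIntegral.integral_const_mul]
    nlinarith [sq_nonneg r]

theorem Approx.sum_range {a b α : ℝ} {l : ℕ} (n : ℕ) {M : ℕ → ℝ} {g : ℕ → ℝ → ℝ}
    (hM : ∀ i < n, 0 ≤ M i) (h : ∀ i < n, Approx a b α (M i) l (g i)) :
    Approx a b α (2 ^ n * ∑ i ∈ Finset.range n, M i) l
      fun x => ∑ i ∈ Finset.range n, g i x := by
  induction n with
  | zero =>
    refine ⟨by simp, fun _ => 0, ⟨by simp, fun _ => le_rfl, by simp⟩, fun c d _ _ _ => ⟨0, zero_mem _, ?_⟩⟩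
    simp
  | succ n ih =>
    have hs : 0 ≤ ∑ i ∈ Finset.range n, M i :=
      Finset.sum_nonneg fun i hi => hM i (by have := Finset.mem_range.mp hi; omega)
    have h0 := hM n (by omega)
    have := (ih (fun i hi => hM i (by omega)) fun i hi => h i (by omega)).add
      (mul_nonneg (by positivity) hs) h0 (h n (by omega))
    simp only [Finset.sum_range_succ]
    refine this.mono_const (by positivity) ?_
    have : (1 : ℝ) ≤ 2 ^ n := one_le_pow₀ (by norm_num)
    rw [pow_succ]
    nlinarith

/-- The antiderivative of the approximating polynomial that agrees with `G` at the left endpoint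
works: Poincaré's inequality supplies the extra factor `ℓ`, with the same density. -/
theorem Approx.lift {a b α M : ℝ} {l : ℕ} {G g : ℝ → ℝ} (h : Approx a b α M l g)
    (hG : Prim a b G g) : Approx a b (α + 1) M (l + 1) G := by
  obtain ⟨ρ, hρ, hh⟩ := h.exists_density
  refine ⟨hG.memLp_self, ρ, hρ, fun c d hac hcd hdb => ?_⟩
  obtain ⟨q, hq, hq'⟩ := hh c d hac hcd hdb
  refine ⟨antiderivFrom c (G c) q, antiderivFrom_mem_P _ _ hq, ?_⟩
  have hp := (hG.mono hac hdb).sub (prim_antiderivFrom c d c (G c) q)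
  have h1 := hp.nrm_sub_le hcd.le
  simp only [eval_antiderivFrom_self, sub_self, sub_zero] at h1
  have h2 := pow_le_pow_left₀ (nrm_nonneg _ _ _) h1 2
  rw [mul_pow, nrm_sq hcd.le, nrm_sq hcd.le] at h2
  refine h2.trans ?_
  have hdc : 0 < d - c := by linarith
  have : (d - c) ^ (2 * (α + 1)) = (d - c) ^ 2 * (d - c) ^ (2 * α) := by
    rw [mul_add, Real.rpow_add hdc, mul_comm]
    norm_num
  rw [this, mul_assoc]
  exact mul_le_mul_of_nonneg_left hq' (sq_nonneg _)

/-- The constant `F(c) κ` approximates the product, since `F g - F(c) κ = F (g - κ) + κ (F - F(c))`.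
The last part is of size `|κ| ℓ ‖f‖`, so the growth bound `|κ| ≤ M ℓ^{θ-1}` is exactly what leaves
the order `ℓ^θ`. -/
theorem Reg.mul {a b θ M B : ℝ} (hB : 0 ≤ B) {F f g : ℝ → ℝ} (hg : Reg a b θ M g)
    (hF : Prim a b F f) (hFB : ∀ x ∈ Icc a b, |F x| ≤ B) (hfB : nrm a b f ≤ B) :
    Approx a b θ (2 * B * M) 0 fun x => F x * g x := by
  obtain ⟨ρ, hρ, hh⟩ := hg.exists_density
  refine ⟨memLp_mul_of_continuousOn hg.memLp hF.continuousOn, ?_⟩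
  rcases lt_or_ge b a with hab | hab
  · exact ⟨fun _ => 0, ⟨by simp, fun _ => le_rfl, by simp; positivity⟩, fun c d _ _ _ => by linarith⟩
  have hf2 := density_sq hab hF.memLp hfB
  refine ⟨fun x => 2 * B ^ 2 * ρ x + 2 * M ^ 2 * f x ^ 2, ⟨(hρ.1.const_mul _).add
    (hf2.1.const_mul _), fun x => add_nonneg (mul_nonneg (by positivity) (hρ.2 x)) (by positivity),
    ?_⟩, fun c d hac hcd hdb => ?_⟩
  · rw [intervalIntegral.integral_add (hρ.1.const_mul _) (hf2.1.const_mul _),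
      intervalIntegral.integral_const_mul, intervalIntegral.integral_const_mul]
    have h1 := mul_le_mul_of_nonneg_left hρ.3 (by positivity : 0 ≤ 2 * B ^ 2)
    have h2 := mul_le_mul_of_nonneg_left hf2.3 (by positivity : 0 ≤ 2 * M ^ 2)
    calc _ ≤ _ := add_le_add h1 h2
      _ = _ := by ring
  · obtain ⟨κ, hκ, hκ'⟩ := hh c d hac hcd hdb
    have hdc : 0 < d - c := by linarith
    refine ⟨C (F c * κ), C_mem_P _ _, ?_⟩
    have hFs := hF.mono hac hdb
    have hgs : MemLp (fun x => g x - κ) 2 (vol c d) :=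
      (memLp_sub hg.memLp hac hdb).sub (memLp_const_vol c d κ)
    have m1 : MemLp (fun x => F x * (g x - κ)) 2 (vol c d) :=
      memLp_mul_of_continuousOn hgs hFs.continuousOn
    have m2 : MemLp (fun x => F x - F c) 2 (vol c d) :=
      hFs.memLp_self.sub (memLp_const_vol c d _)
    have h1 := integral_add_sq_le hcd.le m1 (m2.const_mul κ)
    have e : ∀ x, F x * g x - (C (F c * κ)).eval x = F x * (g x - κ) + κ * (F x - F c) := fun x => by
      rw [eval_C]
      ring
    simp only [e]
    have h2 : ∫ x in c..d, (F x * (g x - κ)) ^ 2 ≤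
        B ^ 2 * ((d - c) ^ (2 * θ) * ∫ x in c..d, ρ x) := by
      refine le_trans ?_ (mul_le_mul_of_nonneg_left hκ (sq_nonneg B))
      rw [← intervalIntegral.integral_const_mul]
      simp only [← mul_pow]
      refine integral_sq_mono hcd.le m1 (hgs.const_mul B) ?_
      filter_upwards [ae_restrict_mem measurableSet_Ioo] with x hx
      rw [abs_mul, abs_mul, abs_of_nonneg hB]
      exact mul_le_mul_of_nonneg_right (hFB x ⟨hac.trans hx.1.le, hx.2.le.trans hdb⟩)
        (abs_nonneg _)
    have h3 : ∫ x in c..d, (κ * (F x - F c)) ^ 2 ≤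
        M ^ 2 * (d - c) ^ (2 * θ) * ∫ x in c..d, f x ^ 2 := by
      have h4 := pow_le_pow_left₀ (nrm_nonneg _ _ _) (hFs.nrm_sub_le hcd.le) 2
      rw [mul_pow, nrm_sq hcd.le, nrm_sq hcd.le] at h4
      have h5 := pow_le_pow_left₀ (abs_nonneg _) hκ' 2
      rw [sq_abs] at h5
      simp only [mul_pow]
      rw [intervalIntegral.integral_const_mul]
      refine (mul_le_mul h5 h4 (integral_sq_nonneg hcd.le _) (sq_nonneg _)).trans (le_of_eq ?_)
      have : (d - c) ^ (2 * θ) = ((d - c) ^ (θ - 1)) ^ 2 * (d - c) ^ 2 := by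
        rw [← mul_pow, ← Real.rpow_natCast, ← Real.rpow_add_one hdc.ne', ← Real.rpow_mul hdc.le]
        congr 1
        push_cast
        ring
      rw [this]
      ring
    rw [intervalIntegral.integral_add ((hρ.sub_integrable hac hcd.le hdb).const_mul _)
      ((hf2.sub_integrable hac hcd.le hdb).const_mul _), intervalIntegral.integral_const_mul,
      intervalIntegral.integral_const_mul]
    linarith

/-- Order zero asks for no smallness, so the constant `κ = 0` suffices. -/
theorem Reg.of_zero {a b M : ℝ} (hab : a ≤ b) {g : ℝ → ℝ} (hg : MemLp g 2 (vol a b))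
    (hM : nrm a b g ≤ M) : Reg a b 0 M g := by
  refine ⟨hg, _, density_sq hab hg hM, fun c d _ hcd _ => ⟨0, by simp, ?_⟩⟩
  rw [abs_zero]
  exact mul_nonneg ((nrm_nonneg _ _ _).trans hM) (Real.rpow_nonneg (by linarith) _)

/-- The constant in the bound of a function by the norms of the function and its derivative. -/
noncomputable def supConst (a b : ℝ) : ℝ := (Real.sqrt (b - a))⁻¹ + 2 * Real.sqrt (b - a)

theorem supConst_nonneg (a b : ℝ) : 0 ≤ supConst a b := by
  unfold supConst
  positivity

theorem Prim.abs_le_supConst {a b N : ℝ} {G g : ℝ → ℝ} (hab : a < b) (h : Prim a b G g)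
    (hG : nrm a b G ≤ N) (hg : nrm a b g ≤ N) {x : ℝ} (hx : x ∈ Icc a b) :
    |G x| ≤ supConst a b * N := by
  refine (h.abs_le hab hx).trans ?_
  unfold supConst
  rw [add_mul]
  gcongr

/-- The constant is the left endpoint value. Poincaré gives order one, more than `θ`, and a bounded
constant satisfies the growth bound because `ℓ^{θ-1} ≥ (b-a)^{θ-1}`. -/
theorem Prim.reg {a b θ N : ℝ} {G g : ℝ → ℝ} (hab : a < b) (hθ : θ ≤ 1)
    (h : Prim a b G g) (hG : nrm a b G ≤ N) (hg : nrm a b g ≤ N) :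
    Reg a b θ ((1 + supConst a b) * (b - a) ^ (1 - θ) * N) G := by
  have hba : 0 < b - a := by linarith
  have hN : 0 ≤ N := (nrm_nonneg _ _ _).trans hg
  have hs := supConst_nonneg a b
  have hL : 0 ≤ (b - a) ^ (1 - θ) := Real.rpow_nonneg hba.le _
  have hd := density_sq hab.le h.memLp hg
  refine ⟨h.memLp_self, fun x => ((b - a) ^ (1 - θ)) ^ 2 * g x ^ 2, ⟨hd.1.const_mul _,
    fun x => by positivity, ?_⟩, fun c d hac hcd hdb => ⟨G c, ?_, ?_⟩⟩
  · rw [intervalIntegral.integral_const_mul, mul_pow, mul_pow, mul_comm ((1 + supConst a b) ^ 2),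
      mul_assoc]
    refine mul_le_mul_of_nonneg_left (hd.3.trans ?_) (sq_nonneg _)
    exact le_mul_of_one_le_left (sq_nonneg _) (one_le_pow₀ (by linarith))
  · have hdc : 0 < d - c := by linarith
    have h4 := pow_le_pow_left₀ (nrm_nonneg _ _ _) ((h.mono hac hdb).nrm_sub_le hcd.le) 2
    rw [mul_pow, nrm_sq hcd.le, nrm_sq hcd.le] at h4
    refine h4.trans ?_
    rw [intervalIntegral.integral_const_mul, ← mul_assoc]
    refine mul_le_mul_of_nonneg_right ?_ (integral_sq_nonneg hcd.le _)
    have : (d - c) ^ 2 = (d - c) ^ (2 * θ) * ((d - c) ^ (1 - θ)) ^ 2 := by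
      rw [← Real.rpow_natCast (_ ^ _), ← Real.rpow_mul hdc.le, ← Real.rpow_add hdc,
        ← Real.rpow_natCast]
      congr 1
      push_cast
      ring
    rw [this]
    gcongr
  · have hdc : 0 < d - c := by linarith
    have hcI : c ∈ Icc a b := ⟨hac, hcd.le.trans hdb⟩
    refine (h.abs_le_supConst hab hG hg hcI).trans ?_
    have : 1 ≤ (b - a) ^ (1 - θ) * (d - c) ^ (θ - 1) := by
      rw [show θ - 1 = -(1 - θ) by ring, Real.rpow_neg hdc.le, ← div_eq_mul_inv,
        one_le_div (Real.rpow_pos_of_pos hdc _)]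
      gcongr
    calc supConst a b * N ≤ (1 + supConst a b) * N * 1 := by nlinarith
      _ ≤ (1 + supConst a b) * N * ((b - a) ^ (1 - θ) * (d - c) ^ (θ - 1)) := by gcongr
      _ = _ := by ring

/-! ### Approximation by means of functions of finite Slobodeckij seminorm -/

/-- The mean of `g` over `(c, d)`. -/
noncomputable def mean (c d : ℝ) (g : ℝ → ℝ) : ℝ := (d - c)⁻¹ * ∫ x in c..d, g x

theorem abs_mean_le {c d : ℝ} (hcd : c < d) {g : ℝ → ℝ} (hg : MemLp g 2 (vol c d)) :
    |mean c d g| ≤ (d - c)⁻¹ * (Real.sqrt (d - c) * nrm c d g) := by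
  have hdc : 0 < d - c := by linarith
  unfold mean
  rw [abs_mul, abs_of_pos (inv_pos.mpr hdc)]
  exact mul_le_mul_of_nonneg_left (abs_integral_le_nrm hcd.le hg) (inv_pos.mpr hdc).le

theorem mean_sub_const {c d : ℝ} (hcd : c < d) {g : ℝ → ℝ} (hg : MemLp g 2 (vol c d)) (κ : ℝ) :
    mean c d (fun x => g x - κ) = mean c d g - κ := by
  have hdc : d - c ≠ 0 := by linarith
  unfold mean
  rw [intervalIntegral.integral_sub (memLp_intervalIntegrable hg hcd.le)
    (by simp), intervalIntegral.integral_const, smul_eq_mul, mul_sub]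
  congr 1
  field_simp

/-- The constant in the growth bound for means. -/
noncomputable def meanConst (a b θ : ℝ) : ℝ :=
  ((b - a) / 2)⁻¹ * Real.sqrt (b - a) * (b - a) ^ (1 - θ) +
    2 * Real.sqrt (b - a) / (1 - 2 ^ (θ - 1))

theorem one_sub_two_rpow_pos {θ : ℝ} (hθ : θ < 1) : 0 < 1 - (2 : ℝ) ^ (θ - 1) := by
  have := Real.rpow_lt_one_of_one_lt_of_neg (x := 2) (z := θ - 1) (by norm_num) (by linarith)
  linarith

theorem meanConst_nonneg {a b θ : ℝ} (hab : a ≤ b) (hθ : θ < 1) : 0 ≤ meanConst a b θ := by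
  have := one_sub_two_rpow_pos hθ
  have h : 0 ≤ b - a := by linarith
  unfold meanConst
  positivity

/-- If the oscillation over intervals of length `ℓ` is of order `ℓ ^ θ`, then the means grow at most
like `ℓ ^ (θ - 1)`. -/
theorem abs_mean_le_rpow {a b θ N : ℝ} (hab : a < b) (hθ : θ < 1) (hN : 0 ≤ N)
    {g : ℝ → ℝ} (hg : MemLp g 2 (vol a b)) (hgN : nrm a b g ≤ N)
    (hosc : ∀ c d, a ≤ c → c < d → d ≤ b →
      nrm c d (fun x => g x - mean c d g) ≤ (d - c) ^ θ * N) :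
    ∀ c d, a ≤ c → c < d → d ≤ b → |mean c d g| ≤ meanConst a b θ * N * (d - c) ^ (θ - 1) := by
  have hL : 0 < b - a := by linarith
  have h2 := one_sub_two_rpow_pos hθ
  -- For long intervals the norm of `g` over `(a, b)` bounds the mean; this is the first summand of
  -- `meanConst`.
  have base : ∀ c d, a ≤ c → c < d → d ≤ b → (b - a) / 2 ≤ d - c →
      |mean c d g| ≤ meanConst a b θ * N * (d - c) ^ (θ - 1) := by
    intro c d hac hcd hdb hl
    have hdc : 0 < d - c := by linarith
    have hdL : d - c ≤ b - a := by linarith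
    have h1 : (d - c)⁻¹ * (Real.sqrt (d - c) * nrm c d g) ≤
        ((b - a) / 2)⁻¹ * (Real.sqrt (b - a) * N) := by
      have := (nrm_mono hg hac hcd.le hdb).trans hgN
      have h0 := nrm_nonneg c d g
      gcongr
    have h3 : 1 ≤ (b - a) ^ (1 - θ) * (d - c) ^ (θ - 1) := by
      rw [show θ - 1 = -(1 - θ) by ring, Real.rpow_neg hdc.le, ← div_eq_mul_inv,
        one_le_div (Real.rpow_pos_of_pos hdc _)]
      gcongr
    calc |mean c d g| ≤ _ := abs_mean_le hcd (memLp_sub hg hac hdb)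
      _ ≤ ((b - a) / 2)⁻¹ * (Real.sqrt (b - a) * N) * 1 := by rw [mul_one]; exact h1
      _ ≤ ((b - a) / 2)⁻¹ * (Real.sqrt (b - a) * N) *
          ((b - a) ^ (1 - θ) * (d - c) ^ (θ - 1)) := by gcongr
      _ = ((b - a) / 2)⁻¹ * Real.sqrt (b - a) * (b - a) ^ (1 - θ) * N * (d - c) ^ (θ - 1) := by
        ring
      _ ≤ _ := by
        unfold meanConst
        gcongr
        have : 0 ≤ 2 * Real.sqrt (b - a) / (1 - 2 ^ (θ - 1)) := by positivity
        linarith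
  -- Induction on the number of doublings needed to reach half of the whole length.
  have key : ∀ n : ℕ, ∀ c d, a ≤ c → c < d → d ≤ b → (b - a) / 2 ^ n ≤ 2 * (d - c) →
      |mean c d g| ≤ meanConst a b θ * N * (d - c) ^ (θ - 1) := by
    intro n
    induction n with
    | zero =>
      intro c d hac hcd hdb hl
      exact base c d hac hcd hdb (by simp at hl; linarith)
    | succ n ih =>
      intro c d hac hcd hdb hl
      rcases le_total ((b - a) / 2) (d - c) with hbig | hsmall
      · exact base c d hac hcd hdb hbig
      have hdc : 0 < d - c := by linarith
      set l := d - c with hl_def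
      set c' := min c (b - 2 * l) with hc'
      have h1 : a ≤ c' := le_min hac (by linarith)
      have h1' : c' ≤ c := min_le_left _ _
      have h3 : c' + 2 * l ≤ b := by
        have : c' ≤ b - 2 * l := min_le_right _ _
        linarith
      have h4 : d ≤ c' + 2 * l := by
        rcases min_choice c (b - 2 * l) with h | h <;> rw [hc', h] <;> linarith
      have hlt : c' < c' + 2 * l := by linarith
      have e1 := ih c' (c' + 2 * l) h1 hlt h3 (by
        rw [pow_succ, ← div_div] at hl
        linarith)
      have e2 := hosc c' (c' + 2 * l) h1 hlt h3
      rw [add_sub_cancel_left] at e1 e2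
      set κ := mean c' (c' + 2 * l) g
      have hgs := memLp_sub hg hac hdb
      have hgs' : MemLp (fun x => g x - κ) 2 (vol c' (c' + 2 * l)) :=
        (memLp_sub hg h1 h3).sub (memLp_const_vol _ _ _)
      have e3 : |mean c d g - κ| ≤ l⁻¹ * (Real.sqrt l * ((2 * l) ^ θ * N)) := by
        rw [← mean_sub_const hcd hgs]
        refine (abs_mean_le hcd (memLp_sub hgs' h1' h4)).trans ?_
        rw [← hl_def]
        gcongr
        exact (nrm_mono hgs' h1' hcd.le h4).trans e2
      have hl1 : 0 < l ^ (θ - 1) := Real.rpow_pos_of_pos hdc _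
      have e4 : l⁻¹ * (Real.sqrt l * ((2 * l) ^ θ * N)) ≤
          2 * Real.sqrt (b - a) * N * l ^ (θ - 1) := by
        have q1 : (2 * l) ^ θ ≤ 2 * l ^ θ := by
          rw [Real.mul_rpow (by norm_num) hdc.le]
          gcongr
          calc (2 : ℝ) ^ θ ≤ 2 ^ (1 : ℝ) := Real.rpow_le_rpow_of_exponent_le (by norm_num) hθ.le
            _ = 2 := Real.rpow_one 2
        have q2 : l ^ θ = l ^ (θ - 1) * l := by
          rw [← Real.rpow_add_one hdc.ne', sub_add_cancel]
        calc l⁻¹ * (Real.sqrt l * ((2 * l) ^ θ * N))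
            ≤ l⁻¹ * (Real.sqrt (b - a) * ((2 * l ^ θ) * N)) := by
              gcongr
              linarith
          _ = _ := by
              rw [q2]
              field_simp
      have e5 : (2 * l) ^ (θ - 1) = 2 ^ (θ - 1) * l ^ (θ - 1) :=
        Real.mul_rpow (by norm_num) hdc.le
      rw [e5] at e1
      -- Doubling closes if `2 ^ (θ - 1) * Q + 2 √(b - a) ≤ Q`. The second summand of `meanConst` is
      -- chosen for this, and `θ < 1` makes it finite and positive.
      have e6 : 2 * Real.sqrt (b - a) ≤ meanConst a b θ * (1 - 2 ^ (θ - 1)) := by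
        rw [← div_le_iff₀ h2]
        unfold meanConst
        have : 0 ≤ ((b - a) / 2)⁻¹ * Real.sqrt (b - a) * (b - a) ^ (1 - θ) := by positivity
        linarith
      have e7 : |mean c d g| ≤ |mean c d g - κ| + |κ| := by
        have := abs_add_le (mean c d g - κ) κ
        rwa [sub_add_cancel] at this
      have e8 := mul_le_mul_of_nonneg_right e6 (mul_nonneg hN hl1.le)
      nlinarith
  intro c d hac hcd hdb
  have hdc : 0 < d - c := by linarith
  obtain ⟨n, hn⟩ := pow_unbounded_of_one_lt ((b - a) / (d - c)) (one_lt_two)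
  refine key n c d hac hcd hdb ?_
  rw [div_lt_iff₀ hdc] at hn
  rw [div_le_iff₀ (by positivity)]
  nlinarith

theorem measurable_slobodeckij_kernel {θ : ℝ} {g : ℝ → ℝ} (hg : Measurable g) :
    Measurable fun z : ℝ × ℝ =>
      ENNReal.ofReal ((g z.1 - g z.2) ^ 2 / |z.1 - z.2| ^ (1 + 2 * θ)) := by
  refine ENNReal.measurable_ofReal.comp (Measurable.div ?_ ?_)
  · exact ((hg.comp measurable_fst).sub (hg.comp measurable_snd)).pow_const 2
  · exact ((measurable_fst.sub measurable_snd).abs).pow_const _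

/-- The density is the inner integral of the Slobodeckij double integral as a function of its first
variable; measurability of `g` makes this function measurable. The constants are the means. -/
theorem reg_of_slobodeckij_of_measurable {a b θ N : ℝ} (hab : a < b) (hθ₀ : 0 < θ) (hθ : θ < 1)
    (hN : 0 ≤ N) {g : ℝ → ℝ} (hgm : Measurable g) (hg : MemLp g 2 (vol a b))
    (hgN : nrm a b g ≤ N) (hs : slobodeckijSq a b θ g ≤ ENNReal.ofReal (N ^ 2)) :
    Reg a b θ ((1 + meanConst a b θ) * N) g := by
  have hmc := meanConst_nonneg hab.le hθ
  set R : ℝ → ℝ≥0∞ := fun x => ∫⁻ y in Ioo a b,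
    ENNReal.ofReal ((g x - g y) ^ 2 / |x - y| ^ (1 + 2 * θ)) with hR
  have hRm : Measurable R := Measurable.lintegral_prod_right' (measurable_slobodeckij_kernel hgm)
  have hRfin : ∫⁻ x in Ioo a b, R x ≠ ⊤ := (hs.trans_lt ENNReal.ofReal_lt_top).ne
  have hRae : ∀ᵐ x ∂vol a b, R x < ⊤ := ae_lt_top hRm hRfin
  have hρi : Integrable (fun x => (R x).toReal) (vol a b) :=
    integrable_toReal_of_lintegral_ne_top hRm.aemeasurable hRfin
  have hρmass : ∫ x in a..b, (R x).toReal ≤ N ^ 2 := by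
    rw [← integral_Ioo_eq_interval hab.le, integral_toReal hRm.aemeasurable hRae]
    exact ENNReal.toReal_le_of_le_ofReal (sq_nonneg _) hs
  have hρ : Density a b N fun x => (R x).toReal :=
    ⟨intervalIntegrable_of_integrable_vol hab.le hρi, fun _ => ENNReal.toReal_nonneg, hρmass⟩
  have hosc : ∀ c d, a ≤ c → c < d → d ≤ b →
      ∫ x in c..d, (g x - mean c d g) ^ 2 ≤ (d - c) ^ (2 * θ) * ∫ x in c..d, (R x).toReal := by
    intro c d hac hcd hdb
    have hdc : 0 < d - c := by linarith
    have hgs := memLp_sub hg hac hdb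
    have hsub : Ioo c d ⊆ Ioo a b := Ioo_subset_Ioo hac hdb
    rw [← intervalIntegral.integral_const_mul, ← integral_Ioo_eq_interval hcd.le,
      ← integral_Ioo_eq_interval hcd.le]
    have hm : MemLp (fun x => g x - mean c d g) 2 (vol c d) := hgs.sub (memLp_const_vol c d _)
    refine integral_mono_ae hm.integrable_sq
      ((hρi.mono_measure (Measure.restrict_mono hsub le_rfl)).const_mul _) ?_
    filter_upwards [ae_mono (Measure.restrict_mono hsub le_rfl) hRae,
      ae_restrict_mem measurableSet_Ioo] with x hx hxI
    have hgx : MemLp (fun y => g y - g x) 2 (vol c d) := hgs.sub (memLp_const_vol c d _)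
    -- Jensen's inequality: `mean c d g - g x` is the mean of `g y - g x` over `y`.
    have h1 : (g x - mean c d g) ^ 2 ≤ (d - c)⁻¹ * ∫ y in c..d, (g y - g x) ^ 2 := by
      have e := abs_mean_le hcd hgx
      rw [mean_sub_const hcd hgs, abs_sub_comm] at e
      have e' := pow_le_pow_left₀ (abs_nonneg _) e 2
      rw [sq_abs, mul_pow, mul_pow, Real.sq_sqrt hdc.le, nrm_sq hcd.le] at e'
      refine e'.trans (le_of_eq ?_)
      field_simp
    -- The kernel is inserted by means of `|x - y| ≤ d - c`.
    have h2 : ∫ y in c..d, (g y - g x) ^ 2 ≤ (d - c) ^ (1 + 2 * θ) * (R x).toReal := by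
      rw [← integral_Ioo_eq_interval hcd.le]
      have hp : 0 ≤ (d - c) ^ (1 + 2 * θ) := Real.rpow_nonneg hdc.le _
      rw [← ENNReal.ofReal_le_ofReal_iff (mul_nonneg hp ENNReal.toReal_nonneg),
        ENNReal.ofReal_mul hp, ENNReal.ofReal_toReal hx.ne,
        ofReal_integral_eq_lintegral_ofReal hgx.integrable_sq
          (Filter.Eventually.of_forall fun _ => sq_nonneg _)]
      calc ∫⁻ y in Ioo c d, ENNReal.ofReal ((g y - g x) ^ 2)
          ≤ ∫⁻ y in Ioo c d, ENNReal.ofReal ((d - c) ^ (1 + 2 * θ)) *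
              ENNReal.ofReal ((g x - g y) ^ 2 / |x - y| ^ (1 + 2 * θ)) := by
            refine setLIntegral_mono' measurableSet_Ioo fun y hy => ?_
            rw [← ENNReal.ofReal_mul hp]
            refine ENNReal.ofReal_le_ofReal ?_
            rcases eq_or_ne x y with rfl | hxy
            · simp
            have habs : 0 < |x - y| := abs_pos.mpr (sub_ne_zero.mpr hxy)
            have hle : |x - y| ≤ d - c := by
              rw [abs_le]
              constructor <;> linarith [hxI.1, hxI.2, hy.1, hy.2]
            rw [mul_div_assoc', le_div_iff₀ (Real.rpow_pos_of_pos habs _), mul_comm,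
              show (g y - g x) ^ 2 = (g x - g y) ^ 2 by ring]
            exact mul_le_mul_of_nonneg_right
              (Real.rpow_le_rpow habs.le hle (by linarith)) (sq_nonneg _)
        _ = ENNReal.ofReal ((d - c) ^ (1 + 2 * θ)) * ∫⁻ y in Ioo c d,
              ENNReal.ofReal ((g x - g y) ^ 2 / |x - y| ^ (1 + 2 * θ)) :=
            lintegral_const_mul' _ _ ENNReal.ofReal_ne_top
        _ ≤ _ := by
            gcongr
            exact lintegral_mono' (Measure.restrict_mono hsub le_rfl) le_rfl
    refine h1.trans ((mul_le_mul_of_nonneg_left h2 (inv_pos.mpr hdc).le).trans (le_of_eq ?_))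
    rw [Real.rpow_add hdc, Real.rpow_one]
    field_simp
  have hmean := abs_mean_le_rpow hab hθ hN hg hgN (fun c d hac hcd hdb => by
    have hdc : 0 < d - c := by linarith
    refine nrm_le_of_sq_le (by positivity) ((hosc c d hac hcd hdb).trans ?_)
    rw [mul_pow, ← Real.rpow_natCast ((d - c) ^ θ), ← Real.rpow_mul hdc.le, mul_comm 2 θ]
    refine mul_le_mul_of_nonneg_left (hρ.integral_le hac hcd.le hdb) ?_
    positivity)
  refine ⟨hg, _, ⟨hρ.1, hρ.2, hρ.3.trans ?_⟩, fun c d hac hcd hdb =>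
    ⟨mean c d g, hosc c d hac hcd hdb, (hmean c d hac hcd hdb).trans ?_⟩⟩
  · rw [mul_pow]
    exact le_mul_of_one_le_left (sq_nonneg _) (one_le_pow₀ (by linarith))
  · have hdc : 0 < d - c := by linarith
    gcongr
    linarith

/-- Norm, seminorm and conclusion ignore null sets, so a measurable representative may take the
place of `g`. -/
theorem reg_of_slobodeckij {a b θ N : ℝ} (hab : a < b) (hθ₀ : 0 < θ) (hθ : θ < 1)
    (hN : 0 ≤ N) {g : ℝ → ℝ} (hg : MemLp g 2 (vol a b))
    (hgN : nrm a b g ≤ N) (hs : slobodeckijSq a b θ g ≤ ENNReal.ofReal (N ^ 2)) :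
    Reg a b θ ((1 + meanConst a b θ) * N) g := by
  have hae : ∀ᵐ x ∂vol a b, g x = hg.1.mk g x := hg.1.ae_eq_mk
  refine Reg.congr (reg_of_slobodeckij_of_measurable hab hθ₀ hθ hN
    hg.1.stronglyMeasurable_mk.measurable ((memLp_congr_ae hae).mp hg) ?_ ?_)
    (hae.mono fun _ h => h.symm)
  · rwa [← nrm_congr hae hab.le]
  · rwa [← slobodeckijSq_congr hae]

/-- The top derivative of a function in `H^σ` is approximated by constants with order `fract σ`. -/
theorem MemH.reg {a b σ : ℝ} (hab : a < b) {u v : ℝ → ℝ} (hu : MemH a b σ u)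
    (hv : MemLp v 2 (vol a b)) (h : ∀ᵐ x ∂vol a b, v x = weakDeriv a b ⌊σ⌋₊ u x) :
    Reg a b (Int.fract σ) ((1 + meanConst a b (Int.fract σ)) * normH a b σ u) v := by
  have hn := nrm_le_normH hab le_rfl h
  have h0 := normH_nonneg a b σ u
  rcases (Int.fract_nonneg σ).eq_or_lt with hz | hz
  · rw [← hz]
    refine Reg.of_zero hab.le hv (hn.trans ?_)
    have := meanConst_nonneg hab.le (θ := 0) (by norm_num)
    nlinarith
  · exact reg_of_slobodeckij hab hz (Int.fract_lt_one σ) h0 hv hn (slobodeckijSq_le_normH hz hu h)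

/-! ### Products -/

/-- The Leibniz expression for the derivative of order `l` of a product. -/
noncomputable def leibniz (A V : ℕ → ℝ → ℝ) (l : ℕ) (x : ℝ) : ℝ :=
  ∑ p ∈ Finset.HasAntidiagonal.antidiagonal l, (l.choose p.1 : ℝ) * (A p.1 x * V p.2 x)

/-- Pascal's rule. In this form the next Leibniz expression is visibly the termwise derivative of
the previous one. -/
theorem leibniz_succ (A V : ℕ → ℝ → ℝ) (l : ℕ) (x : ℝ) :
    leibniz A V (l + 1) x = ∑ p ∈ Finset.HasAntidiagonal.antidiagonal l,
      (l.choose p.1 : ℝ) * (A p.1 x * V (p.2 + 1) x + A (p.1 + 1) x * V p.2 x) := by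
  unfold leibniz
  rw [Finset.sum_antidiagonal_choose_succ_mul (R := ℝ) (fun i j => A i x * V j x), ← Finset.sum_add_distrib]
  refine Finset.sum_congr rfl fun p hp => ?_
  rw [mul_add]
  congr 2
  rw [← Finset.HasAntidiagonal.mem_antidiagonal.mp hp, Nat.choose_symm_add]

theorem prim_leibniz {a b : ℝ} {A V : ℕ → ℝ → ℝ} {l : ℕ}
    (hA : ∀ j ≤ l, Prim a b (A j) (A (j + 1))) (hV : ∀ j ≤ l, Prim a b (V j) (V (j + 1))) :
    Prim a b (leibniz A V l) (leibniz A V (l + 1)) := by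
  have := Prim.sum (Finset.HasAntidiagonal.antidiagonal l) (a := a) (b := b)
    (F := fun p x => (l.choose p.1 : ℝ) * (A p.1 x * V p.2 x))
    (f := fun p x => (l.choose p.1 : ℝ) * (A p.1 x * V (p.2 + 1) x + A (p.1 + 1) x * V p.2 x))
    (fun p hp => by
      have hp := Finset.HasAntidiagonal.mem_antidiagonal.mp hp
      exact ((hA p.1 (by omega)).mul (hV p.2 (by omega))).const_mul _)
  have e : leibniz A V (l + 1) = _ := funext (leibniz_succ A V l)
  rw [e]
  exact this

theorem Approx.lift_iterate {a b α M : ℝ} {l : ℕ} (n : ℕ) {U : ℕ → ℝ → ℝ}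
    (hU : ∀ j < n, Prim a b (U j) (U (j + 1))) (h : Approx a b α M l (U n)) :
    Approx a b (α + n) M (l + n) (U 0) := by
  induction n generalizing α l with
  | zero => simpa using h
  | succ n ih =>
    have := ih (fun j hj => hU j (by omega)) (h.lift (hU n (by omega)))
    convert this using 1
    · push_cast
      ring
    · ring

/-- The derivative of a product of functions in `H^{m+1+θ}` has the approximation properties of a
function in `H^{m+θ}`. -/
theorem exists_approx_leibniz {a b θ : ℝ} (hab : a < b) (hθ : θ ≤ 1) (m : ℕ)
    {K : ℝ} (hK : 0 ≤ K) : ∃ C : ℝ, 0 ≤ C ∧ ∀ (A V : ℕ → ℝ → ℝ) (NA NV : ℝ),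
      (∀ j < m + 1, Prim a b (A j) (A (j + 1))) → (∀ j < m + 1, Prim a b (V j) (V (j + 1))) →
      (∀ j ≤ m + 1, nrm a b (A j) ≤ NA) → (∀ j ≤ m + 1, nrm a b (V j) ≤ NV) →
      Reg a b θ (K * NA) (A (m + 1)) → Reg a b θ (K * NV) (V (m + 1)) →
      Approx a b (θ + m) (C * (NA * NV)) m (leibniz A V 1) := by
  have hs := supConst_nonneg a b
  have hba : 0 < b - a := by linarith
  set S := 1 + supConst a b with hS
  -- One constant for both sources of regularity: `K` for the top derivatives, and the constant of
  -- `Prim.reg` for the lower ones.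
  set K' := K + S * (b - a) ^ (1 - θ) with hK'
  have hK'0 : 0 ≤ K' := by positivity
  refine ⟨2 ^ (m + 2) * ∑ i ∈ Finset.range (m + 2), ((m + 1).choose i : ℝ) * (2 * S * K'),
    by positivity, fun A V NA NV hA hV hAn hVn hAr hVr => ?_⟩
  have hNA : 0 ≤ NA := (nrm_nonneg _ _ _).trans (hAn 0 (by omega))
  have hNV : 0 ≤ NV := (nrm_nonneg _ _ _).trans (hVn 0 (by omega))
  -- The orders `i` and `m + 1 - i` are never both maximal, so at least one factor is a primitive
  -- and `Reg.mul` applies with the other one as the rough factor.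
  have term : ∀ i < m + 2, Approx a b θ (2 * S * K' * (NA * NV)) 0
      fun x => A i x * V (m + 1 - i) x := by
    intro i hi
    rcases Nat.lt_or_ge i (m + 1) with him | him
    · have hb : ∀ x ∈ Icc a b, |A i x| ≤ S * NA := fun x hx =>
        ((hA i him).abs_le_supConst hab (hAn i him.le) (hAn (i + 1) (by omega)) hx).trans (by
          gcongr
          linarith)
      have hb' : nrm a b (A (i + 1)) ≤ S * NA := (hAn (i + 1) (by omega)).trans
        (le_mul_of_one_le_left hNA (by linarith))
      rcases Nat.eq_zero_or_pos i with rfl | hi0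
      · refine (Reg.mul (by positivity) hVr (hA 0 him) hb hb').mono_const (by positivity) ?_
        calc 2 * (S * NA) * (K * NV) = 2 * S * K * (NA * NV) := by ring
          _ ≤ _ := by
            gcongr
            rw [hK']
            have : 0 ≤ S * (b - a) ^ (1 - θ) := by positivity
            linarith
      · have hr := (hV (m + 1 - i) (by omega)).reg hab hθ (hVn _ (by omega)) (hVn _ (by omega))
        refine (Reg.mul (by positivity) hr (hA i him) hb hb').mono_const (by positivity) ?_
        calc 2 * (S * NA) * (S * (b - a) ^ (1 - θ) * NV) =
            2 * S * (S * (b - a) ^ (1 - θ)) * (NA * NV) := by ring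
          _ ≤ _ := by
            gcongr
            linarith
    · obtain rfl : i = m + 1 := by omega
      rw [Nat.sub_self]
      have hb : ∀ x ∈ Icc a b, |V 0 x| ≤ S * NV := fun x hx =>
        ((hV 0 (by omega)).abs_le_supConst hab (hVn 0 (by omega)) (hVn 1 (by omega)) hx).trans (by
          gcongr
          linarith)
      have hb' : nrm a b (V 1) ≤ S * NV := (hVn 1 (by omega)).trans
        (le_mul_of_one_le_left hNV (by linarith))
      have := (Reg.mul (by positivity) hAr (hV 0 (by omega)) hb hb').mono_const (by positivity)
        (M' := 2 * S * K' * (NA * NV)) (by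
          calc 2 * (S * NV) * (K * NA) = 2 * S * K * (NA * NV) := by ring
            _ ≤ _ := by
              gcongr
              rw [hK']
              have : 0 ≤ S * (b - a) ^ (1 - θ) := by positivity
              linarith)
      simpa only [mul_comm] using this
  have top : Approx a b θ ((2 ^ (m + 2) * ∑ i ∈ Finset.range (m + 2),
      ((m + 1).choose i : ℝ) * (2 * S * K')) * (NA * NV)) 0 (leibniz A V (m + 1)) := by
    have := Approx.sum_range (m + 2)
      (M := fun i => ((m + 1).choose i : ℝ) * (2 * S * K' * (NA * NV)))
      (fun i _ => by positivity) (fun i hi => (term i hi).const_mul ((m + 1).choose i : ℝ))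
    convert this using 1
    · rw [mul_assoc, Finset.sum_mul]
      simp only [mul_assoc]
    · ext x
      unfold leibniz
      rw [Finset.Nat.sum_antidiagonal_eq_sum_range_succ_mk]
  -- The derivative of order `m + 1` of the product is integrated only `m` times, which ends at its
  -- first derivative.
  have := Approx.lift_iterate m (U := fun j => leibniz A V (j + 1))
    (fun j hj => prim_leibniz (fun i hi => hA i (by omega)) (fun i hi => hV i (by omega))) top
  simpa only [zero_add] using this

/-! ### The `L²` projection onto polynomials -/

theorem isL2Proj_l2Proj {y z : ℝ} (hyz : y < z) (r : ℕ) {u : ℝ → ℝ} (hu : MemLp u 2 (vol y z)) :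
    IsL2Proj y z r u (l2Proj y z r u) :=
  Classical.epsilon_spec (existsUnique_isL2Proj hyz r (memLp_intervalIntegrable hu hyz.le)).exists

theorem IsL2Proj.eq_l2Proj {y z : ℝ} (hyz : y < z) {r : ℕ} {u : ℝ → ℝ} (hu : MemLp u 2 (vol y z))
    {p : ℝ[X]} (hp : IsL2Proj y z r u p) : l2Proj y z r u = p :=
  (existsUnique_isL2Proj hyz r (memLp_intervalIntegrable hu hyz.le)).unique
    (isL2Proj_l2Proj hyz r hu) hp

/-- The defining predicates coincide, so `epsilon` makes the same choice; no integrability enters.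
-/
theorem l2Proj_congr {y z : ℝ} (hyz : y ≤ z) (r : ℕ) {u v : ℝ → ℝ}
    (h : ∀ᵐ x ∂vol y z, u x = v x) : l2Proj y z r u = l2Proj y z r v := by
  have : (fun p => IsL2Proj y z r u p) = fun p => IsL2Proj y z r v p := by
    ext p
    unfold IsL2Proj
    refine and_congr_right fun _ => forall₂_congr fun q _ => ?_
    rw [integral_congr_sub h le_rfl hyz le_rfl fun x t => t * q.eval x]
  unfold l2Proj
  rw [this]

theorem l2Proj_mem_P {y z : ℝ} (hyz : y < z) (r : ℕ) {u : ℝ → ℝ}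
    (hu : MemLp u 2 (vol y z)) : l2Proj y z r u ∈ P r := (isL2Proj_l2Proj hyz r hu).1

theorem integral_l2Proj_mul {y z : ℝ} (hyz : y < z) (r : ℕ) {u : ℝ → ℝ}
    (hu : MemLp u 2 (vol y z)) {q : ℝ[X]} (hq : q ∈ P r) :
    ∫ x in y..z, (l2Proj y z r u).eval x * q.eval x = ∫ x in y..z, u x * q.eval x :=
  (isL2Proj_l2Proj hyz r hu).2 q hq

theorem integral_sub_l2Proj_mul {y z : ℝ} (hyz : y < z) (r : ℕ) {u : ℝ → ℝ}
    (hu : MemLp u 2 (vol y z)) {q : ℝ[X]} (hq : q ∈ P r) :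
    ∫ x in y..z, (u x - (l2Proj y z r u).eval x) * q.eval x = 0 := by
  simp only [sub_mul]
  rw [intervalIntegral.integral_sub (memLp_intervalIntegrable_mul hu (memLp_eval _ _ _) hyz.le)
    (memLp_intervalIntegrable_mul (memLp_eval _ _ _) (memLp_eval _ _ _) hyz.le),
    integral_l2Proj_mul hyz r hu hq, sub_self]

theorem memLp_sub_l2Proj {y z : ℝ} (r : ℕ) {u : ℝ → ℝ}
    (hu : MemLp u 2 (vol y z)) : MemLp (fun x => u x - (l2Proj y z r u).eval x) 2 (vol y z) :=
  hu.sub (memLp_eval _ _ _)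

/-- Pythagoras: `u - p` is orthogonal to `p - q`. -/
theorem integral_sub_l2Proj_sq_le {y z : ℝ} (hyz : y < z) (r : ℕ) {u : ℝ → ℝ}
    (hu : MemLp u 2 (vol y z)) {q : ℝ[X]} (hq : q ∈ P r) :
    ∫ x in y..z, (u x - (l2Proj y z r u).eval x) ^ 2 ≤ ∫ x in y..z, (u x - q.eval x) ^ 2 := by
  set p := l2Proj y z r u with hp
  have hm := memLp_sub_l2Proj r hu
  have e : ∀ x, (u x - q.eval x) ^ 2 = (u x - p.eval x) ^ 2 +
      2 * ((u x - p.eval x) * (p - q).eval x) + (p - q).eval x ^ 2 := fun x => by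
    rw [eval_sub]
    ring
  have h0 := integral_sub_l2Proj_mul hyz r hu (sub_mem (l2Proj_mem_P hyz r hu) hq)
  simp only [e]
  rw [intervalIntegral.integral_add ((memLp_intervalIntegrable_sq hm hyz.le).add
    ((memLp_intervalIntegrable_mul hm (memLp_eval _ _ _) hyz.le).const_mul 2))
    (memLp_intervalIntegrable_sq (memLp_eval _ _ _) hyz.le),
    intervalIntegral.integral_add (memLp_intervalIntegrable_sq hm hyz.le)
    ((memLp_intervalIntegrable_mul hm (memLp_eval _ _ _) hyz.le).const_mul 2),
    intervalIntegral.integral_const_mul, h0]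
  have := integral_sq_nonneg hyz.le fun x => (p - q).eval x
  linarith

theorem nrm_l2Proj_le {y z : ℝ} (hyz : y < z) (r : ℕ) {u : ℝ → ℝ}
    (hu : MemLp u 2 (vol y z)) : nrm y z (fun x => (l2Proj y z r u).eval x) ≤ nrm y z u := by
  have h1 := integral_l2Proj_mul hyz r hu (l2Proj_mem_P hyz r hu)
  have h2 := (le_abs_self _).trans
    (abs_integral_mul_le hyz.le hu (memLp_eval y z (l2Proj y z r u)))
  simp only [← sq] at h1
  rw [← h1, ← nrm_sq hyz.le] at h2
  have h3 := nrm_nonneg y z (fun x => (l2Proj y z r u).eval x)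
  have h4 := nrm_nonneg y z u
  by_contra! h
  nlinarith

theorem integral_l2Proj {y z : ℝ} (hyz : y < z) (r : ℕ) {u : ℝ → ℝ}
    (hu : MemLp u 2 (vol y z)) : ∫ x in y..z, (l2Proj y z r u).eval x = ∫ x in y..z, u x := by
  simpa using integral_l2Proj_mul hyz r hu (C_mem_P r 1)

/-! ### The discrete weak derivative -/

theorem isDiscreteWeakDeriv_discreteWeakDeriv {y z : ℝ} (hyz : y < z) (r : ℕ) (v₀ : ℝ[X])
    (vy vz : ℝ) : IsDiscreteWeakDeriv y z r v₀ vy vz (discreteWeakDeriv y z r v₀ vy vz) :=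
  Classical.epsilon_spec (existsUnique_isDiscreteWeakDeriv hyz r v₀ vy vz).exists

theorem IsDiscreteWeakDeriv.eq {y z : ℝ} (hyz : y < z) {r : ℕ} {v₀ : ℝ[X]} {vy vz : ℝ} {p : ℝ[X]}
    (hp : IsDiscreteWeakDeriv y z r v₀ vy vz p) : discreteWeakDeriv y z r v₀ vy vz = p :=
  (existsUnique_isDiscreteWeakDeriv hyz r v₀ vy vz).unique
    (isDiscreteWeakDeriv_discreteWeakDeriv hyz r v₀ vy vz) hp

theorem intervalIntegrable_eval_mul (y z : ℝ) (p q : ℝ[X]) :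
    IntervalIntegrable (fun x => p.eval x * q.eval x) volume y z :=
  (p.continuous.mul q.continuous).intervalIntegrable _ _

theorem integral_eval_mul_add (y z : ℝ) (p q w : ℝ[X]) :
    ∫ x in y..z, (p + q).eval x * w.eval x =
      (∫ x in y..z, p.eval x * w.eval x) + ∫ x in y..z, q.eval x * w.eval x := by
  rw [← intervalIntegral.integral_add (intervalIntegrable_eval_mul y z p w)
    (intervalIntegrable_eval_mul y z q w)]
  simp only [eval_add, add_mul]

theorem integral_eval_mul_smul (y z t : ℝ) (p w : ℝ[X]) :
    ∫ x in y..z, (t • p).eval x * w.eval x = t * ∫ x in y..z, p.eval x * w.eval x := by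
  rw [← intervalIntegral.integral_const_mul]
  simp only [eval_smul, smul_eq_mul, mul_assoc]

theorem integral_eval_mul_sub (y z : ℝ) (p q w : ℝ[X]) :
    ∫ x in y..z, (p - q).eval x * w.eval x =
      (∫ x in y..z, p.eval x * w.eval x) - ∫ x in y..z, q.eval x * w.eval x := by
  rw [← intervalIntegral.integral_sub (intervalIntegrable_eval_mul y z p w)
    (intervalIntegrable_eval_mul y z q w)]
  simp only [eval_sub, sub_mul]

theorem IsDiscreteWeakDeriv.sub {y z : ℝ} {r : ℕ} {v₀ w₀ : ℝ[X]} {vy vz wy wz : ℝ} {p q : ℝ[X]}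
    (hp : IsDiscreteWeakDeriv y z r v₀ vy vz p) (hq : IsDiscreteWeakDeriv y z r w₀ wy wz q) :
    IsDiscreteWeakDeriv y z r (v₀ - w₀) (vy - wy) (vz - wz) (p - q) := by
  refine ⟨sub_mem hp.1 hq.1, fun t ht => ?_⟩
  rw [integral_eval_mul_sub, integral_eval_mul_sub, hp.2 t ht, hq.2 t ht]
  ring

/-- Integration by parts against a polynomial. -/
theorem Prim.integral_deriv_mul_eval {y z : ℝ} (hyz : y ≤ z) {F f : ℝ → ℝ} (h : Prim y z F f)
    (q : ℝ[X]) : ∫ x in y..z, f x * q.eval x =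
      -(∫ x in y..z, F x * q.derivative.eval x) + F z * q.eval z - F y * q.eval y := by
  have := (h.mul (Prim.of_polynomial y z q)).integral_eq (x := y) (y := z) ⟨le_rfl, hyz⟩
    ⟨hyz, le_rfl⟩
  rw [intervalIntegral.integral_add
    (memLp_intervalIntegrable_mul h.memLp_self (memLp_eval _ _ _) hyz)
    (memLp_intervalIntegrable_mul h.memLp (memLp_eval _ _ _) hyz)] at this
  linarith

/-- The commuting property: the discrete weak derivative of the projection of a function is the
projection of its derivative. -/
theorem isDiscreteWeakDeriv_l2Proj {y z : ℝ} (hyz : y < z) (k : ℕ) {F f : ℝ → ℝ}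
    (h : Prim y z F f) :
    IsDiscreteWeakDeriv y z (k + 1) (l2Proj y z k F) (F y) (F z) (l2Proj y z (k + 1) f) := by
  refine ⟨l2Proj_mem_P hyz _ h.memLp, fun q hq => ?_⟩
  -- As `q ∈ P_{k+1}` and `q' ∈ P_k`, both projections drop out and ordinary integration by parts
  -- remains.
  rw [integral_l2Proj_mul hyz _ h.memLp hq, integral_l2Proj_mul hyz _ h.memLp_self
    (derivative_mem_P hq), h.integral_deriv_mul_eval hyz.le]

/-- A weak function is determined by its discrete weak derivative and its left endpoint value. -/
theorem IsDiscreteWeakDeriv.interior_eq {y z : ℝ} (hyz : y < z) {k : ℕ} {v₀ p : ℝ[X]} {vy vz : ℝ}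
    (hv : v₀ ∈ P k) (hp : IsDiscreteWeakDeriv y z (k + 1) v₀ vy vz p) :
    v₀ = l2Proj y z k (fun x => (antiderivFrom y vy p).eval x) := by
  have hW := prim_antiderivFrom y z y vy p
  refine (IsL2Proj.eq_l2Proj hyz hW.memLp_self ⟨hv, fun q hq => ?_⟩).symm
  -- Testing with the constant `1` shows that `vz - vy` is the integral of `p`.
  have hvz : vz = (antiderivFrom y vy p).eval z := by
    have := hp.2 (C 1) (C_mem_P _ _)
    simp at this
    rw [eval_antiderivFrom]
    linarith
  -- Every `q ∈ P_k` is the derivative of an admissible test function because `r = k + 1`; hence all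
  -- moments of `v₀` against `P_k` are determined.
  have h1 := hp.2 _ (antiderivFrom_mem_P y 0 hq)
  have h2 := hW.integral_deriv_mul_eval hyz.le (antiderivFrom y 0 q)
  rw [derivative_antiderivFrom] at h1 h2
  rw [h1, hvz, eval_antiderivFrom_self y vy] at h2
  linarith

/-! ### Inverse estimate -/

theorem natDegree_lt_of_mem_P {r : ℕ} {q : ℝ[X]} (hq : q ∈ P r) : q.natDegree < r + 1 := by
  rw [Nat.lt_succ_iff, Polynomial.natDegree_le_iff_coeff_eq_zero]
  exact fun N hN => mem_P_iff.mp hq N hN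

theorem comp_affine_mem_P {r : ℕ} {q : ℝ[X]} (hq : q ∈ P r) (y t : ℝ) :
    q.comp (C t * X + C y) ∈ P r := by
  rw [mem_P_iff]
  intro m hm
  refine coeff_eq_zero_of_natDegree_lt (lt_of_le_of_lt natDegree_comp_le ?_)
  have h1 := natDegree_lt_of_mem_P hq
  have h2 : (C t * X + C y : ℝ[X]).natDegree ≤ 1 := natDegree_linear_le
  nlinarith

/-- Each coefficient of `q` is its `L²` product with a fixed polynomial, hence bounded by the norm
of `q`; on the unit interval the coefficients bound the values. -/
theorem exists_unit_inverse_estimate (r : ℕ) : ∃ K : ℝ, 0 ≤ K ∧ ∀ q ∈ P r, ∀ x ∈ Icc (0 : ℝ) 1,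
    |q.eval x| ≤ K * nrm 0 1 fun t => q.eval t := by
  have h : ∀ j : ℕ, ∃ p : ℝ[X], ∀ q ∈ P r, ∫ x in (0 : ℝ)..1, p.eval x * q.eval x = q.coeff j := by
    intro j
    obtain ⟨p, ⟨-, hp⟩, -⟩ := existsUnique_representative (zero_lt_one' ℝ) r (Polynomial.lcoeff ℝ j)
    exact ⟨p, hp⟩
  choose p hp using h
  refine ⟨∑ j ∈ Finset.range (r + 1), nrm 0 1 fun t => (p j).eval t,
    Finset.sum_nonneg fun _ _ => nrm_nonneg _ _ _, fun q hq x hx => ?_⟩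
  rw [Polynomial.eval_eq_sum_range' (natDegree_lt_of_mem_P hq), Finset.sum_mul]
  refine (Finset.abs_sum_le_sum_abs _ _).trans (Finset.sum_le_sum fun j _ => ?_)
  rw [abs_mul, ← hp j q hq]
  have h1 : |x ^ j| ≤ 1 := by
    rw [abs_of_nonneg (pow_nonneg hx.1 j)]
    exact pow_le_one₀ hx.1 hx.2
  refine (mul_le_of_le_one_right (abs_nonneg _) h1).trans ?_
  exact abs_integral_mul_le zero_le_one (memLp_eval _ _ _) (memLp_eval _ _ _)

/-- Affine change of variables to the unit interval; the constant does not depend on the interval.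
-/
theorem exists_inverse_estimate (r : ℕ) : ∃ K : ℝ, 0 ≤ K ∧ ∀ y z : ℝ, y < z → ∀ q ∈ P r,
    ∀ x ∈ Icc y z, |q.eval x| * Real.sqrt (z - y) ≤ K * nrm y z fun t => q.eval t := by
  obtain ⟨K, hK, h⟩ := exists_unit_inverse_estimate r
  refine ⟨K, hK, fun y z hyz q hq x hx => ?_⟩
  have hzy : 0 < z - y := by linarith
  have h1 := h _ (comp_affine_mem_P hq y (z - y)) ((x - y) / (z - y))
    ⟨div_nonneg (by linarith [hx.1]) hzy.le, (div_le_one hzy).mpr (by linarith [hx.2])⟩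
  have e1 : (z - y) * ((x - y) / (z - y)) + y = x := by
    field_simp
    ring
  simp only [eval_comp, eval_add, eval_mul, eval_C, eval_X, e1] at h1
  have e2 : (nrm 0 1 fun t => q.eval ((z - y) * t + y)) * Real.sqrt (z - y) =
      nrm y z fun t => q.eval t := by
    unfold nrm
    rw [← Real.sqrt_mul (integral_sq_nonneg zero_le_one _),
      intervalIntegral.integral_comp_mul_add (fun t => q.eval t ^ 2) hzy.ne', smul_eq_mul]
    congr 1
    simp only [mul_zero, zero_add, mul_one, sub_add_cancel]
    field_simp
  rw [← e2, ← mul_assoc]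
  exact mul_le_mul_of_nonneg_right h1 (Real.sqrt_nonneg _)

/-! ### Meshes -/

namespace Mesh

variable {a b : ℝ} {n : ℕ} (T : Mesh a b n)

theorem lo_lt_hi (i : Fin n) : T.lo i < T.hi i := T.strictMono Fin.castSucc_lt_succ

theorem a_le_lo (i : Fin n) : a ≤ T.lo i := by
  refine T.node_zero.symm.le.trans ?_
  exact T.strictMono.monotone (Fin.zero_le _)

theorem hi_le_b (i : Fin n) : T.hi i ≤ b := by
  refine le_trans ?_ T.node_last.le
  exact T.strictMono.monotone (Fin.le_last _)

theorem lo_mem (i : Fin n) : T.lo i ∈ Icc a b :=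
  ⟨T.a_le_lo i, (T.lo_lt_hi i).le.trans (T.hi_le_b i)⟩

theorem hi_mem (i : Fin n) : T.hi i ∈ Icc a b :=
  ⟨(T.a_le_lo i).trans (T.lo_lt_hi i).le, T.hi_le_b i⟩

theorem length_pos (i : Fin n) : 0 < T.hi i - T.lo i := sub_pos.mpr (T.lo_lt_hi i)

theorem length_le (i : Fin n) : T.hi i - T.lo i ≤ b - a := by
  linarith [T.a_le_lo i, T.hi_le_b i]

theorem length_le_size (i : Fin n) : T.hi i - T.lo i ≤ T.size :=
  le_ciSup (f := fun i => T.hi i - T.lo i) (Set.finite_range _).bddAbove i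

theorem size_nonneg : 0 ≤ T.size := Real.iSup_nonneg fun i => (T.length_pos i).le

theorem memLp {f : ℝ → ℝ} (hf : MemLp f 2 (vol a b)) (i : Fin n) :
    MemLp f 2 (vol (T.lo i) (T.hi i)) :=
  memLp_sub hf (T.a_le_lo i) (T.hi_le_b i)

theorem Icc_subset (i : Fin n) : Icc (T.lo i) (T.hi i) ⊆ Icc a b :=
  Icc_subset_Icc (T.a_le_lo i) (T.hi_le_b i)

end Mesh

theorem sum_succ_sub_castSucc {n : ℕ} (x : Fin (n + 1) → ℝ) :
    ∑ i : Fin n, (x i.succ - x i.castSucc) = x (Fin.last n) - x 0 := by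
  induction n with
  | zero => simp
  | succ n ih =>
    rw [Fin.sum_univ_castSucc]
    have := ih (fun i => x i.castSucc)
    simp only [Fin.succ_castSucc] at this ⊢
    rw [this]
    simp

namespace Mesh

variable {a b : ℝ} {n : ℕ} (T : Mesh a b n)

theorem sum_sub (F : ℝ → ℝ) : ∑ i, (F (T.hi i) - F (T.lo i)) = F b - F a := by
  have := sum_succ_sub_castSucc fun j => F (T.node j)
  rw [T.node_zero, T.node_last] at this
  exact this

theorem sum_integral (hab : a ≤ b) {f : ℝ → ℝ} (hf : IntervalIntegrable f volume a b) :
    ∑ i, ∫ x in T.lo i..T.hi i, f x = ∫ x in a..b, f x := by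
  have h := T.sum_sub fun x => ∫ t in a..x, f t
  rw [intervalIntegral.integral_same, sub_zero] at h
  rw [← h]
  refine Finset.sum_congr rfl fun i _ => ?_
  rw [intervalIntegral.integral_interval_sub_left]
  · exact hf.mono_set (by
      rw [uIcc_of_le (T.hi_mem i).1, uIcc_of_le hab]
      exact Icc_subset_Icc le_rfl (T.hi_le_b i))
  · exact hf.mono_set (by
      rw [uIcc_of_le (T.a_le_lo i), uIcc_of_le hab]
      exact Icc_subset_Icc le_rfl (T.lo_mem i).2)

/-- The norm of a function given elementwise. -/
noncomputable def snrm (f : Fin n → ℝ → ℝ) : ℝ :=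
  Real.sqrt (∑ i, nrm (T.lo i) (T.hi i) (f i) ^ 2)

theorem snrm_nonneg (f : Fin n → ℝ → ℝ) : 0 ≤ T.snrm f := Real.sqrt_nonneg _

theorem snrm_sq (f : Fin n → ℝ → ℝ) : T.snrm f ^ 2 = ∑ i, nrm (T.lo i) (T.hi i) (f i) ^ 2 :=
  Real.sq_sqrt (Finset.sum_nonneg fun _ _ => sq_nonneg _)

theorem snrm_sq' (f : Fin n → ℝ → ℝ) : T.snrm f ^ 2 = ∑ i, ∫ x in T.lo i..T.hi i, f i x ^ 2 := by
  rw [snrm_sq]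
  exact Finset.sum_congr rfl fun i _ => nrm_sq (T.lo_lt_hi i).le _

theorem nrm_le_snrm (f : Fin n → ℝ → ℝ) (i : Fin n) :
    nrm (T.lo i) (T.hi i) (f i) ≤ T.snrm f := by
  refine Real.le_sqrt_of_sq_le ?_
  exact Finset.single_le_sum (f := fun i => nrm (T.lo i) (T.hi i) (f i) ^ 2)
    (fun _ _ => sq_nonneg _) (Finset.mem_univ i)

theorem snrm_const (hab : a ≤ b) {f : ℝ → ℝ} (hf : MemLp f 2 (vol a b)) :
    T.snrm (fun _ => f) = nrm a b f := by
  have h := T.snrm_sq' fun _ => f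
  rw [T.sum_integral hab (memLp_intervalIntegrable_sq hf hab)] at h
  unfold nrm
  rw [← h, Real.sqrt_sq (T.snrm_nonneg _)]

theorem snrm_add_le {f g : Fin n → ℝ → ℝ} (hf : ∀ i, MemLp (f i) 2 (vol (T.lo i) (T.hi i)))
    (hg : ∀ i, MemLp (g i) 2 (vol (T.lo i) (T.hi i))) :
    T.snrm (fun i x => f i x + g i x) ≤ T.snrm f + T.snrm g := by
  refine abs_le_of_sq_le_sq' ?_ (add_nonneg (T.snrm_nonneg _) (T.snrm_nonneg _)) |>.2
  have h1 : ∑ i, nrm (T.lo i) (T.hi i) (f i) * nrm (T.lo i) (T.hi i) (g i) ≤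
      T.snrm f * T.snrm g := Real.sum_mul_le_sqrt_mul_sqrt _ _ _
  rw [snrm_sq]
  calc ∑ i, nrm (T.lo i) (T.hi i) (fun x => f i x + g i x) ^ 2
      ≤ ∑ i, (nrm (T.lo i) (T.hi i) (f i) ^ 2 +
          2 * (nrm (T.lo i) (T.hi i) (f i) * nrm (T.lo i) (T.hi i) (g i)) +
          nrm (T.lo i) (T.hi i) (g i) ^ 2) := by
        refine Finset.sum_le_sum fun i _ => ?_
        have := pow_le_pow_left₀ (nrm_nonneg _ _ _)
          (nrm_add_le (T.lo_lt_hi i).le (hf i) (hg i)) 2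
        exact this.trans (le_of_eq (by ring))
    _ = T.snrm f ^ 2 + 2 * ∑ i, nrm (T.lo i) (T.hi i) (f i) * nrm (T.lo i) (T.hi i) (g i) +
          T.snrm g ^ 2 := by
        rw [Finset.sum_add_distrib, Finset.sum_add_distrib, snrm_sq, snrm_sq, Finset.mul_sum]
    _ ≤ _ := by nlinarith

theorem snrm_le_of_bound {f : Fin n → ℝ → ℝ} {M : ℝ}
    (hM : 0 ≤ M) (hf : ∀ i, MemLp (f i) 2 (vol (T.lo i) (T.hi i)))
    (h : ∀ i, ∀ x ∈ Icc (T.lo i) (T.hi i), |f i x| ≤ M) :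
    T.snrm f ≤ M * Real.sqrt (b - a) := by
  have hs : 0 ≤ M * Real.sqrt (b - a) := mul_nonneg hM (Real.sqrt_nonneg _)
  rw [← Real.sqrt_sq hs]
  refine Real.sqrt_le_sqrt ?_
  rcases le_or_gt a b with hab | hab
  · rw [mul_pow, Real.sq_sqrt (by linarith)]
    have := T.sum_sub id
    simp only [id] at this
    rw [← this, Finset.mul_sum]
    refine Finset.sum_le_sum fun i _ => ?_
    have h1 := nrm_le_mul (T.lo_lt_hi i).le hM (hf i) (memLp_const_vol _ _ 1) (by
      filter_upwards [ae_restrict_mem measurableSet_Ioo] with x hx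
      simpa using h i x (Ioo_subset_Icc_self hx))
    rw [nrm_const (T.lo_lt_hi i).le, abs_one, one_mul] at h1
    refine (pow_le_pow_left₀ (nrm_nonneg _ _ _) h1 2).trans (le_of_eq ?_)
    rw [mul_pow, Real.sq_sqrt (T.length_pos i).le]
  · refine (Finset.sum_nonpos fun i _ => ?_).trans (sq_nonneg _)
    have := T.length_pos i
    have := T.length_le i
    linarith

theorem sum_abs_integral_le {f : Fin n → ℝ → ℝ}
    (hf : ∀ i, MemLp (f i) 2 (vol (T.lo i) (T.hi i))) :
    ∑ i, |∫ x in T.lo i..T.hi i, f i x| ≤ Real.sqrt (b - a) * T.snrm f := by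
  have h1 := Real.sum_mul_le_sqrt_mul_sqrt (Finset.univ : Finset (Fin n))
    (fun i => Real.sqrt (T.hi i - T.lo i)) fun i => nrm (T.lo i) (T.hi i) (f i)
  have h2 : ∑ i, Real.sqrt (T.hi i - T.lo i) ^ 2 = b - a := by
    refine Eq.trans ?_ (T.sum_sub id)
    exact Finset.sum_congr rfl fun i _ => Real.sq_sqrt (T.length_pos i).le
  rw [h2] at h1
  exact (Finset.sum_le_sum fun i _ => abs_integral_le_nrm (T.lo_lt_hi i).le (hf i)).trans h1

end Mesh

/-! ### Weak functions from their discrete weak derivatives -/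

/-- Partial sums over the elements to the left of a node. -/
def nodal {n : ℕ} (c : Fin n → ℝ) (j : Fin (n + 1)) : ℝ :=
  ∑ i ∈ Finset.univ.filter (fun i : Fin n => i.castSucc < j), c i

theorem nodal_zero {n : ℕ} (c : Fin n → ℝ) : nodal c 0 = 0 := by
  simp [nodal]

theorem nodal_succ {n : ℕ} (c : Fin n → ℝ) (i : Fin n) :
    nodal c i.succ = nodal c i.castSucc + c i := by
  unfold nodal
  have : Finset.univ.filter (fun j : Fin n => j.castSucc < i.succ) =
      insert i (Finset.univ.filter fun j : Fin n => j.castSucc < i.castSucc) := by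
    ext j
    simp only [Finset.mem_filter, Finset.mem_univ, true_and, Finset.mem_insert,
      Fin.castSucc_lt_succ_iff, Fin.castSucc_lt_castSucc_iff, le_iff_eq_or_lt]
  rw [this, Finset.sum_insert (by simp), add_comm]

theorem abs_nodal_le {n : ℕ} (c : Fin n → ℝ) (j : Fin (n + 1)) : |nodal c j| ≤ ∑ i, |c i| :=
  (Finset.abs_sum_le_sum_abs _ _).trans (Finset.sum_le_sum_of_subset_of_nonneg
    (Finset.filter_subset _ _) fun _ _ _ => abs_nonneg _)

theorem nodal_add {n : ℕ} (c d : Fin n → ℝ) (j : Fin (n + 1)) :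
    nodal (fun i => c i + d i) j = nodal c j + nodal d j := Finset.sum_add_distrib

theorem nodal_mul {n : ℕ} (t : ℝ) (c : Fin n → ℝ) (j : Fin (n + 1)) :
    nodal (fun i => t * c i) j = t * nodal c j := (Finset.mul_sum _ _ _).symm

theorem antiderivFrom_add (y v w : ℝ) (p q : ℝ[X]) :
    antiderivFrom y (v + w) (p + q) = antiderivFrom y v p + antiderivFrom y w q := by
  unfold antiderivFrom
  rw [antideriv.map_add, eval_add, C_add, C_add]
  ring

theorem antiderivFrom_smul (y v t : ℝ) (p : ℝ[X]) :
    antiderivFrom y (t * v) (t • p) = t • antiderivFrom y v p := by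
  unfold antiderivFrom
  rw [antideriv.map_smul, eval_smul, smul_eq_mul, C_mul, C_mul, smul_eq_C_mul, smul_eq_C_mul]
  ring

theorem l2Proj_eval_add {y z : ℝ} (hyz : y < z) (r : ℕ) (p q : ℝ[X]) :
    l2Proj y z r (fun x => (p + q).eval x) =
      l2Proj y z r (fun x => p.eval x) + l2Proj y z r fun x => q.eval x := by
  refine IsL2Proj.eq_l2Proj hyz (memLp_eval _ _ _) ⟨add_mem (l2Proj_mem_P hyz r (memLp_eval _ _ _))
    (l2Proj_mem_P hyz r (memLp_eval _ _ _)), fun w hw => ?_⟩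
  rw [integral_eval_mul_add, integral_eval_mul_add, integral_l2Proj_mul hyz r (memLp_eval _ _ _) hw,
    integral_l2Proj_mul hyz r (memLp_eval _ _ _) hw]

theorem l2Proj_eval_smul {y z : ℝ} (hyz : y < z) (r : ℕ) (t : ℝ) (p : ℝ[X]) :
    l2Proj y z r (fun x => (t • p).eval x) = t • l2Proj y z r fun x => p.eval x := by
  refine IsL2Proj.eq_l2Proj hyz (memLp_eval _ _ _)
    ⟨Submodule.smul_mem _ _ (l2Proj_mem_P hyz r (memLp_eval _ _ _)), fun w hw => ?_⟩
  rw [integral_eval_mul_smul, integral_eval_mul_smul,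
    integral_l2Proj_mul hyz r (memLp_eval _ _ _) hw]

section Discrete

variable {a b : ℝ} {n : ℕ} (T : Mesh a b n) (k : ℕ)

/-- The nodal values of the weak function with discrete weak derivative `g`. -/
noncomputable def nodeValue (g : Fin n → ℝ[X]) : Fin (n + 1) → ℝ :=
  nodal fun i => ∫ x in T.lo i..T.hi i, (g i).eval x

/-- The weak function in `S_h` with discrete weak derivative `g`. -/
noncomputable def ofDeriv (g : Fin n → ℝ[X]) : WeakFun n where
  left i := nodeValue T g i.castSucc
  right i := nodeValue T g i.succ
  interior i := l2Proj (T.lo i) (T.hi i) k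
    fun x => (antiderivFrom (T.lo i) (nodeValue T g i.castSucc) (g i)).eval x

theorem memS_ofDeriv (g : Fin n → ℝ[X]) : MemS k (ofDeriv T k g) where
  interior_mem i := l2Proj_mem_P (T.lo_lt_hi i) k (memLp_eval _ _ _)
  left_zero i hi := by
    change nodeValue T g i.castSucc = 0
    have : i.castSucc = 0 := Fin.ext hi
    rw [this]
    exact nodal_zero _
  single_valued i j hij := by
    change nodeValue T g i.succ = nodeValue T g j.castSucc
    congr 1
    exact Fin.ext hij

/-- The interior value is the projection of a continuous primitive of `g`, so integration by parts
returns `g`: every piecewise polynomial of degree `k + 1` is a discrete weak derivative. -/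
theorem dw_ofDeriv {g : Fin n → ℝ[X]} {i : Fin n} (hg : g i ∈ P (k + 1)) :
    (ofDeriv T k g).dw T (k + 1) i = g i := by
  refine IsDiscreteWeakDeriv.eq (T.lo_lt_hi i) ⟨hg, fun q hq => ?_⟩
  have h := prim_antiderivFrom (T.lo i) (T.hi i) (T.lo i) (nodeValue T g i.castSucc) (g i)
  rw [h.integral_deriv_mul_eval (T.lo_lt_hi i).le]
  change _ = -(∫ x in T.lo i..T.hi i, (l2Proj _ _ _ _).eval x * _) +
    nodeValue T g i.succ * _ - nodeValue T g i.castSucc * _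
  rw [integral_l2Proj_mul (T.lo_lt_hi i) k (memLp_eval _ _ _) (derivative_mem_P hq),
    eval_antiderivFrom_self]
  congr 3
  rw [eval_antiderivFrom]
  exact (nodal_succ _ i).symm

theorem nodeValue_add (g g' : Fin n → ℝ[X]) (j : Fin (n + 1)) :
    nodeValue T (g + g') j = nodeValue T g j + nodeValue T g' j := by
  unfold nodeValue
  rw [← nodal_add]
  congr 1
  ext i
  rw [← intervalIntegral.integral_add ((g i).continuous.intervalIntegrable _ _)
    ((g' i).continuous.intervalIntegrable _ _)]
  simp only [Pi.add_apply, eval_add]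

theorem nodeValue_smul (t : ℝ) (g : Fin n → ℝ[X]) (j : Fin (n + 1)) :
    nodeValue T (t • g) j = t * nodeValue T g j := by
  unfold nodeValue
  rw [← nodal_mul]
  congr 1
  ext i
  rw [← intervalIntegral.integral_const_mul]
  simp only [Pi.smul_apply, eval_smul, smul_eq_mul]

theorem interior_ofDeriv_add (g g' : Fin n → ℝ[X]) :
    (ofDeriv T k (g + g')).interior = (ofDeriv T k g).interior + (ofDeriv T k g').interior := by
  ext1 i
  simp only [ofDeriv, Pi.add_apply]
  rw [nodeValue_add, antiderivFrom_add, l2Proj_eval_add (T.lo_lt_hi i)]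

theorem interior_ofDeriv_smul (t : ℝ) (g : Fin n → ℝ[X]) :
    (ofDeriv T k (t • g)).interior = t • (ofDeriv T k g).interior := by
  ext1 i
  simp only [ofDeriv, Pi.smul_apply]
  rw [nodeValue_smul, antiderivFrom_smul, l2Proj_eval_smul (T.lo_lt_hi i)]

/-! ### The space `S_h` parametrised by discrete weak derivatives, and summation by parts. -/

theorem isDiscreteWeakDeriv_dw (r : ℕ) (v : WeakFun n) (i : Fin n) :
    IsDiscreteWeakDeriv (T.lo i) (T.hi i) r (v.interior i) (v.left i) (v.right i) (v.dw T r i) :=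
  isDiscreteWeakDeriv_discreteWeakDeriv (T.lo_lt_hi i) r _ _ _

theorem dw_mem_P (r : ℕ) (v : WeakFun n) (i : Fin n) : v.dw T r i ∈ P r :=
  (isDiscreteWeakDeriv_dw T r v i).1

variable {k}

theorem MemS.exists_node_values {v : WeakFun n} (hv : MemS k v) : ∃ Y : Fin (n + 1) → ℝ,
    Y 0 = 0 ∧ (∀ i, v.left i = Y i.castSucc) ∧ ∀ i, v.right i = Y i.succ := by
  -- Every node but the first is the right end of exactly one element, so the right values define
  -- the nodal vector.
  refine ⟨Fin.cases 0 v.right, rfl, fun i => ?_, fun i => rfl⟩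
  rcases Nat.eq_zero_or_pos (i : ℕ) with h | h
  · have : i.castSucc = 0 := Fin.ext h
    rw [this, hv.left_zero i h]
    rfl
  · have hlt : (i : ℕ) - 1 < n := by omega
    have : i.castSucc = Fin.succ ⟨(i : ℕ) - 1, hlt⟩ := Fin.ext (by simp; omega)
    rw [this]
    exact (hv.single_valued ⟨(i : ℕ) - 1, hlt⟩ i (by simp; omega)).symm

theorem eq_nodal {Y : Fin (n + 1) → ℝ} {c : Fin n → ℝ} (h0 : Y 0 = 0)
    (h : ∀ i : Fin n, Y i.succ = Y i.castSucc + c i) (j : Fin (n + 1)) : Y j = nodal c j := by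
  induction j using Fin.induction with
  | zero => rw [h0, nodal_zero]
  | succ i ih => rw [h, nodal_succ, ih]

/-- The injective half of the parametrisation: starting from the value zero at `a`, the derivative
fixes the nodal values one after the other, and then the interior values. -/
theorem MemS.interior_eq {v : WeakFun n} (hv : MemS k v) :
    v.interior = (ofDeriv T k (v.dw T (k + 1))).interior := by
  obtain ⟨Y, h0, hl, hr⟩ := hv.exists_node_values
  ext1 i
  have hd := fun j => isDiscreteWeakDeriv_dw T (k + 1) v j
  have hY : ∀ j, Y j = nodeValue T (v.dw T (k + 1)) j := eq_nodal h0 fun j => by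
    have := (hd j).2 (C 1) (C_mem_P _ _)
    simp at this
    rw [← hl, ← hr, this]
    ring
  have := (hd i).interior_eq (T.lo_lt_hi i) (hv.interior_mem i)
  rw [this, hl, hY]
  rfl

/-- Summation by parts. -/
theorem MemS.sum_integral_dw_mul {v : WeakFun n} (hv : MemS k v) {τ : Fin n → ℝ[X]}
    (hτ : ∀ i, τ i ∈ P (k + 1)) {Z : Fin (n + 1) → ℝ} (hZ : Z (Fin.last n) = 0)
    (hl : ∀ i, (τ i).eval (T.lo i) = Z i.castSucc) (hr : ∀ i, (τ i).eval (T.hi i) = Z i.succ) :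
    ∑ i, ∫ x in T.lo i..T.hi i, (v.dw T (k + 1) i).eval x * (τ i).eval x =
      -∑ i, ∫ x in T.lo i..T.hi i, (v.interior i).eval x * (τ i).derivative.eval x := by
  obtain ⟨Y, h0, yl, yr⟩ := hv.exists_node_values
  -- The endpoint terms telescope to zero: `Y` vanishes at `a` and `Z` vanishes at `b`.
  have h := sum_succ_sub_castSucc fun j => Y j * Z j
  rw [h0, hZ, mul_zero, zero_mul, sub_zero] at h
  rw [← Finset.sum_neg_distrib, ← add_zero (∑ i, -_), ← h, ← Finset.sum_add_distrib]
  refine Finset.sum_congr rfl fun i _ => ?_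
  rw [(isDiscreteWeakDeriv_dw T (k + 1) v i).2 _ (hτ i), hl, hr, yl, yr]
  ring

/-- The continuous piecewise polynomial with nodal values `Z` whose derivative is the projection of
`Ψ`. -/
noncomputable def flux (k : ℕ) (Ψ : Fin n → ℝ → ℝ) (Z : Fin (n + 1) → ℝ) (i : Fin n) : ℝ[X] :=
  antiderivFrom (T.lo i) (Z i.castSucc) (l2Proj (T.lo i) (T.hi i) k (Ψ i))

theorem flux_mem_P {Ψ : Fin n → ℝ → ℝ} {i : Fin n} (hΨ : MemLp (Ψ i) 2 (vol (T.lo i) (T.hi i)))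
    (Z : Fin (n + 1) → ℝ) : flux T k Ψ Z i ∈ P (k + 1) :=
  antiderivFrom_mem_P _ _ (l2Proj_mem_P (T.lo_lt_hi i) k hΨ)

theorem eval_flux_lo (Ψ : Fin n → ℝ → ℝ) (Z : Fin (n + 1) → ℝ) (i : Fin n) :
    (flux T k Ψ Z i).eval (T.lo i) = Z i.castSucc := eval_antiderivFrom_self _ _ _

theorem eval_flux_hi {Ψ : Fin n → ℝ → ℝ} {i : Fin n}
    (hΨ : MemLp (Ψ i) 2 (vol (T.lo i) (T.hi i))) {Z : Fin (n + 1) → ℝ}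
    (hZ : Z i.succ = Z i.castSucc + ∫ x in T.lo i..T.hi i, Ψ i x) :
    (flux T k Ψ Z i).eval (T.hi i) = Z i.succ := by
  unfold flux
  rw [eval_antiderivFrom, integral_l2Proj (T.lo_lt_hi i) k hΨ, hZ]

/-- The derivative of the flux is the projection of `Ψ` onto `P_k`, and the projection is invisible
to `v⁰ ∈ P_k`. This serves both the exact flux `A V` and the flux of the dual problem. -/
theorem MemS.sum_integral_dw_mul_flux {v : WeakFun n} (hv : MemS k v) {Ψ : Fin n → ℝ → ℝ}
    (hΨ : ∀ i, MemLp (Ψ i) 2 (vol (T.lo i) (T.hi i))) {Z : Fin (n + 1) → ℝ}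
    (hlast : Z (Fin.last n) = 0)
    (hZ : ∀ i : Fin n, Z i.succ = Z i.castSucc + ∫ x in T.lo i..T.hi i, Ψ i x) :
    ∑ i, ∫ x in T.lo i..T.hi i, (v.dw T (k + 1) i).eval x * (flux T k Ψ Z i).eval x =
      -∑ i, ∫ x in T.lo i..T.hi i, Ψ i x * (v.interior i).eval x := by
  rw [hv.sum_integral_dw_mul T (fun i => flux_mem_P T (hΨ i) Z) hlast (eval_flux_lo T Ψ Z)
    fun i => eval_flux_hi T (hΨ i) (hZ i)]
  congr 1
  refine Finset.sum_congr rfl fun i _ => ?_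
  unfold flux
  rw [derivative_antiderivFrom, ← integral_l2Proj_mul (T.lo_lt_hi i) k (hΨ i) (hv.interior_mem i)]
  simp only [mul_comm]

/-- The maximum norm of a primitive with given initial value. -/
theorem abs_eval_antiderivFrom_le {y z v : ℝ} {q : ℝ[X]} {x : ℝ} (hx : x ∈ Icc y z) :
    |(antiderivFrom y v q).eval x| ≤ |v| + Real.sqrt (z - y) * nrm y z fun x => q.eval x := by
  have h := (prim_antiderivFrom y z y v q).abs_sub_le hx
  rw [eval_antiderivFrom_self] at h
  have := abs_add_le v ((antiderivFrom y v q).eval x - v)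
  rw [add_sub_cancel] at this
  linarith

/-- A primitive starting from zero at `a` is bounded by its derivative in `L²`. The bound passes to
the projection through `L²` contractivity and the inverse estimate, whose powers of the element
length cancel. -/
theorem abs_interior_ofDeriv_le {K : ℝ} (hK₀ : 0 ≤ K)
    (hK : ∀ y z : ℝ, y < z → ∀ q ∈ P k, ∀ x ∈ Icc y z,
      |q.eval x| * Real.sqrt (z - y) ≤ K * nrm y z fun t => q.eval t)
    (g : Fin n → ℝ[X]) (i : Fin n) {x : ℝ} (hx : x ∈ Icc (T.lo i) (T.hi i)) :
    |((ofDeriv T k g).interior i).eval x| ≤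
      2 * K * Real.sqrt (b - a) * T.snrm fun i x => (g i).eval x := by
  set G := T.snrm fun i x => (g i).eval x
  have hG : 0 ≤ G := T.snrm_nonneg _
  have hi := T.lo_lt_hi i
  have hs : 0 < Real.sqrt (T.hi i - T.lo i) := Real.sqrt_pos.mpr (T.length_pos i)
  have hW : ∀ t ∈ Icc (T.lo i) (T.hi i),
      |(antiderivFrom (T.lo i) (nodeValue T g i.castSucc) (g i)).eval t| ≤
        2 * Real.sqrt (b - a) * G := by
    intro t ht
    refine (abs_eval_antiderivFrom_le ht).trans ?_
    have h1 : |nodeValue T g i.castSucc| ≤ Real.sqrt (b - a) * G :=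
      (abs_nodal_le _ _).trans (T.sum_abs_integral_le fun _ => memLp_eval _ _ _)
    have h2 : Real.sqrt (T.hi i - T.lo i) * nrm (T.lo i) (T.hi i) (fun x => (g i).eval x) ≤
        Real.sqrt (b - a) * G := by
      have h3 := T.nrm_le_snrm (fun i x => (g i).eval x) i
      have h4 := T.length_le i
      have h5 := nrm_nonneg (T.lo i) (T.hi i) (fun x => (g i).eval x)
      gcongr
    linarith
  have h1 := hK _ _ hi _ ((memS_ofDeriv T k g).interior_mem i) x hx
  have h2 : nrm (T.lo i) (T.hi i) (fun t => ((ofDeriv T k g).interior i).eval t) ≤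
      2 * Real.sqrt (b - a) * G * Real.sqrt (T.hi i - T.lo i) := by
    refine (nrm_l2Proj_le hi k (memLp_eval _ _ _)).trans ?_
    have := nrm_le_mul hi.le (M := 2 * Real.sqrt (b - a) * G) (by positivity)
      (memLp_eval (T.lo i) (T.hi i) (antiderivFrom (T.lo i) (nodeValue T g i.castSucc) (g i)))
      (memLp_const_vol _ _ 1) (by
        filter_upwards [ae_restrict_mem measurableSet_Ioo] with t ht
        simpa using hW t (Ioo_subset_Icc_self ht))
    rwa [nrm_const hi.le, abs_one, one_mul] at this
  have h3 := h1.trans (mul_le_mul_of_nonneg_left h2 hK₀)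
  refine le_of_mul_le_mul_right (h3.trans (le_of_eq ?_)) hs
  ring

end Discrete

/-! ### The discrete dual problem -/

section Dual

variable {a b : ℝ} {n : ℕ} (T : Mesh a b n)

/-- The weighted `L²` product of piecewise polynomials. -/
noncomputable def wip (w : ℝ → ℝ) (p q : Fin n → ℝ[X]) : ℝ :=
  ∑ i, ∫ x in T.lo i..T.hi i, w x * (p i).eval x * (q i).eval x

theorem memLp_weight_mul {w : ℝ → ℝ} (hw : ContinuousOn w (Icc a b)) (p : ℝ[X]) (i : Fin n) :
    MemLp (fun x => w x * p.eval x) 2 (vol (T.lo i) (T.hi i)) :=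
  memLp_mul_of_continuousOn (memLp_eval _ _ _) (hw.mono (T.Icc_subset i))

theorem intervalIntegrable_weight_mul {w : ℝ → ℝ} (hw : ContinuousOn w (Icc a b)) (p q : ℝ[X])
    (i : Fin n) :
    IntervalIntegrable (fun x => w x * p.eval x * q.eval x) volume (T.lo i) (T.hi i) :=
  memLp_intervalIntegrable_mul (memLp_weight_mul T hw p i) (memLp_eval _ _ _) (T.lo_lt_hi i).le

theorem wip_comm (w : ℝ → ℝ) (p q : Fin n → ℝ[X]) : wip T w p q = wip T w q p := by
  unfold wip
  simp only [mul_right_comm]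

theorem wip_add_left {w : ℝ → ℝ} (hw : ContinuousOn w (Icc a b)) (p p' q : Fin n → ℝ[X]) :
    wip T w (p + p') q = wip T w p q + wip T w p' q := by
  unfold wip
  rw [← Finset.sum_add_distrib]
  refine Finset.sum_congr rfl fun i _ => ?_
  rw [← intervalIntegral.integral_add (intervalIntegrable_weight_mul T hw _ _ i)
    (intervalIntegrable_weight_mul T hw _ _ i)]
  simp only [Pi.add_apply, eval_add, mul_add, add_mul]

theorem wip_smul_left (w : ℝ → ℝ) (t : ℝ) (p q : Fin n → ℝ[X]) :
    wip T w (t • p) q = t * wip T w p q := by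
  unfold wip
  rw [Finset.mul_sum]
  refine Finset.sum_congr rfl fun i _ => ?_
  rw [← intervalIntegral.integral_const_mul]
  simp only [Pi.smul_apply, eval_smul, smul_eq_mul, mul_left_comm, mul_assoc]

theorem wip_add_right {w : ℝ → ℝ} (hw : ContinuousOn w (Icc a b)) (p q q' : Fin n → ℝ[X]) :
    wip T w p (q + q') = wip T w p q + wip T w p q' := by
  rw [wip_comm, wip_add_left T hw, wip_comm, wip_comm T w q']

theorem wip_smul_right (w : ℝ → ℝ) (t : ℝ) (p q : Fin n → ℝ[X]) :
    wip T w p (t • q) = t * wip T w p q := by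
  rw [wip_comm, wip_smul_left, wip_comm]

theorem wip_sub_left {w : ℝ → ℝ} (hw : ContinuousOn w (Icc a b)) (p p' q : Fin n → ℝ[X]) :
    wip T w (p - p') q = wip T w p q - wip T w p' q := by
  rw [sub_eq_add_neg, ← neg_one_smul ℝ p', wip_add_left T hw, wip_smul_left]
  ring

theorem wip_one_self (p : Fin n → ℝ[X]) :
    wip T (fun _ => 1) p p = T.snrm (fun i x => (p i).eval x) ^ 2 := by
  rw [T.snrm_sq']
  unfold wip
  simp only [one_mul, sq]

theorem wip_one_le (p q : Fin n → ℝ[X]) : wip T (fun _ => 1) p q ≤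
    T.snrm (fun i x => (p i).eval x) * T.snrm fun i x => (q i).eval x := by
  refine le_trans (Finset.sum_le_sum fun i _ => ?_) (Real.sum_mul_le_sqrt_mul_sqrt _ _ _)
  simp only [one_mul]
  exact (le_abs_self _).trans
    (abs_integral_mul_le (T.lo_lt_hi i).le (memLp_eval _ _ _) (memLp_eval _ _ _))

theorem integral_weight_sq_ge {w : ℝ → ℝ} (hw : ContinuousOn w (Icc a b)) {m : ℝ}
    (hm : ∀ x ∈ Icc a b, m ≤ w x) (p : ℝ[X]) (i : Fin n) :
    m * nrm (T.lo i) (T.hi i) (fun x => p.eval x) ^ 2 ≤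
      ∫ x in T.lo i..T.hi i, w x * p.eval x * p.eval x := by
  rw [nrm_sq (T.lo_lt_hi i).le, ← intervalIntegral.integral_const_mul]
  refine intervalIntegral.integral_mono_on (T.lo_lt_hi i).le
    ((memLp_intervalIntegrable_sq (memLp_eval _ _ _) (T.lo_lt_hi i).le).const_mul _)
    (intervalIntegrable_weight_mul T hw _ _ i) fun x hx => ?_
  rw [mul_assoc, ← sq]
  exact mul_le_mul_of_nonneg_right (hm x (T.Icc_subset i hx)) (sq_nonneg _)

theorem wip_self_ge {w : ℝ → ℝ} (hw : ContinuousOn w (Icc a b)) {m : ℝ}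
    (hm : ∀ x ∈ Icc a b, m ≤ w x) (p : Fin n → ℝ[X]) :
    m * T.snrm (fun i x => (p i).eval x) ^ 2 ≤ wip T w p p := by
  rw [T.snrm_sq, Finset.mul_sum]
  exact Finset.sum_le_sum fun i _ => integral_weight_sq_ge T hw hm (p i) i

/-- With the derivative as unknown, the bilinear form is positive definite already through its first
term, so it is injective, hence surjective, onto the dual of a finite-dimensional space. -/
theorem exists_dual (k : ℕ) {A E : ℝ → ℝ} (hA : ContinuousOn A (Icc a b))
    (hE : ContinuousOn E (Icc a b)) {m : ℝ} (hm : 0 < m) (hAm : ∀ x ∈ Icc a b, m ≤ A x)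
    (hE₀ : ∀ x ∈ Icc a b, 0 ≤ E x) (φ : Fin n → ℝ[X]) :
    ∃ ζ : Fin n → ℝ[X], (∀ i, ζ i ∈ P (k + 1)) ∧ ∀ g : Fin n → ℝ[X], (∀ i, g i ∈ P (k + 1)) →
      wip T A g ζ + wip T E (ofDeriv T k g).interior (ofDeriv T k ζ).interior =
        wip T (fun _ => 1) φ (ofDeriv T k g).interior := by
  let ι : (Fin n → P (k + 1)) → Fin n → ℝ[X] := fun g i => g i
  let J : (Fin n → P (k + 1)) → Fin n → ℝ[X] := fun g => (ofDeriv T k (ι g)).interior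
  have hι : ∀ g g', ι (g + g') = ι g + ι g' := fun _ _ => rfl
  have hι' : ∀ (t : ℝ) g, ι (t • g) = t • ι g := fun _ _ => rfl
  have hJ : ∀ g g', J (g + g') = J g + J g' := fun g g' => by
    simp only [J, hι, interior_ofDeriv_add]
  have hJ' : ∀ (t : ℝ) g, J (t • g) = t • J g := fun t g => by
    simp only [J, hι', interior_ofDeriv_smul]
  have h1 : ContinuousOn (fun _ : ℝ => (1 : ℝ)) (Icc a b) := continuousOn_const
  let B : (Fin n → P (k + 1)) →ₗ[ℝ] Module.Dual ℝ (Fin n → P (k + 1)) := LinearMap.mk₂ ℝ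
    (fun g ζ => wip T A (ι g) (ι ζ) + wip T E (J g) (J ζ))
    (by
      intro g g' ζ
      rw [hι, hJ, wip_add_left T hA, wip_add_left T hE]
      ring)
    (by
      intro t g ζ
      rw [hι', hJ', wip_smul_left, wip_smul_left, smul_eq_mul]
      ring)
    (by
      intro g ζ ζ'
      rw [hι, hJ, wip_add_right T hA, wip_add_right T hE]
      ring)
    (by
      intro t g ζ
      rw [hι', hJ', wip_smul_right, wip_smul_right, smul_eq_mul]
      ring)
  have hBinj : Function.Injective B := by
    rw [← LinearMap.ker_eq_bot, LinearMap.ker_eq_bot']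
    intro g hg
    have h := LinearMap.congr_fun hg g
    change wip T A (ι g) (ι g) + wip T E (J g) (J g) = 0 at h
    have hEp := wip_self_ge T hE hE₀ (J g)
    have hAp := wip_self_ge T hA hAm (ι g)
    have hs : T.snrm (fun i x => (ι g i).eval x) = 0 := by
      have := T.snrm_nonneg fun i x => (ι g i).eval x
      by_contra hne
      have hpos : 0 < T.snrm (fun i x => (ι g i).eval x) ^ 2 := by positivity
      nlinarith
    funext i
    have hi : nrm (T.lo i) (T.hi i) (fun x => (ι g i).eval x) = 0 :=
      le_antisymm (hs ▸ T.nrm_le_snrm (fun i x => (ι g i).eval x) i) (nrm_nonneg _ _ _)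
    have hu := (existsUnique_representative (T.lo_lt_hi i) (k + 1) 0).unique
      (y₁ := ι g i) (y₂ := 0) ⟨(g i).2, fun q _ => ?_⟩ ⟨zero_mem _, fun q _ => by simp⟩
    · exact Subtype.ext hu
    · have := abs_integral_mul_le (T.lo_lt_hi i).le (memLp_eval _ _ (ι g i)) (memLp_eval _ _ q)
      rw [hi, zero_mul] at this
      exact abs_nonpos_iff.mp this
  have : FiniteDimensional ℝ (P (k + 1)) :=
    Module.Finite.equiv (Polynomial.degreeLTEquiv ℝ (k + 1 + 1)).symm
  have hBsurj : Function.Surjective B :=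
    (LinearMap.injective_iff_surjective_of_finrank_eq_finrank
      (Subspace.dual_finrank_eq (K := ℝ) (V := Fin n → P (k + 1))).symm).mp hBinj
  let L : Module.Dual ℝ (Fin n → P (k + 1)) :=
    { toFun := fun g => wip T (fun _ => 1) φ (J g)
      map_add' := fun g g' => by rw [hJ, wip_add_right T h1]
      map_smul' := fun t g => by rw [hJ', wip_smul_right]; rfl }
  obtain ⟨ζ, hζ⟩ := hBsurj L
  refine ⟨ι ζ, fun i => (ζ i).2, fun g hg => ?_⟩
  have h := LinearMap.congr_fun hζ fun i => ⟨g i, hg i⟩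
  change wip T A (ι ζ) g + wip T E (J ζ) (ofDeriv T k g).interior =
    wip T (fun _ => 1) φ (ofDeriv T k g).interior at h
  rw [← h, wip_comm T A, wip_comm T E]

/-- Energy estimate: `m ‖ζ‖² ≤ (φ, z) ≤ ‖φ‖ ‖z‖`, where the weak function `z` of derivative `ζ`
satisfies a discrete Poincaré inequality. -/
theorem snrm_dual_le {k : ℕ} {A E : ℝ → ℝ} (hA : ContinuousOn A (Icc a b))
    (hE : ContinuousOn E (Icc a b)) {m : ℝ} (hm : 0 < m) (hAm : ∀ x ∈ Icc a b, m ≤ A x)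
    (hE₀ : ∀ x ∈ Icc a b, 0 ≤ E x) {φ ζ : Fin n → ℝ[X]}
    (h : wip T A ζ ζ + wip T E (ofDeriv T k ζ).interior (ofDeriv T k ζ).interior =
        wip T (fun _ => 1) φ (ofDeriv T k ζ).interior) {K : ℝ} (hK₀ : 0 ≤ K)
    (hK : ∀ y z : ℝ, y < z → ∀ q ∈ P k, ∀ x ∈ Icc y z,
      |q.eval x| * Real.sqrt (z - y) ≤ K * nrm y z fun t => q.eval t) :
    T.snrm (fun i x => (ζ i).eval x) ≤
      2 * K * (Real.sqrt (b - a)) ^ 2 / m * T.snrm fun i x => (φ i).eval x := by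
  set G := T.snrm fun i x => (ζ i).eval x
  set ε := T.snrm fun i x => (φ i).eval x
  have hG : 0 ≤ G := T.snrm_nonneg _
  have hε : 0 ≤ ε := T.snrm_nonneg _
  have h1 : m * G ^ 2 ≤ wip T A ζ ζ := wip_self_ge T hA hAm ζ
  have h2 := wip_self_ge T hE hE₀ (ofDeriv T k ζ).interior
  have h3 := wip_one_le T φ (ofDeriv T k ζ).interior
  have h4 : T.snrm (fun i x => ((ofDeriv T k ζ).interior i).eval x) ≤
      2 * K * Real.sqrt (b - a) * G * Real.sqrt (b - a) :=
    T.snrm_le_of_bound (by positivity) (fun i => memLp_eval _ _ _)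
      fun i x hx => abs_interior_ofDeriv_le T hK₀ hK ζ i hx
  have h5 : m * G ^ 2 ≤ ε * (2 * K * Real.sqrt (b - a) * G * Real.sqrt (b - a)) := by
    have := mul_le_mul_of_nonneg_left h4 hε
    linarith
  rw [div_mul_eq_mul_div, le_div_iff₀ hm]
  rcases hG.eq_or_lt with h0 | h0
  · rw [← h0, zero_mul]
    positivity
  · refine le_of_mul_le_mul_right ?_ h0
    calc G * m * G = m * G ^ 2 := by ring
      _ ≤ _ := h5
      _ = _ := by ring

theorem Mesh.sqrt_sum_sq_le (hab : a ≤ b) {m B N : ℝ} (hm : 0 ≤ m) (hB : 0 ≤ B) {f : ℝ → ℝ}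
    (hf : MemLp f 2 (vol a b)) {Ψ : Fin n → ℝ → ℝ} (hΨ : T.snrm Ψ ≤ N) :
    √(∑ i, (m * (nrm (T.lo i) (T.hi i) f * B + nrm (T.lo i) (T.hi i) (Ψ i))) ^ 2) ≤
      m * (nrm a b f * B + N) := by
  have hα₀ := nrm_nonneg a b f
  have hN : 0 ≤ N := (T.snrm_nonneg _).trans hΨ
  refine Real.sqrt_le_iff.mpr ⟨by positivity, ?_⟩
  simp only [mul_pow m]
  rw [← Finset.mul_sum]
  refine mul_le_mul_of_nonneg_left ?_ (sq_nonneg _)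
  have hα' : ∑ i, nrm (T.lo i) (T.hi i) f ^ 2 = nrm a b f ^ 2 := by
    rw [← T.snrm_const hab hf, T.snrm_sq]
  have hΨ2 : ∑ i, nrm (T.lo i) (T.hi i) (Ψ i) ^ 2 ≤ N ^ 2 := by
    rw [← T.snrm_sq]
    exact pow_le_pow_left₀ (T.snrm_nonneg _) hΨ 2
  have hcs : ∑ i, nrm (T.lo i) (T.hi i) f * nrm (T.lo i) (T.hi i) (Ψ i) ≤ nrm a b f * N := by
    refine (Real.sum_mul_le_sqrt_mul_sqrt _ _ _).trans ?_
    rw [hα', Real.sqrt_sq hα₀]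
    exact mul_le_mul_of_nonneg_left hΨ hα₀
  have e : ∀ i, (nrm (T.lo i) (T.hi i) f * B + nrm (T.lo i) (T.hi i) (Ψ i)) ^ 2 =
      B ^ 2 * nrm (T.lo i) (T.hi i) f ^ 2 +
      2 * B * (nrm (T.lo i) (T.hi i) f * nrm (T.lo i) (T.hi i) (Ψ i)) +
      nrm (T.lo i) (T.hi i) (Ψ i) ^ 2 := fun i => by ring
  simp only [e]
  rw [Finset.sum_add_distrib, Finset.sum_add_distrib, ← Finset.mul_sum, ← Finset.mul_sum, hα']
  have := mul_le_mul_of_nonneg_left hcs (by positivity : 0 ≤ 2 * B)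
  nlinarith

/-- If `A ζ + τ` is orthogonal to `P_r` and `τ` is nearly constant, then `ζ` is nearly constant. -/
theorem nrm_sub_const_le_of_orthogonal {y z : ℝ} (hyz : y < z) {A A₁ : ℝ → ℝ}
    (hA : Prim y z A A₁) {m : ℝ} (hm : 0 < m) (hAm : ∀ x ∈ Icc y z, m ≤ A x) {r : ℕ} {ζ τ : ℝ[X]}
    (hζ : ζ ∈ P r) (hτ : τ ∈ P r)
    (horth : ∀ q ∈ P r, ∫ x in y..z, A x * q.eval x * ζ.eval x =
      -∫ x in y..z, q.eval x * τ.eval x) {B N v : ℝ} (hB : 0 ≤ B)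
    (hζB : ∀ x ∈ Icc y z, |ζ.eval x| ≤ B)
    (hτN : nrm y z (fun x => τ.eval x - v) ≤ (z - y) * N) :
    nrm y z (fun x => ζ.eval x - -(A y)⁻¹ * v) ≤ (z - y) * (m⁻¹ * (nrm y z A₁ * B + N)) := by
  have hi := hyz.le
  have hyy : y ∈ Icc y z := ⟨le_rfl, hi⟩
  have hA0 : 0 < A y := hm.trans_le (hAm _ hyy)
  -- Freezing `A` at `y` turns the orthogonal function `A ζ + τ` into a polynomial, which is
  -- admissible as a test function.
  set χ : ℝ[X] := C (A y) * ζ + τ with hχ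
  have hχP : χ ∈ P r := by
    rw [hχ, ← smul_eq_C_mul]
    exact add_mem (Submodule.smul_mem _ _ hζ) hτ
  have m1 : MemLp (fun x => A x - A y) 2 (vol y z) := hA.memLp_self.sub (memLp_const_vol _ _ _)
  have m2 : MemLp (fun x => ζ.eval x * (A x - A y)) 2 (vol y z) :=
    memLp_mul_of_continuousOn m1 ζ.continuous.continuousOn
  have m3 : MemLp (fun x => A x * χ.eval x) 2 (vol y z) :=
    memLp_mul_of_continuousOn (memLp_eval _ _ χ) hA.continuousOn
  have n2 : nrm y z (fun x => ζ.eval x * (A x - A y)) ≤ B * ((z - y) * nrm y z A₁) := by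
    refine (nrm_le_mul hi hB m2 m1 ?_).trans (mul_le_mul_of_nonneg_left (hA.nrm_sub_le hi) hB)
    filter_upwards [ae_restrict_mem measurableSet_Ioo] with x hx
    rw [abs_mul]
    exact mul_le_mul_of_nonneg_right (hζB x (Ioo_subset_Icc_self hx)) (abs_nonneg _)
  have nχ : nrm y z (fun x => χ.eval x) ≤ B * ((z - y) * nrm y z A₁) := by
    refine le_trans ?_ n2
    -- Since `A ζ + τ` is orthogonal to `χ`, only the variation of `A` survives in `∫ χ²`.
    have e1 : nrm y z (fun x => χ.eval x) ^ 2 =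
        -∫ x in y..z, (ζ.eval x * (A x - A y)) * χ.eval x := by
      rw [nrm_sq hi]
      have e3 : ∀ x, χ.eval x ^ 2 = A x * χ.eval x * ζ.eval x + χ.eval x * τ.eval x -
          (ζ.eval x * (A x - A y)) * χ.eval x := fun x => by
        have : χ.eval x = A y * ζ.eval x + τ.eval x := by simp [hχ]
        rw [this]
        ring
      have i1 := memLp_intervalIntegrable_mul m3 (memLp_eval _ _ ζ) hi
      have i2 := intervalIntegrable_eval_mul y z χ τ
      have i3 := memLp_intervalIntegrable_mul m2 (memLp_eval _ _ χ) hi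
      simp only [e3]
      rw [intervalIntegral.integral_sub (i1.add i2) i3, intervalIntegral.integral_add i1 i2,
        horth χ hχP]
      ring
    have e4 := (neg_le_abs _).trans (abs_integral_mul_le hi m2 (memLp_eval _ _ χ))
    rw [← e1] at e4
    have h0 := nrm_nonneg y z fun x => χ.eval x
    have h0' := nrm_nonneg y z fun x => ζ.eval x * (A x - A y)
    by_contra! hlt
    nlinarith
  have nτ : nrm y z (fun x => -1 * (τ.eval x - v)) ≤ (z - y) * N := by
    rwa [nrm_const_mul, abs_neg, abs_one, one_mul]
  have e5 : (fun x => ζ.eval x - -(A y)⁻¹ * v) = fun x =>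
      (A y)⁻¹ * (χ.eval x + -1 * (τ.eval x - v)) := by
    ext x
    simp only [hχ, eval_add, eval_mul, eval_C]
    field_simp
    ring
  rw [e5, nrm_const_mul, abs_of_pos (inv_pos.mpr hA0)]
  have hm' : (A y)⁻¹ ≤ m⁻¹ := inv_anti₀ hm (hAm _ hyy)
  have n6 := (nrm_add_le hi (memLp_eval _ _ χ)
    (((memLp_eval _ _ τ).sub (memLp_const_vol _ _ v)).const_mul (-1))).trans (add_le_add nχ nτ)
  calc _ ≤ m⁻¹ * (B * ((z - y) * nrm y z A₁) + (z - y) * N) :=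
        mul_le_mul hm' n6 (nrm_nonneg _ _ _) (by positivity)
    _ = _ := by ring

/-- The discrete dual solution and the bounds that make the duality argument work. -/
theorem exists_dual_bounds (hab : a ≤ b) (k : ℕ) {A A₁ E : ℝ → ℝ} (hA : Prim a b A A₁)
    (hE : ContinuousOn E (Icc a b)) {m : ℝ} (hm : 0 < m) (hAm : ∀ x ∈ Icc a b, m ≤ A x)
    (hE₀ : ∀ x ∈ Icc a b, 0 ≤ E x) :
    ∃ C : ℝ, 0 ≤ C ∧ ∀ (n : ℕ) (T : Mesh a b n) (φ : Fin n → ℝ[X]),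
      ∃ ζ : Fin n → ℝ[X], (∀ i, ζ i ∈ P (k + 1)) ∧
      (∀ g : Fin n → ℝ[X], (∀ i, g i ∈ P (k + 1)) →
        wip T A g ζ + wip T E (ofDeriv T k g).interior (ofDeriv T k ζ).interior =
          wip T (fun _ => 1) φ (ofDeriv T k g).interior) ∧
      (∀ i, ∀ x ∈ Icc (T.lo i) (T.hi i),
        |(ζ i).eval x| ≤ C * T.snrm fun i x => (φ i).eval x) ∧
      (∀ i, ∀ x ∈ Icc (T.lo i) (T.hi i),
        |((ofDeriv T k ζ).interior i).eval x| ≤ C * T.snrm fun i x => (φ i).eval x) ∧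
      ∃ c R : Fin n → ℝ, √(∑ i, R i ^ 2) ≤ C * (T.snrm fun i x => (φ i).eval x) ∧
        ∀ i, nrm (T.lo i) (T.hi i) (fun x => (ζ i).eval x - c i) ≤ (T.hi i - T.lo i) * R i := by
  obtain ⟨K, hK₀, hK⟩ := exists_inverse_estimate k
  obtain ⟨K', hK'₀, hK'⟩ := exists_inverse_estimate (k + 1)
  obtain ⟨β, hβ⟩ := isCompact_Icc.exists_bound_of_continuousOn hE
  have hβ₀ : 0 ≤ β := (norm_nonneg _).trans (hβ a ⟨le_rfl, hab⟩)
  set L := Real.sqrt (b - a)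
  have hL : 0 ≤ L := Real.sqrt_nonneg _
  -- Relative to `‖φ‖`, `cz` bounds the weak function `z` pointwise, `cΨ` bounds `φ - E z` in `L²`,
  -- `cζ` bounds `ζ` pointwise, and `cR` bounds its deviation from constants.
  set cz := 2 * K * L * (2 * K * L ^ 2 / m) with hcz
  have hcz₀ : 0 ≤ cz := by positivity
  set cΨ := 1 + β * cz * L with hcΨ
  have hcΨ₀ : 0 ≤ cΨ := by positivity
  set cζ := K' * (3 * L * cΨ / m) with hcζ
  have hcζ₀ : 0 ≤ cζ := by positivity
  set α := nrm a b A₁ with hα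
  have hα₀ : 0 ≤ α := nrm_nonneg _ _ _
  set cR := m⁻¹ * (α * cζ + cΨ) with hcR
  have hcR₀ : 0 ≤ cR := by positivity
  refine ⟨cζ + cz + cR, by positivity, fun n T φ => ?_⟩
  set ε := T.snrm fun i x => (φ i).eval x
  have hε : 0 ≤ ε := T.snrm_nonneg _
  have hAc := hA.continuousOn
  obtain ⟨ζ, hζP, hζ⟩ := exists_dual T k hAc hE hm hAm hE₀ φ
  have hG := snrm_dual_le T hAc hE hm hAm hE₀ (hζ ζ hζP) hK₀ hK
  set z := (ofDeriv T k ζ).interior with hz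
  have hzb : ∀ i, ∀ x ∈ Icc (T.lo i) (T.hi i), |(z i).eval x| ≤ cz * ε := by
    intro i x hx
    refine (abs_interior_ofDeriv_le T hK₀ hK ζ i hx).trans ?_
    calc _ ≤ 2 * K * L * (2 * K * L ^ 2 / m * ε) := by gcongr
      _ = _ := by
        rw [hcz]
        ring
  set Ψ : Fin n → ℝ → ℝ := fun i x => (φ i).eval x + (-1 * E x) * (z i).eval x with hΨdef
  have hE' : ContinuousOn (fun x => -1 * E x) (Icc a b) := continuousOn_const.mul hE
  have hΨm : ∀ i, MemLp (Ψ i) 2 (vol (T.lo i) (T.hi i)) := fun i =>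
    (memLp_eval _ _ _).add (memLp_weight_mul T hE' (z i) i)
  have hΨn : T.snrm Ψ ≤ cΨ * ε := by
    refine (T.snrm_add_le (fun i => memLp_eval _ _ _)
      (fun i => memLp_weight_mul T hE' (z i) i)).trans ?_
    have := T.snrm_le_of_bound (f := fun i x => (-1 * E x) * (z i).eval x) (M := β * (cz * ε))
      (by positivity) (fun i => memLp_weight_mul T hE' (z i) i) (fun i x hx => by
        rw [abs_mul, abs_mul, abs_neg, abs_one, one_mul]
        exact mul_le_mul (hβ x (T.Icc_subset i hx)) (hzb i x hx) (abs_nonneg _) hβ₀)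
    calc _ ≤ ε + β * (cz * ε) * L := add_le_add le_rfl this
      _ = _ := by
        rw [hcΨ]
        ring
  set c : Fin n → ℝ := fun i => ∫ x in T.lo i..T.hi i, Ψ i x with hc
  -- The flux of the dual problem is normalised to vanish at `b`, as summation by parts requires.
  set Z : Fin (n + 1) → ℝ := fun j => nodal c j - nodal c (Fin.last n) with hZ
  have hZl : Z (Fin.last n) = 0 := sub_self _
  have hZs : ∀ i : Fin n, Z i.succ = Z i.castSucc + ∫ x in T.lo i..T.hi i, Ψ i x := fun i => by
    simp only [hZ, nodal_succ]
    ring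
  have hcsum : ∑ i, |c i| ≤ L * (cΨ * ε) :=
    (T.sum_abs_integral_le hΨm).trans (mul_le_mul_of_nonneg_left hΨn hL)
  have hZb : ∀ j, |Z j| ≤ 2 * L * (cΨ * ε) := fun j => by
    have := abs_sub (nodal c j) (nodal c (Fin.last n))
    have h1 := abs_nodal_le c j
    have h2 := abs_nodal_le c (Fin.last n)
    linarith
  set τ := flux T k Ψ Z with hτ
  have hτP : ∀ i, τ i ∈ P (k + 1) := fun i => flux_mem_P T (hΨm i) Z
  have hτb : ∀ i, ∀ x ∈ Icc (T.lo i) (T.hi i), |(τ i).eval x| ≤ 3 * L * (cΨ * ε) := by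
    intro i x hx
    refine (abs_eval_antiderivFrom_le hx).trans ?_
    have h1 := hZb i.castSucc
    have h2 : Real.sqrt (T.hi i - T.lo i) * nrm (T.lo i) (T.hi i)
        (fun x => (l2Proj (T.lo i) (T.hi i) k (Ψ i)).eval x) ≤ L * (cΨ * ε) := by
      have h3 := (nrm_l2Proj_le (T.lo_lt_hi i) k (hΨm i)).trans ((T.nrm_le_snrm Ψ i).trans hΨn)
      have h4 := T.length_le i
      exact mul_le_mul (Real.sqrt_le_sqrt h4) h3 (nrm_nonneg _ _ _) hL
    linarith
  -- The dual equation is tested with a derivative supported on one element. The corresponding weak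
  -- function is not local, but the flux identity replaces its pairing with `φ - E z` by the local
  -- integral of `q τ`.
  have horth : ∀ i, ∀ q ∈ P (k + 1), ∫ x in T.lo i..T.hi i, A x * q.eval x * (ζ i).eval x =
      -∫ x in T.lo i..T.hi i, q.eval x * (τ i).eval x := by
    intro i q hq
    classical
    set g : Fin n → ℝ[X] := Pi.single i q with hg
    have hgP : ∀ j, g j ∈ P (k + 1) := fun j => by
      rcases eq_or_ne j i with rfl | hj
      · rwa [hg, Pi.single_eq_same]
      · rw [hg, Pi.single_eq_of_ne hj]
        exact zero_mem _
    have e1 := hζ g hgP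
    have e2 := (memS_ofDeriv T k g).sum_integral_dw_mul_flux T hΨm hZl hZs
    have e3 : wip T A g ζ = ∫ x in T.lo i..T.hi i, A x * q.eval x * (ζ i).eval x := by
      unfold wip
      rw [Finset.sum_eq_single i]
      · rw [hg, Pi.single_eq_same]
      · intro j _ hj
        rw [hg, Pi.single_eq_of_ne hj]
        simp
      · simp
    have e4 : ∑ j, ∫ x in T.lo j..T.hi j,
        ((ofDeriv T k g).dw T (k + 1) j).eval x * (flux T k Ψ Z j).eval x =
        ∫ x in T.lo i..T.hi i, q.eval x * (τ i).eval x := by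
      rw [Finset.sum_eq_single i]
      · rw [dw_ofDeriv T k (hgP i), hg, Pi.single_eq_same]
      · intro j _ hj
        rw [dw_ofDeriv T k (hgP j), hg, Pi.single_eq_of_ne hj]
        simp
      · simp
    have e5 : ∑ j, ∫ x in T.lo j..T.hi j, Ψ j x * ((ofDeriv T k g).interior j).eval x =
        wip T (fun _ => 1) φ (ofDeriv T k g).interior - wip T E (ofDeriv T k g).interior z := by
      unfold wip
      rw [← Finset.sum_sub_distrib]
      refine Finset.sum_congr rfl fun j _ => ?_
      rw [← intervalIntegral.integral_sub
        (intervalIntegrable_weight_mul T continuousOn_const _ _ j)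
        (intervalIntegrable_weight_mul T hE _ _ j)]
      refine intervalIntegral.integral_congr fun x _ => ?_
      simp only [hΨdef]
      ring
    rw [e4, e5] at e2
    rw [← e3]
    linarith
  -- With `q = ζ`, orthogonality bounds `m ‖ζ‖` by `‖τ‖` on the element, which is at most `√(h_i)`
  -- times the maximum of `|τ|`; the inverse estimate removes the root.
  have hζb : ∀ i, ∀ x ∈ Icc (T.lo i) (T.hi i), |(ζ i).eval x| ≤ cζ * ε := by
    intro i x hx
    have hs : 0 < Real.sqrt (T.hi i - T.lo i) := Real.sqrt_pos.mpr (T.length_pos i)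
    have h1 := integral_weight_sq_ge T hAc hAm (ζ i) i
    rw [horth i _ (hζP i)] at h1
    have h2 := (neg_le_abs _).trans (abs_integral_mul_le (T.lo_lt_hi i).le
      (memLp_eval (T.lo i) (T.hi i) (ζ i)) (memLp_eval (T.lo i) (T.hi i) (τ i)))
    have h3 := nrm_le_mul (T.lo_lt_hi i).le (M := 3 * L * (cΨ * ε)) (by positivity)
      (memLp_eval (T.lo i) (T.hi i) (τ i)) (memLp_const_vol _ _ 1) (by
        filter_upwards [ae_restrict_mem measurableSet_Ioo] with t ht
        simpa using hτb i t (Ioo_subset_Icc_self ht))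
    rw [nrm_const (T.lo_lt_hi i).le, abs_one, one_mul] at h3
    have hn := nrm_nonneg (T.lo i) (T.hi i) fun x => (ζ i).eval x
    set N := nrm (T.lo i) (T.hi i) fun x => (ζ i).eval x with hN
    have h4 : m * N ≤ 3 * L * (cΨ * ε) * Real.sqrt (T.hi i - T.lo i) := by
      rcases hn.eq_or_lt with h0 | h0
      · rw [← h0, mul_zero]
        positivity
      · refine le_of_mul_le_mul_right ?_ h0
        have := mul_le_mul_of_nonneg_left h3 hn
        nlinarith
    have h5 : N ≤ 3 * L * cΨ / m * ε * Real.sqrt (T.hi i - T.lo i) := by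
      rw [div_mul_eq_mul_div, div_mul_eq_mul_div, le_div_iff₀ hm]
      linarith
    have h6 := (hK' _ _ (T.lo_lt_hi i) _ (hζP i) x hx).trans (mul_le_mul_of_nonneg_left h5 hK'₀)
    refine le_of_mul_le_mul_right (h6.trans (le_of_eq ?_)) hs
    rw [hcζ]
    ring
  refine ⟨ζ, hζP, hζ, fun i x hx => (hζb i x hx).trans ?_, fun i x hx => (hzb i x hx).trans ?_,
    fun i => -(A (T.lo i))⁻¹ * Z i.castSucc,
    fun i => m⁻¹ * (nrm (T.lo i) (T.hi i) A₁ * (cζ * ε) + nrm (T.lo i) (T.hi i) (Ψ i)), ?_,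
    fun i => ?_⟩
  · gcongr
    linarith
  · gcongr
    linarith
  · have h1 := T.sqrt_sum_sq_le (m := m⁻¹) (B := cζ * ε) hab (by positivity) (by positivity)
      hA.memLp hΨn
    calc _ ≤ _ := h1
      _ = cR * ε := by
        rw [hcR]
        ring
      _ ≤ _ := by
        gcongr
        linarith
  · have hi := (T.lo_lt_hi i).le
    have pτ := prim_antiderivFrom (T.lo i) (T.hi i) (T.lo i) (Z i.castSucc)
      (l2Proj (T.lo i) (T.hi i) k (Ψ i))
    refine nrm_sub_const_le_of_orthogonal (T.lo_lt_hi i) (hA.mono (T.a_le_lo i) (T.hi_le_b i)) hm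
      (fun x hx => hAm x (T.Icc_subset i hx)) (hζP i) (hτP i) (horth i) (by positivity) (hζb i) ?_
    have := pτ.nrm_sub_le hi
    rw [eval_antiderivFrom_self] at this
    exact this.trans (mul_le_mul_of_nonneg_left (nrm_l2Proj_le (T.lo_lt_hi i) k (hΨm i))
      (T.length_pos i).le)

end Dual

/-! ### The error of the weak finite element method -/

/-- The projection is the best approximation, and `R i` is the root of the mass of the density on
the element. The masses add up over any mesh, so no quasi-uniformity is needed. -/
theorem Approx.exists_mesh_bound {a b α M : ℝ} (hab : a ≤ b) {l r : ℕ} {g : ℝ → ℝ}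
    (h : Approx a b α M l g) (hM : 0 ≤ M) (hα : 0 ≤ α) (hlr : l ≤ r) {n : ℕ} (T : Mesh a b n) :
    ∃ R : Fin n → ℝ, (∀ i, 0 ≤ R i) ∧ √(∑ i, R i ^ 2) ≤ M ∧
      ∀ i, nrm (T.lo i) (T.hi i) (fun x => g x - (l2Proj (T.lo i) (T.hi i) r g).eval x) ≤
        T.size ^ α * R i := by
  obtain ⟨ρ, hρ, hh⟩ := h.exists_density
  have hρi : ∀ i, 0 ≤ ∫ x in T.lo i..T.hi i, ρ x := fun i => hρ.integral_nonneg (T.lo_lt_hi i).le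
  refine ⟨fun i => √(∫ x in T.lo i..T.hi i, ρ x), fun i => Real.sqrt_nonneg _, ?_, fun i => ?_⟩
  · refine Real.sqrt_le_iff.mpr ⟨hM, ?_⟩
    simp only [Real.sq_sqrt (hρi _)]
    rw [T.sum_integral hab hρ.1]
    exact hρ.3
  · obtain ⟨q, hq, hq'⟩ := hh _ _ (T.a_le_lo i) (T.lo_lt_hi i) (T.hi_le_b i)
    have hs := T.size_nonneg
    have hl := T.length_pos i
    refine nrm_le_of_sq_le (mul_nonneg (Real.rpow_nonneg hs _) (Real.sqrt_nonneg _)) ?_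
    refine (integral_sub_l2Proj_sq_le (T.lo_lt_hi i) r (T.memLp h.memLp i)
      (P_mono hlr hq)).trans (hq'.trans ?_)
    rw [mul_pow, Real.sq_sqrt (hρi i), ← Real.rpow_natCast (T.size ^ α), ← Real.rpow_mul hs]
    refine mul_le_mul_of_nonneg_right ?_ (hρi i)
    rw [mul_comm α, Nat.cast_ofNat]
    exact Real.rpow_le_rpow hl.le (T.length_le_size i) (by positivity)

/-- The projection error is nearly orthogonal to weighted polynomials. -/
theorem abs_integral_weight_mul_l2Proj_sub_le {y z : ℝ} (hyz : y < z) {A A₁ g : ℝ → ℝ}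
    (hA : Prim y z A A₁) {r : ℕ} (hg : MemLp g 2 (vol y z)) {q : ℝ[X]} (hq : q ∈ P r) {B : ℝ}
    (hB : 0 ≤ B) (hqB : ∀ x ∈ Icc y z, |q.eval x| ≤ B) :
    |∫ x in y..z, A x * ((l2Proj y z r g).eval x - g x) * q.eval x| ≤
      B * ((z - y) * nrm y z A₁) * nrm y z fun x => g x - (l2Proj y z r g).eval x := by
  have hi := hyz.le
  have m1 : MemLp (fun x => A x - A y) 2 (vol y z) := hA.memLp_self.sub (memLp_const_vol _ _ _)
  have m2 : MemLp (fun x => q.eval x * (A x - A y)) 2 (vol y z) :=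
    memLp_mul_of_continuousOn m1 q.continuous.continuousOn
  have m3 := memLp_sub_l2Proj r hg
  -- The projection error is orthogonal to `A(y) q`, so the weight `A` may be replaced by `A -
  -- A(y)`.
  have h0 := integral_sub_l2Proj_mul hyz r hg (Submodule.smul_mem _ (A y) hq)
  have e : ∫ x in y..z, A x * ((l2Proj y z r g).eval x - g x) * q.eval x =
      -∫ x in y..z, q.eval x * (A x - A y) * (g x - (l2Proj y z r g).eval x) := by
    have e1 : ∀ x, A x * ((l2Proj y z r g).eval x - g x) * q.eval x =
        -1 * (q.eval x * (A x - A y) * (g x - (l2Proj y z r g).eval x)) -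
          (g x - (l2Proj y z r g).eval x) * (A y • q).eval x := fun x => by
      rw [eval_smul, smul_eq_mul]
      ring
    simp only [e1]
    rw [intervalIntegral.integral_sub ((memLp_intervalIntegrable_mul m2 m3 hi).const_mul (-1))
      (memLp_intervalIntegrable_mul m3 (memLp_eval _ _ _) hi), h0,
      intervalIntegral.integral_const_mul, sub_zero, neg_one_mul]
  rw [e, abs_neg]
  refine (abs_integral_mul_le hi m2 m3).trans
    (mul_le_mul_of_nonneg_right ?_ (nrm_nonneg _ _ _))
  refine (nrm_le_mul hi hB m2 m1 ?_).trans (mul_le_mul_of_nonneg_left (hA.nrm_sub_le hi) hB)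
  filter_upwards [ae_restrict_mem measurableSet_Ioo] with x hx
  rw [abs_mul]
  exact mul_le_mul_of_nonneg_right (hqB x (Ioo_subset_Icc_self hx)) (abs_nonneg _)

/-- The flux error is orthogonal to constants. -/
theorem abs_integral_flux_error_mul_le {y z : ℝ} (hyz : y < z) {F Ψ : ℝ → ℝ} (hF : Prim y z F Ψ)
    {k : ℕ} (hk : 1 ≤ k) (q : ℝ[X]) (c : ℝ) :
    |∫ x in y..z, (F x - (antiderivFrom y (F y) (l2Proj y z k Ψ)).eval x) * q.eval x| ≤
      (z - y) * nrm y z (fun x => Ψ x - (l2Proj y z k Ψ).eval x) *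
        nrm y z fun x => q.eval x - c := by
  have hi := hyz.le
  have hD := hF.sub (prim_antiderivFrom y z y (F y) (l2Proj y z k Ψ))
  -- The projection preserves the mean of `Ψ`, so the flux error vanishes at the right endpoint as
  -- well.
  have hz : F z - (antiderivFrom y (F y) (l2Proj y z k Ψ)).eval z = 0 := by
    rw [eval_antiderivFrom, integral_l2Proj hyz k hF.memLp, hF.integral_eq ⟨le_rfl, hi⟩ ⟨hi, le_rfl⟩]
    ring
  -- Here `k ≥ 1` enters: integration by parts against `x`, to which the derivative of the flux
  -- error is orthogonal, gives the flux error mean zero.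
  have hX : (X : ℝ[X]) ∈ P k := by
    rw [mem_P_iff]
    intro m hm
    exact coeff_X_of_ne_one (by omega)
  have h1 := hD.integral_deriv_mul_eval hi X
  rw [integral_sub_l2Proj_mul hyz k hF.memLp hX, hz, eval_antiderivFrom_self, sub_self] at h1
  simp only [derivative_X, eval_one, mul_one, zero_mul, add_zero, sub_zero] at h1
  have h2 := neg_eq_zero.mp h1.symm
  have mq : MemLp (fun x => q.eval x - c) 2 (vol y z) :=
    (memLp_eval _ _ q).sub (memLp_const_vol _ _ c)
  have e : ∫ x in y..z, (F x - (antiderivFrom y (F y) (l2Proj y z k Ψ)).eval x) * q.eval x =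
      ∫ x in y..z, (F x - (antiderivFrom y (F y) (l2Proj y z k Ψ)).eval x) * (q.eval x - c) := by
    simp only [mul_sub _ _ c]
    rw [intervalIntegral.integral_sub
      (memLp_intervalIntegrable_mul hD.memLp_self (memLp_eval _ _ _) hi)
      (memLp_intervalIntegrable_mul hD.memLp_self (memLp_const_vol _ _ c) hi),
      intervalIntegral.integral_mul_const, h2, zero_mul, sub_zero]
  rw [e]
  refine (abs_integral_mul_le hi hD.memLp_self mq).trans
    (mul_le_mul_of_nonneg_right ?_ (nrm_nonneg _ _ _))
  simpa only [eval_antiderivFrom_self, sub_self, sub_zero] using hD.nrm_sub_le hi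

/-! ### The error equation. -/

section Error

variable {a b : ℝ} {n : ℕ} (T : Mesh a b n)

/-- The projection of a function to the space of weak functions. -/
noncomputable def projWeak (k : ℕ) (U : ℝ → ℝ) : WeakFun n where
  interior i := l2Proj (T.lo i) (T.hi i) k U
  left i := U (T.lo i)
  right i := U (T.hi i)

/-- The difference of two weak functions. -/
noncomputable def WeakFun.diff (v w : WeakFun n) : WeakFun n where
  interior i := v.interior i - w.interior i
  left i := v.left i - w.left i
  right i := v.right i - w.right i

theorem MemS.diff {k : ℕ} {v w : WeakFun n} (hv : MemS k v) (hw : MemS k w) :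
    MemS k (v.diff w) where
  interior_mem i := sub_mem (hv.interior_mem i) (hw.interior_mem i)
  left_zero i hi := by
    change v.left i - w.left i = 0
    rw [hv.left_zero i hi, hw.left_zero i hi, sub_zero]
  single_valued i j hij := by
    change v.right i - w.right i = v.left j - w.left j
    rw [hv.single_valued i j hij, hw.single_valued i j hij]

theorem dw_diff (r : ℕ) (v w : WeakFun n) (i : Fin n) :
    (v.diff w).dw T r i = v.dw T r i - w.dw T r i :=
  IsDiscreteWeakDeriv.eq (T.lo_lt_hi i)
    ((isDiscreteWeakDeriv_dw T r v i).sub (isDiscreteWeakDeriv_dw T r w i))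

theorem memS_projWeak (k : ℕ) {U V : ℝ → ℝ} (hU : Prim a b U V) (hUa : U a = 0) :
    MemS k (projWeak T k U) where
  interior_mem i := l2Proj_mem_P (T.lo_lt_hi i) k (T.memLp hU.memLp_self i)
  left_zero i hi := by
    change U (T.node i.castSucc) = 0
    have : i.castSucc = 0 := Fin.ext hi
    rw [this, T.node_zero, hUa]
  single_valued i j hij := by
    change U (T.node i.succ) = U (T.node j.castSucc)
    have : i.succ = j.castSucc := Fin.ext hij
    rw [this]

theorem dw_projWeak (k : ℕ) {U V : ℝ → ℝ} (hU : Prim a b U V) (i : Fin n) :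
    (projWeak T k U).dw T (k + 1) i = l2Proj (T.lo i) (T.hi i) (k + 1) V :=
  IsDiscreteWeakDeriv.eq (T.lo_lt_hi i)
    (isDiscreteWeakDeriv_l2Proj (T.lo_lt_hi i) k (hU.mono (T.a_le_lo i) (T.hi_le_b i)))

/-- The error equation. -/
theorem error_identity {k : ℕ} {A E U V Ψ : ℝ → ℝ} (hA : ContinuousOn A (Icc a b))
    (hE : ContinuousOn E (Icc a b)) (hU : Prim a b U V)
    (hF : Prim a b (fun x => A x * V x) Ψ) (hFb : A b * V b = 0) {uh v : WeakFun n}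
    (hv : MemS k v)
    (heq : wip T A (uh.dw T (k + 1)) (v.dw T (k + 1)) + wip T E uh.interior v.interior =
      ∑ i, ∫ x in T.lo i..T.hi i, (E x * U x - Ψ x) * (v.interior i).eval x) :
    wip T A (((projWeak T k U).diff uh).dw T (k + 1)) (v.dw T (k + 1)) +
        wip T E ((projWeak T k U).diff uh).interior v.interior =
      ∑ i, ((∫ x in T.lo i..T.hi i,
          A x * ((l2Proj (T.lo i) (T.hi i) (k + 1) V).eval x - V x) * (v.dw T (k + 1) i).eval x) +
        (∫ x in T.lo i..T.hi i, (A x * V x - (antiderivFrom (T.lo i) (A (T.lo i) * V (T.lo i))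
          (l2Proj (T.lo i) (T.hi i) k Ψ)).eval x) * (v.dw T (k + 1) i).eval x) +
        ∫ x in T.lo i..T.hi i,
          E x * ((l2Proj (T.lo i) (T.hi i) k U).eval x - U x) * (v.interior i).eval x) := by
  set d := v.dw T (k + 1)
  have e1 : ((projWeak T k U).diff uh).dw T (k + 1) =
      (fun i => l2Proj (T.lo i) (T.hi i) (k + 1) V) - uh.dw T (k + 1) := by
    ext1 i
    rw [dw_diff, dw_projWeak T k hU]
    rfl
  have e2 : ((projWeak T k U).diff uh).interior =
      (fun i => l2Proj (T.lo i) (T.hi i) k U) - uh.interior := rfl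
  rw [e1, e2, wip_sub_left T hA, wip_sub_left T hE]
  have hΨ : ∀ i, MemLp Ψ 2 (vol (T.lo i) (T.hi i)) := fun i => T.memLp hF.memLp i
  -- The discrete flux takes the values of `A V` at the nodes; the Neumann condition makes the last
  -- one zero.
  have hp := hv.sum_integral_dw_mul_flux T (Ψ := fun _ => Ψ) hΨ
    (Z := fun j => A (T.node j) * V (T.node j)) (by rw [T.node_last, hFb]) (fun i => by
      have := hF.integral_eq (T.lo_mem i) (T.hi_mem i)
      rw [this]
      change A (T.hi i) * V (T.hi i) = A (T.lo i) * V (T.lo i) + _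
      ring)
  have hVm : ∀ i, MemLp (fun x => A x * V x) 2 (vol (T.lo i) (T.hi i)) := fun i =>
    T.memLp hF.memLp_self i
  have hUm : ∀ i, MemLp (fun x => E x * U x) 2 (vol (T.lo i) (T.hi i)) := fun i =>
    memLp_mul_of_continuousOn (T.memLp hU.memLp_self i) (hE.mono (T.Icc_subset i))
  have hi := fun i => (T.lo_lt_hi i).le
  have h1 : ∀ i, ∫ x in T.lo i..T.hi i,
      A x * ((l2Proj (T.lo i) (T.hi i) (k + 1) V).eval x - V x) * (d i).eval x =
      (∫ x in T.lo i..T.hi i, A x * (l2Proj (T.lo i) (T.hi i) (k + 1) V).eval x * (d i).eval x) -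
        ∫ x in T.lo i..T.hi i, A x * V x * (d i).eval x := fun i => by
    rw [← intervalIntegral.integral_sub (intervalIntegrable_weight_mul T hA _ _ i)
      (memLp_intervalIntegrable_mul (hVm i) (memLp_eval _ _ _) (hi i))]
    simp only [mul_sub, sub_mul]
  have h2 : ∀ i, ∫ x in T.lo i..T.hi i, (A x * V x - (antiderivFrom (T.lo i)
      (A (T.lo i) * V (T.lo i)) (l2Proj (T.lo i) (T.hi i) k Ψ)).eval x) * (d i).eval x =
      (∫ x in T.lo i..T.hi i, A x * V x * (d i).eval x) -
        ∫ x in T.lo i..T.hi i, (d i).eval x * (flux T k (fun _ => Ψ)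
          (fun j => A (T.node j) * V (T.node j)) i).eval x := fun i => by
    rw [← intervalIntegral.integral_sub
      (memLp_intervalIntegrable_mul (hVm i) (memLp_eval _ _ _) (hi i))
      (intervalIntegrable_eval_mul _ _ _ _)]
    refine intervalIntegral.integral_congr fun x _ => ?_
    simp only [flux, Mesh.lo]
    ring
  have h3 : ∀ i, ∫ x in T.lo i..T.hi i,
      E x * ((l2Proj (T.lo i) (T.hi i) k U).eval x - U x) * (v.interior i).eval x =
      (∫ x in T.lo i..T.hi i, E x * (l2Proj (T.lo i) (T.hi i) k U).eval x *
        (v.interior i).eval x) - ∫ x in T.lo i..T.hi i, E x * U x * (v.interior i).eval x :=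
      fun i => by
    rw [← intervalIntegral.integral_sub (intervalIntegrable_weight_mul T hE _ _ i)
      (memLp_intervalIntegrable_mul (hUm i) (memLp_eval _ _ _) (hi i))]
    simp only [mul_sub, sub_mul]
  have h4 : ∑ i, ∫ x in T.lo i..T.hi i, (E x * U x - Ψ x) * (v.interior i).eval x =
      (∑ i, ∫ x in T.lo i..T.hi i, E x * U x * (v.interior i).eval x) -
        ∑ i, ∫ x in T.lo i..T.hi i, Ψ x * (v.interior i).eval x := by
    rw [← Finset.sum_sub_distrib]
    refine Finset.sum_congr rfl fun i _ => ?_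
    rw [← intervalIntegral.integral_sub
      (memLp_intervalIntegrable_mul (hUm i) (memLp_eval _ _ _) (hi i))
      (memLp_intervalIntegrable_mul (hΨ i) (memLp_eval _ _ _) (hi i))]
    simp only [sub_mul]
  simp only [h1, h2, h3, Finset.sum_add_distrib, Finset.sum_sub_distrib]
  rw [h4] at heq
  unfold wip at heq ⊢
  linarith

end Error

/-- The error estimate in terms of the approximation properties of the data. -/
theorem exists_interior_error_bound {a b : ℝ} (hab : a ≤ b) {k : ℕ} (hk : 1 ≤ k)
    {A A₁ E E₁ : ℝ → ℝ}
    (hA : Prim a b A A₁) (hE : Prim a b E E₁) {m : ℝ} (hm : 0 < m) (hAm : ∀ x ∈ Icc a b, m ≤ A x)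
    (hE₀ : ∀ x ∈ Icc a b, 0 ≤ E x) :
    ∃ C : ℝ, 0 ≤ C ∧ ∀ (s : ℝ) (U V Ψ : ℝ → ℝ) (M₁ M₂ M₃ : ℝ), 0 ≤ s → 0 ≤ M₁ → 0 ≤ M₂ → 0 ≤ M₃ →
      Prim a b U V → U a = 0 → Prim a b (fun x => A x * V x) Ψ → A b * V b = 0 →
      Approx a b (s + 1) M₁ (k + 1) V → Approx a b (s + 1) M₂ k U → Approx a b s M₃ k Ψ →
      ∀ (n : ℕ) (T : Mesh a b n) (uh : WeakFun n), MemS k uh →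
      (∀ v : WeakFun n, MemS k v →
        wip T A (uh.dw T (k + 1)) (v.dw T (k + 1)) + wip T E uh.interior v.interior =
          ∑ i, ∫ x in T.lo i..T.hi i, (E x * U x - Ψ x) * (v.interior i).eval x) →
      T.snrm (fun i x => (((projWeak T k U).diff uh).interior i).eval x) ≤
        C * (M₁ + M₂ + M₃) * T.size ^ (s + 2) := by
  obtain ⟨C, hC, hdual⟩ := exists_dual_bounds hab k hA hE.continuousOn hm hAm hE₀
  have hα := nrm_nonneg a b A₁
  have hβ := nrm_nonneg a b E₁
  refine ⟨C * (nrm a b A₁ + nrm a b E₁ + 1), by positivity, ?_⟩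
  intro s U V Ψ M₁ M₂ M₃ hs hM₁ hM₂ hM₃ hU hUa hF hFb aV aU aΨ n T uh huh heq
  set e := (projWeak T k U).diff uh with he
  have heS : MemS k e := (memS_projWeak T k hU hUa).diff huh
  obtain ⟨ζ, hζP, hζ, hζb, hzb, c, R, hR, hcR⟩ := hdual n T e.interior
  set ε := T.snrm fun i x => (e.interior i).eval x
  have hε : 0 ≤ ε := T.snrm_nonneg _
  have hvS := memS_ofDeriv T k ζ
  have hdw : (ofDeriv T k ζ).dw T (k + 1) = ζ := funext fun i => dw_ofDeriv T k (hζP i)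
  -- The dual equation tested with the derivative of the error itself has right side `ε ^ 2`, and
  -- its left side is that of the error equation for `v = ofDeriv T k ζ`.
  have h1 := hζ (e.dw T (k + 1)) fun i => dw_mem_P T (k + 1) e i
  have h2 := error_identity T hA.continuousOn hE.continuousOn hU hF hFb hvS (heq _ hvS)
  rw [hdw, ← he] at h2
  rw [← heS.interior_eq T, wip_one_self, h2] at h1
  obtain ⟨R₁, hR₁, hR₁M, hV⟩ := aV.exists_mesh_bound hab hM₁ (by linarith) le_rfl T
  obtain ⟨R₂, hR₂, hR₂M, hU'⟩ := aU.exists_mesh_bound hab hM₂ (by linarith) le_rfl T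
  obtain ⟨R₃, hR₃, hR₃M, hΨ⟩ := aΨ.exists_mesh_bound hab hM₃ hs le_rfl T
  set h := T.size
  have hh : 0 ≤ h := T.size_nonneg
  have hCε : 0 ≤ C * ε := mul_nonneg hC hε
  have hpow1 : h * h ^ (s + 1) = h ^ (s + 2) := by
    rw [show s + 2 = 1 + (s + 1) by ring, Real.rpow_add_of_nonneg hh zero_le_one (by linarith),
      Real.rpow_one]
  have hpow2 : h * h ^ s * h = h ^ (s + 2) := by
    rw [show s + 2 = (1 + s) + 1 by ring, Real.rpow_add_of_nonneg hh (by linarith) zero_le_one,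
      Real.rpow_add_of_nonneg hh zero_le_one hs, Real.rpow_one]
  have hhs : 0 ≤ h ^ s := Real.rpow_nonneg hh _
  have hhs1 : 0 ≤ h ^ (s + 1) := Real.rpow_nonneg hh _
  have hhs2 : 0 ≤ h ^ (s + 2) := Real.rpow_nonneg hh _
  -- Covers the first and third terms: `s + 1` powers of `h` from the projection error, one from the
  -- variation of the weight.
  have weighted : ∀ {W W₁ g : ℝ → ℝ} (_ : Prim a b W W₁) (_ : MemLp g 2 (vol a b)) {r : ℕ}
      {q : ℝ[X]} (i : Fin n) (_ : q ∈ P r) (_ : ∀ x ∈ Icc (T.lo i) (T.hi i), |q.eval x| ≤ C * ε)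
      {ρ : ℝ} (_ : nrm (T.lo i) (T.hi i)
        (fun x => g x - (l2Proj (T.lo i) (T.hi i) r g).eval x) ≤ h ^ (s + 1) * ρ),
      ∫ x in T.lo i..T.hi i, W x * ((l2Proj (T.lo i) (T.hi i) r g).eval x - g x) * q.eval x ≤
        C * ε * h ^ (s + 2) * (nrm (T.lo i) (T.hi i) W₁ * ρ) := by
    intro W W₁ g hW hg r q i hq hqb ρ hρ
    refine (le_abs_self _).trans ((abs_integral_weight_mul_l2Proj_sub_le (T.lo_lt_hi i)
      (hW.mono (T.a_le_lo i) (T.hi_le_b i)) (T.memLp hg i) hq hCε hqb).trans ?_)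
    have hn := nrm_nonneg (T.lo i) (T.hi i) W₁
    calc _ ≤ C * ε * (h * nrm (T.lo i) (T.hi i) W₁) * (h ^ (s + 1) * ρ) := by
          refine mul_le_mul ?_ hρ (nrm_nonneg _ _ _) (by positivity)
          exact mul_le_mul_of_nonneg_left
            (mul_le_mul_of_nonneg_right (T.length_le_size i) hn) hCε
      _ = _ := by
          rw [← hpow1]
          ring
  have cs : ∀ {W₁ : ℝ → ℝ} (_ : MemLp W₁ 2 (vol a b)) (ρ : Fin n → ℝ) {M : ℝ}
      (_ : √(∑ i, ρ i ^ 2) ≤ M),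
      ∑ i, nrm (T.lo i) (T.hi i) W₁ * ρ i ≤ nrm a b W₁ * M := by
    intro W₁ hW ρ M hρ
    refine (Real.sum_mul_le_sqrt_mul_sqrt _ _ _).trans ?_
    have : √(∑ i, nrm (T.lo i) (T.hi i) W₁ ^ 2) = nrm a b W₁ := T.snrm_const hab hW
    rw [this]
    exact mul_le_mul_of_nonneg_left hρ (nrm_nonneg _ _ _)
  -- The powers of `h`: `s` from projecting `Ψ`, one from integrating the projection error, one from
  -- subtracting the constant `c i` from `ζ`.
  have b2 : ∀ i, ∫ x in T.lo i..T.hi i, (A x * V x - (antiderivFrom (T.lo i)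
      (A (T.lo i) * V (T.lo i)) (l2Proj (T.lo i) (T.hi i) k Ψ)).eval x) * (ζ i).eval x ≤
      h ^ (s + 2) * (R₃ i * R i) := by
    intro i
    refine (le_abs_self _).trans ((abs_integral_flux_error_mul_le (T.lo_lt_hi i)
      (hF.mono (T.a_le_lo i) (T.hi_le_b i)) hk (ζ i) (c i)).trans ?_)
    have hRi : 0 ≤ R i := by
      have := (nrm_nonneg _ _ _).trans (hcR i)
      exact nonneg_of_mul_nonneg_right this (T.length_pos i)
    have hl := T.length_le_size i
    have hR3i := hR₃ i
    calc _ ≤ h * (h ^ s * R₃ i) * (h * R i) := by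
          refine mul_le_mul (mul_le_mul hl (hΨ i) (nrm_nonneg _ _ _) hh)
            ((hcR i).trans (mul_le_mul_of_nonneg_right hl hRi)) (nrm_nonneg _ _ _) (by positivity)
      _ = _ := by
          rw [← hpow2]
          ring
  have hRR : ∑ i, R₃ i * R i ≤ M₃ * (C * ε) :=
    (Real.sum_mul_le_sqrt_mul_sqrt _ _ _).trans (mul_le_mul hR₃M hR (Real.sqrt_nonneg _) hM₃)
  have total : ε ^ 2 ≤ C * ε * h ^ (s + 2) * (nrm a b A₁ * M₁) + h ^ (s + 2) * (M₃ * (C * ε)) +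
      C * ε * h ^ (s + 2) * (nrm a b E₁ * M₂) := by
    rw [← h1, Finset.sum_add_distrib, Finset.sum_add_distrib]
    refine add_le_add (add_le_add ?_ ?_) ?_
    · refine (Finset.sum_le_sum fun i _ =>
        weighted hA aV.memLp i (hζP i) (hζb i) (hV i)).trans ?_
      rw [← Finset.mul_sum]
      exact mul_le_mul_of_nonneg_left (cs hA.memLp R₁ hR₁M) (by positivity)
    · refine (Finset.sum_le_sum fun i _ => b2 i).trans ?_
      rw [← Finset.mul_sum]
      exact mul_le_mul_of_nonneg_left hRR hhs2
    · refine (Finset.sum_le_sum fun i _ =>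
        weighted hE aU.memLp i (hvS.interior_mem i) (hzb i) (hU' i)).trans ?_
      rw [← Finset.mul_sum]
      exact mul_le_mul_of_nonneg_left (cs hE.memLp R₂ hR₂M) (by positivity)
  have bound : nrm a b A₁ * M₁ + M₃ + nrm a b E₁ * M₂ ≤
      (nrm a b A₁ + nrm a b E₁ + 1) * (M₁ + M₂ + M₃) := by
    nlinarith [mul_nonneg hα hM₂, mul_nonneg hα hM₃, mul_nonneg hβ hM₁, mul_nonneg hβ hM₃]
  rcases hε.eq_or_lt with h0 | h0
  · rw [← h0]
    positivity
  · refine le_of_mul_le_mul_right ?_ h0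
    calc ε * ε = ε ^ 2 := by ring
      _ ≤ _ := total
      _ = C * ε * h ^ (s + 2) * (nrm a b A₁ * M₁ + M₃ + nrm a b E₁ * M₂) := by ring
      _ ≤ C * ε * h ^ (s + 2) * ((nrm a b A₁ + nrm a b E₁ + 1) * (M₁ + M₂ + M₃)) :=
          mul_le_mul_of_nonneg_left bound (by positivity)
      _ = _ := by ring

/-! ### The main estimate -/

theorem le_of_ae_le_of_continuousOn {a b : ℝ} (hab : a < b) {f g : ℝ → ℝ}
    (hf : ContinuousOn f (Icc a b)) (hg : ContinuousOn g (Icc a b))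
    (h : ∀ᵐ x ∂vol a b, f x ≤ g x) : ∀ x ∈ Icc a b, f x ≤ g x := by
  by_contra! hcon
  obtain ⟨c, hc, hlt⟩ := hcon
  have hpos : 0 < ∫ x in a..b, max (f x - g x) 0 :=
    intervalIntegral.integral_pos hab (ContinuousOn.sup (hf.sub hg) continuousOn_const)
      (fun x _ => le_max_right _ _) ⟨c, hc, lt_max_of_lt_left (sub_pos.mpr hlt)⟩
  have hz : ∫ x in a..b, max (f x - g x) 0 = 0 := by
    rw [← integral_Ioo_eq_interval hab.le]
    refine integral_eq_zero_of_ae ?_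
    filter_upwards [h] with x hx
    exact max_eq_right (sub_nonpos.mpr hx)
  exact hpos.ne' hz

theorem eq_of_ae_eq_of_continuousOn {a b : ℝ} (hab : a < b) {f g : ℝ → ℝ}
    (hf : ContinuousOn f (Icc a b)) (hg : ContinuousOn g (Icc a b))
    (h : ∀ᵐ x ∂vol a b, f x = g x) : ∀ x ∈ Icc a b, f x = g x := fun x hx =>
  le_antisymm (le_of_ae_le_of_continuousOn hab hf hg (h.mono fun _ h => h.le) x hx)
    (le_of_ae_le_of_continuousOn hab hg hf (h.mono fun _ h => h.ge) x hx)

theorem Prim.hasDerivWithinAt_right {a b : ℝ} (hab : a < b) {F f : ℝ → ℝ} (h : Prim a b F f)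
    (hf : ContinuousOn f (Icc a b)) : HasDerivWithinAt F (f b) (Icc a b) b := by
  have hb : b ∈ Icc a b := ⟨hab.le, le_rfl⟩
  -- Constant extension makes the integrand continuous on the line, so the fundamental theorem
  -- applies at the endpoint `b`.
  set f' := IccExtend hab.le ((Icc a b).domRestrict f) with hf'
  have hc : Continuous f' := hf.domRestrict.Icc_extend'
  have hff : ∀ x ∈ Icc a b, f' x = f x := fun x hx => by
    rw [hf', IccExtend_of_mem _ _ hx]
    rfl
  have hd : HasDerivAt (fun x => F a + ∫ t in a..x, f' t) (f' b) b :=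
    (intervalIntegral.integral_hasDerivAt_right (hc.intervalIntegrable _ _)
      (hc.stronglyMeasurableAtFilter _ _) hc.continuousAt).const_add _
  rw [hff b hb] at hd
  have he : ∀ x ∈ Icc a b, F x = F a + ∫ t in a..x, f' t := fun x hx => by
    rw [h.ftc x hx]
    congr 1
    refine intervalIntegral.integral_congr fun t ht => (hff t ?_).symm
    rw [uIcc_of_le hx.1] at ht
    exact ⟨ht.1, ht.2.trans hx.2⟩
  exact hd.hasDerivWithinAt.congr he (he b hb)

/-- Approximation of `u ∈ H^{s+2}` by polynomials of degree `k ≥ s` with order `s + 1`. -/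
theorem exists_approx_solution {a b : ℝ} (hab : a < b) {k : ℕ} {s : ℝ} (hs₀ : 0 ≤ s)
    (hsk : s ≤ k) : ∃ C : ℝ, 0 ≤ C ∧ ∀ (U : ℕ → ℝ → ℝ) (N : ℝ),
      (∀ j < ⌊s⌋₊ + 2, Prim a b (U j) (U (j + 1))) → (∀ j ≤ ⌊s⌋₊ + 2, nrm a b (U j) ≤ N) →
      Approx a b (s + 1) (C * N) k (U 0) := by
  have hba : 0 < b - a := by linarith
  have hS := supConst_nonneg a b
  have hmk : ⌊s⌋₊ ≤ k := Nat.floor_le_of_le hsk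
  rcases hmk.lt_or_eq with hlt | heq
  -- If `⌊s⌋ < k`, there is room for degree `⌊s⌋ + 1`, whose order `⌊s⌋ + 2` exceeds `s + 1`.
  · refine ⟨(b - a) ^ (1 + ((⌊s⌋₊ + 1 : ℕ) : ℝ) - (s + 1)) *
      ((1 + supConst a b) * (b - a) ^ (1 - 1 : ℝ)), by positivity, fun U N hU hN => ?_⟩
    have hr := (hU (⌊s⌋₊ + 1) (by omega)).reg hab le_rfl (hN _ (by omega)) (hN _ (by omega))
    have h1 := Approx.lift_iterate (⌊s⌋₊ + 1) (fun j hj => hU j (by omega)) hr.approx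
    rw [zero_add] at h1
    have h2 := (h1.mono_degree hlt).mono_order (α := s + 1) (by
      have := (Nat.lt_floor_add_one s).le
      push_cast
      linarith)
    rwa [← mul_assoc] at h2
  -- If `⌊s⌋ = k`, then `s = k` is an integer and degree `k` gives the order `k + 1 = s + 1`
  -- exactly.
  · refine ⟨(1 + supConst a b) * (b - a) ^ (1 - 1 : ℝ), by positivity, fun U N hU hN => ?_⟩
    have hr := (hU ⌊s⌋₊ (by omega)).reg hab le_rfl (hN _ (by omega)) (hN _ (by omega))
    have h1 := Approx.lift_iterate ⌊s⌋₊ (fun j hj => hU j (by omega)) hr.approx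
    have hs : (⌊s⌋₊ : ℝ) = s := le_antisymm (Nat.floor_le hs₀) (by rw [heq]; exact hsk)
    rwa [zero_add, hs, add_comm 1 s, heq] at h1

theorem interiorError_eq_snrm {a b : ℝ} {n : ℕ} (T : Mesh a b n) (k : ℕ) {u U : ℝ → ℝ}
    (h : ∀ᵐ x ∂vol a b, u x = U x) (uh : WeakFun n) :
    interiorError T k u uh =
      T.snrm fun i x => (((projWeak T k U).diff uh).interior i).eval x := by
  have hs := T.snrm_nonneg fun i x => (((projWeak T k U).diff uh).interior i).eval x
  rw [← Real.sqrt_sq hs, T.snrm_sq']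
  unfold interiorError
  congr 1
  refine Finset.sum_congr rfl fun i _ => ?_
  rw [l2Proj_congr (T.lo_lt_hi i).le k
    (ae_mono (Measure.restrict_mono (Ioo_subset_Ioo (T.a_le_lo i) (T.hi_le_b i)) le_rfl) h)]
  simp only [WeakFun.diff, projWeak, eval_sub]

/-- The finite element equations in terms of representatives of the data. -/
theorem IsWeakFESolution.congr {a b : ℝ} {n : ℕ} {T : Mesh a b n} {k r : ℕ}
    {a₂ a₀ f A E g : ℝ → ℝ} {uh : WeakFun n} (h : IsWeakFESolution T k r a₂ a₀ f uh)
    (hA : ∀ᵐ x ∂vol a b, a₂ x = A x) (hE : ∀ᵐ x ∂vol a b, a₀ x = E x)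
    (hf : ∀ᵐ x ∂vol a b, f x = g x) {v : WeakFun n} (hv : MemS k v) :
    wip T A (uh.dw T r) (v.dw T r) + wip T E uh.interior v.interior =
      ∑ i, ∫ x in T.lo i..T.hi i, g x * (v.interior i).eval x := by
  have e := h.2 v hv
  unfold wip
  have hA' := fun i => integral_congr_sub hA (T.a_le_lo i) (T.lo_lt_hi i).le (T.hi_le_b i)
    fun x t => t * (uh.dw T r i).eval x * (v.dw T r i).eval x
  have hE' := fun i => integral_congr_sub hE (T.a_le_lo i) (T.lo_lt_hi i).le (T.hi_le_b i)
    fun x t => t * (uh.interior i).eval x * (v.interior i).eval x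
  have hf' := fun i => integral_congr_sub hf (T.a_le_lo i) (T.lo_lt_hi i).le (T.hi_le_b i)
    fun x t => t * (v.interior i).eval x
  simp only [hA', hE', hf'] at e
  exact e

end WeakFEM

theorem theorem4p5 (a b : ℝ) (hab : a < b) (k : ℕ) (hk : 1 ≤ k)
    (s : ℝ) (hs₀ : 0 ≤ s) (hsk : s ≤ k)
    (amin : ℝ) (hamin : 0 < amin) (a₂ a₀ : ℝ → ℝ)
    (ha₂ : WeakFEM.MemH a b (1 + s) a₂) (ha₂_ge : ∀ᵐ x ∂WeakFEM.vol a b, amin ≤ a₂ x)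
    (ha₀ : WeakFEM.MemH a b 1 a₀) (ha₀_ge : ∀ᵐ x ∂WeakFEM.vol a b, 0 ≤ a₀ x) :
    ∃ C : ℝ, 0 < C ∧
      ∀ (f u : ℝ → ℝ), MeasureTheory.MemLp f 2 (WeakFEM.vol a b) →
        WeakFEM.IsSolution a b a₂ a₀ f u → WeakFEM.MemH a b (s + 2) u →
        ∀ (n : ℕ) (T : WeakFEM.Mesh a b n) (uh : WeakFEM.WeakFun n),
          WeakFEM.IsWeakFESolution T k (k + 1) a₂ a₀ f uh →
          WeakFEM.interiorError T k u uh ≤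
            C * T.size ^ (s + 2) * WeakFEM.normH a b (s + 2) u := by
  open WeakFEM in
  set m := ⌊s⌋₊ with hm
  set θ := Int.fract s with hθ
  have hsm : θ + m = s := by
    rw [hθ, hm, natCast_floor_eq_intCast_floor hs₀]
    exact Int.fract_add_floor s
  have hθ₁ : θ < 1 := Int.fract_lt_one s
  have hmk : m ≤ k := Nat.floor_le_of_le hsk
  have fl1 : ⌊1 + s⌋₊ = m + 1 := by rw [add_comm, Nat.floor_add_one hs₀]
  have fl2 : ⌊s + 2⌋₊ = m + 2 := Nat.floor_add_ofNat hs₀ 2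
  have fr1 : Int.fract (1 + s) = θ := by rw [add_comm, Int.fract_add_one]
  have fr2 : Int.fract (s + 2) = θ := Int.fract_add_ofNat s 2
  obtain ⟨A, hA, hAm, hAw, hAe⟩ := ha₂.exists_derivatives hab
  obtain ⟨E, hE, -, -, hEe⟩ := ha₀.exists_derivatives hab
  have hA1 : Prim a b (A 0) (A 1) := hA 0 (by omega)
  have hE1 : Prim a b (E 0) (E 1) := hE 0 (by simp)
  have hAge : ∀ x ∈ Icc a b, amin ≤ A 0 x :=
    le_of_ae_le_of_continuousOn hab continuousOn_const hA1.continuousOn (by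
      filter_upwards [ha₂_ge, hAe] with x h1 h2
      rwa [← h2])
  have hEge : ∀ x ∈ Icc a b, 0 ≤ E 0 x :=
    le_of_ae_le_of_continuousOn hab continuousOn_const hE1.continuousOn (by
      filter_upwards [ha₀_ge, hEe] with x h1 h2
      rwa [← h2])
  set K := 1 + meanConst a b θ with hK
  have hK₀ : 0 ≤ K := by
    have := meanConst_nonneg hab.le hθ₁
    linarith
  set α := normH a b (1 + s) a₂ with hα
  have hα₀ : 0 ≤ α := normH_nonneg _ _ _ _
  have hAreg := ha₂.reg hab (hAm _ le_rfl) (hAw _ le_rfl)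
  rw [fr1, fl1] at hAreg
  have hAn : ∀ j ≤ m + 1, nrm a b (A j) ≤ α := fun j hj =>
    nrm_le_normH hab (by omega) (hAw j (by omega))
  obtain ⟨C₀, hC₀, main⟩ := exists_interior_error_bound hab.le hk hA1 hE1 hamin hAge hEge
  obtain ⟨C₂, hC₂, aU⟩ := exists_approx_solution hab hs₀ hsk
  obtain ⟨C₃, hC₃, aΨ⟩ := exists_approx_leibniz hab hθ₁.le m hK₀
  -- The three summands belong to the approximation of `V`, `U` and `Ψ`; `1` is added only to make
  -- the constant positive.
  refine ⟨C₀ * (K + C₂ + C₃ * α) + 1, by positivity, fun f u _ hsol hu n T uh huh => ?_⟩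
  obtain ⟨U, hU, hUm, hUw, hUe⟩ := hu.exists_derivatives hab
  have hureg := hu.reg hab (hUm _ le_rfl) (hUw _ le_rfl)
  rw [fr2, fl2] at hureg
  set N := normH a b (s + 2) u with hN
  have hN₀ : 0 ≤ N := normH_nonneg _ _ _ _
  have hUn : ∀ j ≤ m + 2, nrm a b (U j) ≤ N := fun j hj =>
    nrm_le_normH hab (by omega) (hUw j (by omega))
  have hU' : ∀ j < m + 2, Prim a b (U j) (U (j + 1)) := fun j hj => hU j (by omega)
  have hA' : ∀ j < m + 1, Prim a b (A j) (A (j + 1)) := fun j hj => hA j (by omega)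
  set V : ℕ → ℝ → ℝ := fun j => U (j + 1) with hV
  have hV' : ∀ j < m + 1, Prim a b (V j) (V (j + 1)) := fun j hj => hU' (j + 1) (by omega)
  have hU0 : Prim a b (U 0) (V 0) := hU' 0 (by omega)
  have hVc : ContinuousOn (V 0) (Icc a b) := (hV' 0 (by omega)).continuousOn
  have hUu := eq_of_ae_eq_of_continuousOn hab hsol.memHE.2.1 hU0.continuousOn hUe
  have ha_mem : a ∈ Icc a b := ⟨le_rfl, hab.le⟩
  have hb_mem : b ∈ Icc a b := ⟨hab.le, le_rfl⟩
  have hUa : U 0 a = 0 := by rw [← hUu a ha_mem, hsol.memHE.2.2]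
  -- As `V` is continuous, its value at `b` is the one-sided derivative of `U`, which the Neumann
  -- condition sets to zero.
  have hVb : V 0 b = 0 := by
    have h1 := hU0.hasDerivWithinAt_right hab hVc
    have h2 := hsol.neumann.congr (fun x hx => (hUu x hx).symm) (hUu b hb_mem).symm
    exact (uniqueDiffOn_Icc hab b hb_mem).eq_deriv _ h1 h2
  have hF : Prim a b (fun x => A 0 x * V 0 x) (leibniz A V 1) := by
    have := prim_leibniz (l := 0) (fun j hj => hA' j (by omega)) (fun j hj => hV' j (by omega))
    have e : leibniz A V 0 = fun x => A 0 x * V 0 x := by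
      ext x
      simp [leibniz]
    rwa [e] at this
  -- Uniqueness of weak derivatives identifies `(A V)'`, computed by the product rule, with `a₀ u -
  -- f`; this removes `f` from the estimate.
  have hΨf : ∀ᵐ x ∂vol a b, f x = E 0 x * U 0 x - leibniz A V 1 x := by
    have hw : HasWeakDeriv a b 1 (fun x => A 0 x * V 0 x) fun x => a₀ x * u x - f x :=
      hsol.eqn.congr_left (by
        filter_upwards [hAe, hUw 1 (by omega)] with x h1 h2
        rw [h1, ← h2]) (memLp_locallyIntegrableOn hF.memLp_self)
    filter_upwards [hw.ae_unique (hF.hasWeakDeriv hab.le), hEe, hUe] with x h1 h2 h3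
    rw [← h1, ← h2, ← h3]
    ring
  -- The top derivative of `u`, of order `⌊s⌋ + 2`, is integrated `⌊s⌋ + 1` times, from order `fract
  -- s` up to `s + 1`.
  have apV : Approx a b (s + 1) (K * N) (k + 1) (V 0) := by
    have h1 := Approx.lift_iterate (m + 1) hV' hureg.approx
    rw [zero_add] at h1
    have h2 := h1.mono_degree (Nat.succ_le_succ hmk)
    rwa [Nat.cast_succ, ← add_assoc, hsm] at h2
  have apU : Approx a b (s + 1) (C₂ * N) k (U 0) := aU U N hU' hUn
  have apΨ : Approx a b s (C₃ * (α * N)) k (leibniz A V 1) := by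
    have h1 := aΨ A V α N hA' hV' hAn (fun j hj => hUn (j + 1) (by omega)) hAreg hureg
    rw [hsm] at h1
    exact h1.mono_degree hmk
  have key := main s (U 0) (V 0) (leibniz A V 1) (K * N) (C₂ * N) (C₃ * (α * N)) hs₀ (by positivity)
    (by positivity) (by positivity) hU0 hUa hF (by rw [hVb, mul_zero]) apV apU apΨ n T uh huh.1
    fun v hv => huh.congr hAe hEe hΨf hv
  rw [interiorError_eq_snrm T k hUe uh]
  have hpow : 0 ≤ T.size ^ (s + 2) := Real.rpow_nonneg T.size_nonneg _
  calc _ ≤ _ := key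
    _ = C₀ * (K + C₂ + C₃ * α) * T.size ^ (s + 2) * N := by ring
    _ ≤ _ := by
      gcongr
      linarith
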